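/- Let $\mathsf{sVW}$ be the affine VW supercategory: the $\mathbb{C}$-linear strict monoidal supercategory generated by one object $\star$, even morphisms $s:\star\otimes\star\to\star\otimes\star$ and $y:\star\to\star$, and odd morphisms $b:\star\otimes\star\to\mathbb{1}$ and $b^*:\mathbb{1}\to\star\otimes\star$, subject to the super interchange law $(f\otimes g)\circ(h\otimes k)=(-1)^{\bar g\,\bar h}(f\circ h)\otimes(g\circ k)$ and the relations $$s^2=1,\qquad (s\otimes 1)(1\otimes s)(s\otimes 1)=(1\otimes s)(s\otimes 1)(1\otimes s),$$ $$(b\otimes 1)(1\otimes b^*)=-1,\qquad (1\otimes b)(b^*\otimes 1)=1,$$ $$(1\otimes s)(b^*\otimes 1)=(s\otimes 1)(1\otimes b^*),\qquad s\,b^*=-b^*,$$ $$1\otimes y=s\,(y\otimes 1)\,s+s+b^*b,\qquad b\,(1\otimes y)=b\,(y\otimes 1)+b .$$ Fix $a\ge 2$, let $\mathsf{sVW}_a=\mathrm{End}_{\mathsf{sVW}}(\star^{\otimes a})$ be the affine VW superalgebra, and for $1\le i\le a$ let $y_i=1_{i-1}\otimes y\otimes 1_{a-i}\in \mathsf{sVW}_a$,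 where $1_k$ denotes the identity of $\star^{\otimes k}$. Theorem. The commuting elements $y_1,\dots,y_a$ are algebraically independent, so that $\mathbb{C}[y_1,\dots,y_a]$ is a polynomial subalgebra of $\mathsf{sVW}_a$, and the centre of $\mathsf{sVW}_a$ consists exactly of the elements $$D_1\cdot\tilde f+c,\qquad \tilde f\in\mathbb{C}[y_1,\dots,y_a]^{S_a},\quad c\in\mathbb{C},$$ where $D_1=\prod_{1\le i<j\le a}\bigl((y_i-y_j)^2-1\bigr)$ is the deformed squared Vandermonde. -/

import Mathlib

open CategoryTheory

namespace AffineVW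

/-- Expressions for the morphisms `m ⟶ n` of the `ℂ`-linear strict monoidal supercategory generated
by one object `⋆` (whose `n`-th tensor power is written `n`) and the morphisms
`s : ⋆ ⊗ ⋆ ⟶ ⋆ ⊗ ⋆` (crossing), `b : ⋆ ⊗ ⋆ ⟶ 𝟙` (cap), `bs : 𝟙 ⟶ ⋆ ⊗ ⋆` (cup, usually written
`b*`) and `y : ⋆ ⟶ ⋆` (dot): everything obtained from the generators and identities by vertical
composition (`comp f g` is `f ∘ g`, that is `f` on top of `g`), horizontal composition
(`tensor f g` is `f ⊗ g`, that is `f` to the left of `g`) and linear combinations.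
The equations in `tensor` only record the source and target; they make it possible to state
strict associativity without casts. -/
inductive Diag : ℕ → ℕ → Type
  | id (n : ℕ) : Diag n n
  | s : Diag 2 2
  | b : Diag 2 0
  | bs : Diag 0 2
  | y : Diag 1 1
  | comp {l m n : ℕ} (f : Diag m n) (g : Diag l m) : Diag l n
  | tensor {m n m' n' k l : ℕ} (f : Diag m n) (g : Diag m' n')
      (hk : k = m + m') (hl : l = n + n') : Diag k l
  | zero (m n : ℕ) : Diag m n
  | add {m n : ℕ} (f g : Diag m n) : Diag m n
  | smul {m n : ℕ} (c : ℂ) (f : Diag m n) : Diag m n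

namespace Diag

/-- `HasParity f p`: the expression `f` is homogeneous of parity `p`. The crossing and the dot are
even, the cap and the cup are odd. -/
inductive HasParity : ∀ {m n : ℕ}, Diag m n → ZMod 2 → Prop
  | id (n : ℕ) : HasParity (id n) 0
  | s : HasParity s 0
  | b : HasParity b 1
  | bs : HasParity bs 1
  | y : HasParity y 0
  | comp {l m n : ℕ} {f : Diag m n} {g : Diag l m} {p q : ZMod 2} :
      HasParity f p → HasParity g q → HasParity (comp f g) (p + q)
  | tensor {m n m' n' k l : ℕ} {f : Diag m n} {g : Diag m' n'} {p q : ZMod 2}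
      (hk : k = m + m') (hl : l = n + n') :
      HasParity f p → HasParity g q → HasParity (tensor f g hk hl) (p + q)
  | zero (m n : ℕ) (p : ZMod 2) : HasParity (zero m n) p
  | add {m n : ℕ} {f g : Diag m n} {p : ZMod 2} :
      HasParity f p → HasParity g p → HasParity (add f g) p
  | smul {m n : ℕ} {f : Diag m n} {p : ZMod 2} (c : ℂ) :
      HasParity f p → HasParity (smul c f) p

/-- The relations of the affine VW supercategory: the smallest congruence on expressions that
contains the axioms of a `ℂ`-linear strict monoidal supercategory and the defining relations. -/
inductive Rel : ∀ {m n : ℕ}, Diag m n → Diag m n → Prop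
  -- equivalence relation
  | refl {m n : ℕ} (f : Diag m n) : Rel f f
  | symm {m n : ℕ} {f g : Diag m n} : Rel f g → Rel g f
  | trans {m n : ℕ} {f g h : Diag m n} : Rel f g → Rel g h → Rel f h
  -- compatible with all operations
  | comp_congr {l m n : ℕ} {f f' : Diag m n} {g g' : Diag l m} :
      Rel f f' → Rel g g' → Rel (comp f g) (comp f' g')
  | tensor_congr {m n m' n' k l : ℕ} {f f' : Diag m n} {g g' : Diag m' n'}
      (hk : k = m + m') (hl : l = n + n') :
      Rel f f' → Rel g g' → Rel (tensor f g hk hl) (tensor f' g' hk hl)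
  | add_congr {m n : ℕ} {f f' g g' : Diag m n} :
      Rel f f' → Rel g g' → Rel (add f g) (add f' g')
  | smul_congr {m n : ℕ} (c : ℂ) {f f' : Diag m n} :
      Rel f f' → Rel (smul c f) (smul c f')
  -- the morphism sets are vector spaces
  | add_assoc {m n : ℕ} (f g h : Diag m n) : Rel (add (add f g) h) (add f (add g h))
  | add_comm {m n : ℕ} (f g : Diag m n) : Rel (add f g) (add g f)
  | zero_add {m n : ℕ} (f : Diag m n) : Rel (add (zero m n) f) f
  | neg_add {m n : ℕ} (f : Diag m n) : Rel (add (smul (-1) f) f) (zero m n)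
  | one_smul {m n : ℕ} (f : Diag m n) : Rel (smul 1 f) f
  | mul_smul {m n : ℕ} (c d : ℂ) (f : Diag m n) : Rel (smul (c * d) f) (smul c (smul d f))
  | smul_add {m n : ℕ} (c : ℂ) (f g : Diag m n) :
      Rel (smul c (add f g)) (add (smul c f) (smul c g))
  | add_smul {m n : ℕ} (c d : ℂ) (f : Diag m n) :
      Rel (smul (c + d) f) (add (smul c f) (smul d f))
  -- vertical composition is bilinear, associative and unital
  | add_comp {l m n : ℕ} (f f' : Diag m n) (g : Diag l m) :
      Rel (comp (add f f') g) (add (comp f g) (comp f' g))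
  | comp_add {l m n : ℕ} (f : Diag m n) (g g' : Diag l m) :
      Rel (comp f (add g g')) (add (comp f g) (comp f g'))
  | smul_comp {l m n : ℕ} (c : ℂ) (f : Diag m n) (g : Diag l m) :
      Rel (comp (smul c f) g) (smul c (comp f g))
  | comp_smul {l m n : ℕ} (c : ℂ) (f : Diag m n) (g : Diag l m) :
      Rel (comp f (smul c g)) (smul c (comp f g))
  | comp_assoc {k l m n : ℕ} (f : Diag m n) (g : Diag l m) (h : Diag k l) :
      Rel (comp (comp f g) h) (comp f (comp g h))
  | id_comp {m n : ℕ} (f : Diag m n) : Rel (comp (id n) f) f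
  | comp_id {m n : ℕ} (f : Diag m n) : Rel (comp f (id m)) f
  -- horizontal composition is bilinear, strictly associative and strictly unital
  | add_tensor {m n m' n' k l : ℕ} (f f' : Diag m n) (g : Diag m' n')
      (hk : k = m + m') (hl : l = n + n') :
      Rel (tensor (add f f') g hk hl) (add (tensor f g hk hl) (tensor f' g hk hl))
  | tensor_add {m n m' n' k l : ℕ} (f : Diag m n) (g g' : Diag m' n')
      (hk : k = m + m') (hl : l = n + n') :
      Rel (tensor f (add g g') hk hl) (add (tensor f g hk hl) (tensor f g' hk hl))
  | smul_tensor {m n m' n' k l : ℕ} (c : ℂ) (f : Diag m n) (g : Diag m' n')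
      (hk : k = m + m') (hl : l = n + n') :
      Rel (tensor (smul c f) g hk hl) (smul c (tensor f g hk hl))
  | tensor_smul {m n m' n' k l : ℕ} (c : ℂ) (f : Diag m n) (g : Diag m' n')
      (hk : k = m + m') (hl : l = n + n') :
      Rel (tensor f (smul c g) hk hl) (smul c (tensor f g hk hl))
  | tensor_assoc {m₁ n₁ m₂ n₂ m₃ n₃ k l k' l' m n : ℕ}
      (f : Diag m₁ n₁) (g : Diag m₂ n₂) (h : Diag m₃ n₃)
      (hk : k = m₁ + m₂) (hl : l = n₁ + n₂) (hk' : k' = m₂ + m₃) (hl' : l' = n₂ + n₃)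
      (hm : m = k + m₃) (hn : n = l + n₃) (hm' : m = m₁ + k') (hn' : n = n₁ + l') :
      Rel (tensor (tensor f g hk hl) h hm hn) (tensor f (tensor g h hk' hl') hm' hn')
  | unit_tensor {m n : ℕ} (f : Diag m n) (hm : m = 0 + m) (hn : n = 0 + n) :
      Rel (tensor (id 0) f hm hn) f
  | tensor_unit {m n : ℕ} (f : Diag m n) (hm : m = m + 0) (hn : n = n + 0) :
      Rel (tensor f (id 0) hm hn) f
  | id_tensor_id {m m' k : ℕ} (hk : k = m + m') :
      Rel (tensor (id m) (id m') hk hk) (id k)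
  -- super interchange law (height moves): `(f ⊗ g) ∘ (h ⊗ k) = (-1)^(|g| |h|) (f ∘ h) ⊗ (g ∘ k)`
  | interchange {l m n l' m' n' i j o : ℕ} {p q : ZMod 2}
      (f : Diag m n) (g : Diag m' n') (h : Diag l m) (k : Diag l' m')
      (hi : i = l + l') (hj : j = m + m') (ho : o = n + n') :
      HasParity g p → HasParity h q →
      Rel (comp (tensor f g hj ho) (tensor h k hi hj))
        (smul ((-1 : ℂ) ^ (p * q).val) (tensor (comp f h) (comp g k) hi ho))
  -- braid relations
  | s_sq : Rel (comp s s) (id 2)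
  | braid :
      Rel (comp (tensor s (id 1) rfl rfl : Diag 3 3)
            (comp (tensor (id 1) s rfl rfl : Diag 3 3) (tensor s (id 1) rfl rfl : Diag 3 3)))
          (comp (tensor (id 1) s rfl rfl : Diag 3 3)
            (comp (tensor s (id 1) rfl rfl : Diag 3 3) (tensor (id 1) s rfl rfl : Diag 3 3)))
  -- snake relations: `(b ⊗ 1) ∘ (1 ⊗ b*) = -1` and `(1 ⊗ b) ∘ (b* ⊗ 1) = 1`
  | snake_neg :
      Rel (comp (tensor b (id 1) rfl rfl : Diag 3 1) (tensor (id 1) bs rfl rfl : Diag 1 3))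
          (smul (-1) (id 1))
  | snake :
      Rel (comp (tensor (id 1) b rfl rfl : Diag 3 1) (tensor bs (id 1) rfl rfl : Diag 1 3))
          (id 1)
  -- untwisting relations: `(1 ⊗ s) ∘ (b* ⊗ 1) = (s ⊗ 1) ∘ (1 ⊗ b*)` and `s ∘ b* = -b*`
  | untwist :
      Rel (comp (tensor (id 1) s rfl rfl : Diag 3 3) (tensor bs (id 1) rfl rfl : Diag 1 3))
          (comp (tensor s (id 1) rfl rfl : Diag 3 3) (tensor (id 1) bs rfl rfl : Diag 1 3))
  | s_bs : Rel (comp s bs) (smul (-1) bs)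
  -- dot relations: `1 ⊗ y = s ∘ (y ⊗ 1) ∘ s + s + b* ∘ b` and `b ∘ (1 ⊗ y) = b ∘ (y ⊗ 1) + b`
  | dot_s :
      Rel (tensor (id 1) y rfl rfl : Diag 2 2)
          (add (add (comp s (comp (tensor y (id 1) rfl rfl : Diag 2 2) s)) s) (comp bs b))
  | dot_b :
      Rel (comp b (tensor (id 1) y rfl rfl : Diag 2 2))
          (add (comp b (tensor y (id 1) rfl rfl : Diag 2 2)) b)

/-- Expressions modulo the relations. -/
instance setoid (m n : ℕ) : Setoid (Diag m n) where
  r := Rel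
  iseqv := ⟨Rel.refl, Rel.symm, Rel.trans⟩

end Diag

/-- The set of morphisms `m ⟶ n` of the affine VW supercategory. -/
def Mor (m n : ℕ) : Type := Quotient (Diag.setoid m n)

namespace Mor

/-- The morphism represented by an expression. -/
def mk {m n : ℕ} (f : Diag m n) : Mor m n := Quotient.mk _ f

/-- Vertical composition: `comp f g` is `f ∘ g`. -/
def comp {l m n : ℕ} : Mor m n → Mor l m → Mor l n :=
  Quotient.map₂ Diag.comp fun _ _ h _ _ h' => Diag.Rel.comp_congr h h'

instance (m n : ℕ) : Zero (Mor m n) := ⟨mk (Diag.zero m n)⟩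

instance (m n : ℕ) : Add (Mor m n) :=
  ⟨Quotient.map₂ Diag.add fun _ _ h _ _ h' => Diag.Rel.add_congr h h'⟩

instance (m n : ℕ) : SMul ℂ (Mor m n) :=
  ⟨fun c => Quotient.map (Diag.smul c) fun _ _ h => Diag.Rel.smul_congr c h⟩

instance (m n : ℕ) : Neg (Mor m n) := ⟨fun f => (-1 : ℂ) • f⟩

instance (m n : ℕ) : AddCommGroup (Mor m n) where
  add_assoc := by
    rintro ⟨f⟩ ⟨g⟩ ⟨h⟩
    exact Quotient.sound (Diag.Rel.add_assoc f g h)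
  add_comm := by
    rintro ⟨f⟩ ⟨g⟩
    exact Quotient.sound (Diag.Rel.add_comm f g)
  zero_add := by
    rintro ⟨f⟩
    exact Quotient.sound (Diag.Rel.zero_add f)
  add_zero := by
    rintro ⟨f⟩
    exact Quotient.sound ((Diag.Rel.add_comm _ _).trans (Diag.Rel.zero_add f))
  neg_add_cancel := by
    rintro ⟨f⟩
    exact Quotient.sound (Diag.Rel.neg_add f)
  nsmul := nsmulRec
  zsmul := zsmulRec

instance (m n : ℕ) : Module ℂ (Mor m n) :=
  Module.ofMinimalAxioms
    (by
      rintro c ⟨f⟩ ⟨g⟩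
      exact Quotient.sound (Diag.Rel.smul_add c f g))
    (by
      rintro c d ⟨f⟩
      exact Quotient.sound (Diag.Rel.add_smul c d f))
    (by
      rintro c d ⟨f⟩
      exact Quotient.sound (Diag.Rel.mul_smul c d f))
    (by
      rintro ⟨f⟩
      exact Quotient.sound (Diag.Rel.one_smul f))

end Mor

/-- The affine VW supercategory, with objects the tensor powers of the generating object. -/
structure SVW where
  /-- The number of tensor factors. -/
  strands : ℕ

instance : Category SVW where
  Hom X Y := Mor X.strands Y.strands
  id X := Mor.mk (Diag.id X.strands)
  comp f g := Mor.comp g f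
  id_comp := by
    rintro X Y ⟨f⟩
    exact Quotient.sound (Diag.Rel.comp_id f)
  comp_id := by
    rintro X Y ⟨f⟩
    exact Quotient.sound (Diag.Rel.id_comp f)
  assoc := by
    rintro X Y Z W ⟨f⟩ ⟨g⟩ ⟨h⟩
    exact Quotient.sound (Diag.Rel.comp_assoc h g f).symm

instance : Preadditive SVW where
  homGroup X Y := inferInstanceAs (AddCommGroup (Mor X.strands Y.strands))
  add_comp := by
    rintro X Y Z ⟨f⟩ ⟨f'⟩ ⟨g⟩
    exact Quotient.sound (Diag.Rel.comp_add g f f')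
  comp_add := by
    rintro X Y Z ⟨f⟩ ⟨g⟩ ⟨g'⟩
    exact Quotient.sound (Diag.Rel.add_comp g g' f)

instance : Linear ℂ SVW where
  homModule X Y := inferInstanceAs (Module ℂ (Mor X.strands Y.strands))
  smul_comp := by
    rintro X Y Z c ⟨f⟩ ⟨g⟩
    exact Quotient.sound (Diag.Rel.comp_smul c g f)
  comp_smul := by
    rintro X Y Z ⟨f⟩ c ⟨g⟩
    exact Quotient.sound (Diag.Rel.smul_comp c g f)

/-- The affine VW superalgebra `sVW_a = End_{sVW}(a)`; the product is `f * g = f ∘ g`. All its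
elements are even, so its centre as a superalgebra is its centre as an algebra. -/
abbrev sVW (a : ℕ) : Type := End (SVW.mk a)

/-- The expression `1_i ⊗ y ⊗ 1_(a-1-i)`: a dot on the strand with `i` strands on its left. -/
def Diag.dot {a : ℕ} (i : Fin a) : Diag a a :=
  Diag.tensor (Diag.tensor (Diag.id (i : ℕ)) Diag.y rfl rfl) (Diag.id (a - 1 - i))
    (by omega) (by omega)

/-- The element `y_{i+1}` of `sVW_a` (indices start at `0` here). -/
def dot {a : ℕ} (i : Fin a) : sVW a := Mor.mk (Diag.dot i)

namespace Diag.Rel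

/-- The interchange law for even morphisms. -/
theorem even_interchange {l m n l' m' n' i j o : ℕ}
    (f : Diag m n) (g : Diag m' n') (h : Diag l m) (k : Diag l' m')
    (hi : i = l + l') (hj : j = m + m') (ho : o = n + n')
    (hg : HasParity g 0) (hh : HasParity h 0) :
    Rel (Diag.comp (Diag.tensor f g hj ho) (Diag.tensor h k hi hj))
      (Diag.tensor (Diag.comp f h) (Diag.comp g k) hi ho) := by
  refine (interchange f g h k hi hj ho hg hh).trans ?_
  simpa using one_smul (Diag.tensor (Diag.comp f h) (Diag.comp g k) hi ho)

/-- Even endomorphisms on disjoint sets of strands commute. -/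
theorem even_comm {m n k : ℕ} (f : Diag m m) (g : Diag n n) (hk : k = m + n)
    (hf : HasParity f 0) (hg : HasParity g 0) :
    Rel (Diag.comp (Diag.tensor f (Diag.id n) hk hk) (Diag.tensor (Diag.id m) g hk hk))
      (Diag.comp (Diag.tensor (Diag.id m) g hk hk) (Diag.tensor f (Diag.id n) hk hk)) := by
  refine (even_interchange _ _ _ _ hk hk hk (.id _) (.id _)).trans ?_
  refine Rel.trans ?_ (even_interchange _ _ _ _ hk hk hk hg hf).symm
  exact tensor_congr _ _ ((comp_id f).trans (id_comp f).symm) ((id_comp g).trans (comp_id g).symm)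

end Diag.Rel

/-- The dots commute, so that polynomials in them make sense. -/
theorem dot_comm {a : ℕ} (i j : Fin a) : dot i * dot j = dot j * dot i := by
  have key : ∀ i j : Fin a, i < j → dot i * dot j = dot j * dot i := by
    intro i j hij
    have hij' : (i : ℕ) < j := hij
    have hj : (j : ℕ) < a := j.2
    have ha : a = j + (a - j) := by omega
    let P : Diag j j := Diag.tensor (Diag.tensor (Diag.id (i : ℕ)) Diag.y rfl rfl)
      (Diag.id (j - 1 - i)) (by omega) (by omega)
    let Q : Diag (a - j) (a - j) := Diag.tensor Diag.y (Diag.id (a - 1 - j)) (by omega) (by omega)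
    have hP : Diag.HasParity P 0 :=
      .tensor (p := 0) (q := 0) _ _ (.tensor (p := 0) (q := 0) _ _ (.id _) .y) (.id _)
    have hQ : Diag.HasParity Q 0 := .tensor (p := 0) (q := 0) _ _ .y (.id _)
    have h1 : Diag.Rel (Diag.dot i) (Diag.tensor P (Diag.id (a - j)) ha ha) := by
      refine Diag.Rel.trans ?_ (Diag.Rel.tensor_assoc _ _ _ _ _
        (k' := a - 1 - i) (l' := a - 1 - i) (by omega) (by omega) _ _
        (by omega) (by omega)).symm
      exact Diag.Rel.tensor_congr _ _ (.refl _) (Diag.Rel.id_tensor_id (by omega)).symm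
    have h2 : Diag.Rel (Diag.dot j) (Diag.tensor (Diag.id (j : ℕ)) Q ha ha) :=
      Diag.Rel.tensor_assoc _ _ _ _ _ _ _ _ _ _ _
    exact Quotient.sound (((Diag.Rel.comp_congr h1 h2).trans
      (Diag.Rel.even_comm P Q ha hP hQ)).trans (Diag.Rel.comp_congr h2 h1).symm)
  rcases lt_trichotomy i j with h | h | h
  · exact key i j h
  · rw [h]
  · exact (key j i h).symm

/-- Evaluation of polynomials at the dots: the algebra homomorphism
`ℂ[y_1, …, y_a] → sVW_a` with `X i ↦ dot i`. -/
noncomputable def dotPoly (a : ℕ) : MvPolynomial (Fin a) ℂ →ₐ[ℂ] sVW a :=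
  letI : CommRing (Algebra.adjoin ℂ (Set.range (dot (a := a)))) :=
    { (Algebra.adjoin ℂ (Set.range (dot (a := a)))).toRing with
      mul_comm := (Algebra.isMulCommutative_adjoin ℂ (by
        rintro _ ⟨i, rfl⟩ _ ⟨j, rfl⟩
        exact dot_comm i j)).is_comm.comm }
  (Algebra.adjoin ℂ (Set.range (dot (a := a)))).val.comp
    (MvPolynomial.aeval fun i => ⟨dot i, Algebra.subset_adjoin ⟨i, rfl⟩⟩)

theorem dotPoly_X {a : ℕ} (i : Fin a) : dotPoly a (MvPolynomial.X i) = dot i := by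
  simp [dotPoly]

/-- The deformed squared Vandermonde `D_1 = ∏_{i < j} ((y_i - y_j)^2 - 1)`. -/
noncomputable def deformedVandermonde (a : ℕ) : MvPolynomial (Fin a) ℂ :=
  ∏ i : Fin a, ∏ j ∈ Finset.Ioi i, ((MvPolynomial.X i - MvPolynomial.X j) ^ 2 - 1)

end AffineVW

/-! The proof plays a concrete representation against a spanning set of diagrams.

The representation acts on functions of infinite words. Letters carry a label and a parity;
crossing, cap and cup act as the signed flip, the contraction and the creation of dual letters, and
the dot acts as the Jucys–Murphy operator `opY`. By `rho_eq_of_rel` a morphism acts in this way to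
the right of any number `k` of additional letters. Crossings, cups and caps do not notice those
letters, but each new letter on the left changes a dot by an interaction term, `out_opY_inn`. Hence
a morphism with at most `d` dots has order at most `d` under finite differences in `k` (`OrdLT`),
and its `d`-th difference is a leading symbol `sym`. In the symbol the dot on strand `i` is
multiplication by the variable of the label at place `i` (`sym_opY_mul`), while the undotted part
only tests whether the letters of the word match along the arcs. Symbols are always evaluated on the
constant function 1.

On the diagrammatic side, every morphism from the unit object is a combination of arc diagrams whose
dots sit at the left ends of arcs (`exists_mem_reg`, by way of `regClosed`). If the arcs have
distinct labels, a word determines the matching, and the monomials in the variables determine the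
numbers of dots. So a morphism whose degree `d` symbol vanishes on all test words is a combination
of diagrams with fewer dots: `mem_regLT_of_sym_eq_zero`. Endomorphisms are brought into this setting
by bending their source strands upwards. The map `rotAll` is injective and turns right
multiplication by the dot `i` into the dot on the mirror image strand plus 1.

Algebraic independence follows because the top ends of the bent identity carry distinct labels in
its test word (`eq_zero_of_polyAct_add_eq_zero`).

A central element commutes with the dots, which forces its symbol onto the matching of the identity;
subtracting a polynomial in the dots lowers the degree, so the element is a polynomial in the dots
(`exists_eq_dotPoly`). Commuting with crossings makes this polynomial `P` symmetric
(`rename_swap_of_comm`). Commuting with the cap-cup element makes `P` at `(s, s - 1, …)` independent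
of `s` (`eval_withHead_eq`). With symmetry this gives invariance under translation by 2 of every
other coordinate, so `P` equals one constant on all hyperplanes `x_i = x_j + 1`. These hyperplanes
are the zero set of the deformed squared Vandermonde polynomial `D`, whose linear factors are
pairwise coprime; hence `D` divides `P` minus the constant.

Conversely, let `f` be symmetric. In `D * f` each factor `(y_i - y_{i+1})² - 1` kills cups on the
strands `i`, `i + 1`, and the polynomial commutes with crossings. After bending there are two blocks
of `a` points, and on both sides of the commutation identity every diagram with an arc inside a
block gives zero. The other diagrams reduce, by crossings inside the blocks, to the bent identity,
where the identity is trivial (`IsGood.balanced`, `dotPoly_mul_comm`). -/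

namespace AffineVW

set_option linter.unusedSectionVars false
set_option linter.unusedVariables false

/-! ### A representation on infinite words -/

section Words

variable (ι : Type) [Fintype ι] [DecidableEq ι]

/-- A letter is a label together with a parity. -/
abbrev Letter : Type := ι × ZMod 2

/-- Infinite words. -/
abbrev Word : Type := ℕ → Letter ι

/-- Linear operators on functions of words. -/
abbrev Op : Type := Module.End ℂ (Word ι → ℂ)

variable {ι}

/-- The dual letter: same label, opposite parity. -/
def Letter.dual (x : Letter ι) : Letter ι := (x.1, x.2 + 1)

/-- The sign `(-1)^(pq)`. -/
noncomputable def sgn (p q : ZMod 2) : ℂ := (-1 : ℂ) ^ (p * q).val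

theorem sgn_zero_left (q : ZMod 2) : sgn 0 q = 1 := by simp [sgn]
theorem sgn_zero_right (q : ZMod 2) : sgn q 0 = 1 := by simp [sgn]
theorem sgn_comm (p q : ZMod 2) : sgn p q = sgn q p := by simp [sgn, mul_comm]

theorem sgn_add_left (p p' q : ZMod 2) : sgn (p + p') q = sgn p q * sgn p' q := by
  have : ∀ p p' q : ZMod 2, ((p + p') * q).val % 2 = ((p * q).val + (p' * q).val) % 2 := by decide
  rw [sgn, sgn, sgn, ← pow_add, neg_one_pow_eq_pow_mod_two, this, ← neg_one_pow_eq_pow_mod_two]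

theorem sgn_add_right (p q q' : ZMod 2) : sgn p (q + q') = sgn p q * sgn p q' := by
  rw [sgn_comm, sgn_add_left, sgn_comm q, sgn_comm q']

theorem sgn_mul_self (p q : ZMod 2) : sgn p q * sgn p q = 1 := by
  rw [sgn, ← pow_add, ← two_mul, pow_mul]; simp

theorem sgn_ne_zero (p q : ZMod 2) : sgn p q ≠ 0 := by simp [sgn]

theorem sgn_one_one : sgn 1 1 = -1 := by
  rw [sgn, show ((1 : ZMod 2) * 1).val = 1 from rfl, pow_one]

@[simp] theorem Letter.dual_dual (x : Letter ι) : x.dual.dual = x := by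
  ext
  · rfl
  · simp only [dual]; rw [add_assoc, show (1 + 1 : ZMod 2) = 0 from rfl, add_zero]

theorem Letter.dual_snd (x : Letter ι) : x.dual.2 = x.2 + 1 := rfl

theorem Letter.eq_dual_comm (x y : Letter ι) : x = y.dual ↔ y = x.dual :=
  ⟨fun h => by rw [h, dual_dual], fun h => by rw [h, dual_dual]⟩

theorem Letter.dual_ne (x : Letter ι) : x.dual ≠ x := by
  intro h
  have h2 : x.2 + 1 = x.2 := congrArg Prod.snd h
  simp at h2

theorem Letter.eq_or_eq_dual {x y : Letter ι} (h : x.1 = y.1) : x = y ∨ x = y.dual := by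
  have : ∀ p q : ZMod 2, p = q ∨ p = q + 1 := by decide
  rcases this x.2 y.2 with h2 | h2
  · exact Or.inl (Prod.ext h h2)
  · exact Or.inr (Prod.ext h h2)

/-- Prepend a letter to a word. -/
def Word.cons (x : Letter ι) (w : Word ι) : Word ι := fun n => Nat.casesOn n x w

/-- Remove the first letter of a word. -/
def Word.tail (w : Word ι) : Word ι := fun n => w (n + 1)

@[simp] theorem Word.cons_zero (x : Letter ι) (w : Word ι) : Word.cons x w 0 = x := rfl
@[simp] theorem Word.cons_succ (x : Letter ι) (w : Word ι) (n : ℕ) :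
    Word.cons x w (n + 1) = w n := rfl
@[simp] theorem Word.cons_one (x : Letter ι) (w : Word ι) :
    Word.cons x w 1 = w 0 := rfl
@[simp] theorem Word.tail_cons (x : Letter ι) (w : Word ι) : (Word.cons x w).tail = w := rfl

theorem Word.cons_head_tail (w : Word ι) : Word.cons (w 0) w.tail = w := by
  funext n; cases n <;> rfl

theorem Word.exists_cons (w : Word ι) : ∃ x t, w = Word.cons x t :=
  ⟨w 0, w.tail, (Word.cons_head_tail w).symm⟩

/-- Extend a function of words to words beginning with `x`. -/
noncomputable def inn (x : Letter ι) : Op ι where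
  toFun u w := if w 0 = x then u w.tail else 0
  map_add' u v := by ext w; simp only [Pi.add_apply]; split_ifs <;> simp
  map_smul' c u := by ext w; simp

/-- Restrict a function of words to words beginning with `x`. -/
def out (x : Letter ι) : Op ι where
  toFun u w := u (Word.cons x w)
  map_add' u v := rfl
  map_smul' c u := rfl

@[simp] theorem out_apply (x : Letter ι) (u : Word ι → ℂ) (w : Word ι) :
    out x u w = u (Word.cons x w) := rfl

@[simp] theorem inn_cons (x y : Letter ι) (u : Word ι → ℂ) (w : Word ι) :
    inn x u (Word.cons y w) = if y = x then u w else 0 := rfl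

/-- `shift p T` is the operator of parity `p` given by `T` one place further to the right. -/
noncomputable def shift (p : ZMod 2) (T : Op ι) : Op ι where
  toFun u w := sgn p (w 0).2 * T (out (w 0) u) w.tail
  map_add' u v := by ext w; simp [mul_add]
  map_smul' c u := by ext w; simp [mul_left_comm]

@[simp] theorem shift_cons (p : ZMod 2) (T : Op ι) (u : Word ι → ℂ) (x : Letter ι) (w : Word ι) :
    shift p T u (Word.cons x w) = sgn p x.2 * T (out x u) w := rfl

theorem op_ext {T T' : Op ι} (h : ∀ u x t, T u (Word.cons x t) = T' u (Word.cons x t)) :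
    T = T' := by
  refine LinearMap.ext fun u => funext fun w => ?_
  obtain ⟨x, t, rfl⟩ := w.exists_cons
  exact h u x t

theorem op_ext₂ {T T' : Op ι}
    (h : ∀ u x y t, T u (Word.cons x (Word.cons y t)) = T' u (Word.cons x (Word.cons y t))) :
    T = T' := by
  refine op_ext fun u x t => ?_
  obtain ⟨y, t, rfl⟩ := t.exists_cons
  exact h u x y t

theorem op_ext₃ {T T' : Op ι} (h : ∀ u x y z t,
    T u (Word.cons x (Word.cons y (Word.cons z t))) =
      T' u (Word.cons x (Word.cons y (Word.cons z t)))) :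
    T = T' := by
  refine op_ext₂ fun u x y t => ?_
  obtain ⟨z, t, rfl⟩ := t.exists_cons
  exact h u x y z t

theorem out_shift (p : ZMod 2) (T : Op ι) (u : Word ι → ℂ) (x : Letter ι) :
    out x (shift p T u) = sgn p x.2 • T (out x u) := rfl

theorem shift_mul (p q : ZMod 2) (T T' : Op ι) :
    shift (p + q) (T * T') = shift p T * shift q T' := by
  refine op_ext fun u x t => ?_
  simp [out_shift, sgn_add_left, mul_assoc]

theorem shift_zero_mul (T T' : Op ι) : shift 0 (T * T') = shift 0 T * shift 0 T' := by
  simpa using shift_mul 0 0 T T'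

theorem shift_add (p : ZMod 2) (T T' : Op ι) : shift p (T + T') = shift p T + shift p T' := by
  refine op_ext fun u x t => ?_
  simp [mul_add]

theorem shift_smul (p : ZMod 2) (c : ℂ) (T : Op ι) : shift p (c • T) = c • shift p T := by
  refine op_ext fun u x t => ?_
  simp [mul_left_comm]

theorem shift_one : shift 0 (1 : Op ι) = 1 := by
  refine op_ext fun u x t => ?_
  simp [sgn_zero_left]

/-- The crossing of the first two letters. -/
noncomputable def crossOp : Op ι where
  toFun u w := sgn (w 0).2 (w 1).2 * u (Word.cons (w 1) (Word.cons (w 0) w.tail.tail))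
  map_add' u v := by ext w; simp [mul_add]
  map_smul' c u := by ext w; simp [mul_left_comm]

/-- Contraction of the first two letters. -/
noncomputable def capOp : Op ι where
  toFun u w := ∑ c : Letter ι, u (Word.cons c (Word.cons c.dual w))
  map_add' u v := by ext w; simp [Finset.sum_add_distrib]
  map_smul' c u := by ext w; simp [Finset.mul_sum]

/-- Creation of a pair of dual letters. -/
noncomputable def cupOp : Op ι where
  toFun u w := if w 1 = (w 0).dual then sgn 1 (w 0).2 * u w.tail.tail else 0
  map_add' u v := by ext w; simp only [Pi.add_apply]; split_ifs <;> simp [mul_add]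
  map_smul' c u := by ext w; simp [mul_left_comm]

@[simp] theorem crossOp_cons (u : Word ι → ℂ) (x y : Letter ι) (t : Word ι) :
    crossOp u (Word.cons x (Word.cons y t)) =
      sgn x.2 y.2 * u (Word.cons y (Word.cons x t)) := rfl

@[simp] theorem capOp_apply (u : Word ι → ℂ) (t : Word ι) :
    capOp u t = ∑ c : Letter ι, u (Word.cons c (Word.cons c.dual t)) := rfl

@[simp] theorem cupOp_cons (u : Word ι → ℂ) (x y : Letter ι) (t : Word ι) :
    cupOp u (Word.cons x (Word.cons y t)) =
      if y = x.dual then sgn 1 x.2 * u t else 0 := rfl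

theorem crossOp_sq : (crossOp * crossOp : Op ι) = 1 := by
  refine op_ext₂ fun u x y t => ?_
  simp [← mul_assoc, sgn_comm y.2 x.2, sgn_mul_self]

theorem crossOp_braid : (crossOp * shift 0 crossOp * crossOp : Op ι) =
    shift 0 crossOp * crossOp * shift 0 crossOp := by
  refine op_ext₃ fun u x y z t => ?_
  simp [sgn_zero_left]
  ring

theorem capOp_shift_cupOp : (capOp * shift 1 cupOp : Op ι) = (-1 : ℂ) • 1 := by
  refine op_ext fun u x t => ?_
  simp only [Module.End.mul_apply, capOp_apply, shift_cons, cupOp_cons, Letter.dual_dual]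
  rw [Finset.sum_eq_single x]
  · simp [Letter.dual_snd, ← mul_assoc, sgn_add_right, sgn_mul_self, sgn_one_one]
  · intro b _ hb
    simp [hb.symm]
  · simp

theorem shift_capOp_cupOp : (shift 1 capOp * cupOp : Op ι) = 1 := by
  refine op_ext fun u x t => ?_
  simp only [Module.End.mul_apply, capOp_apply, shift_cons, cupOp_cons, out_apply]
  rw [Finset.sum_eq_single x.dual]
  · simp [← mul_assoc, sgn_mul_self]
  · intro b _ hb
    simp [hb]
  · simp

theorem shift_crossOp_cupOp : (shift 0 crossOp * cupOp : Op ι) = crossOp * shift 1 cupOp := by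
  refine op_ext₃ fun u x y z t => ?_
  simp only [Module.End.mul_apply, shift_cons, crossOp_cons, cupOp_cons, out_apply,
    sgn_zero_left, one_mul]
  split_ifs with h
  · subst h
    rw [Letter.dual_snd, sgn_add_right, sgn_comm y.2 x.2, sgn_comm y.2 1]
    ring
  · simp

theorem crossOp_cupOp : (crossOp * cupOp : Op ι) = (-1 : ℂ) • cupOp := by
  refine op_ext₂ fun u x y t => ?_
  simp only [Module.End.mul_apply, crossOp_cons, cupOp_cons, LinearMap.smul_apply, Pi.smul_apply,
    smul_eq_mul]
  by_cases h : y = x.dual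
  · subst h
    simp only [Letter.dual_dual, if_true, Letter.dual_snd, sgn_add_right, sgn_one_one]
    have : sgn x.2 x.2 * sgn x.2 1 = 1 := by
      rw [← sgn_add_right]
      have : ∀ p : ZMod 2, p * (p + 1) = 0 := by decide
      simp [sgn, this]
    linear_combination (-sgn 1 x.2 * u t) * this
  · have h' : x ≠ y.dual := fun e => h ((Letter.eq_dual_comm _ _).1 e)
    simp [h, h']

/-- Reindex the contraction by duality. A letter and its dual have parities `p` and `p + 1`, and `p
(p + 1) = 0`, so the flip contributes no sign. -/
theorem capOp_crossOp : (capOp * crossOp : Op ι) = capOp := by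
  refine op_ext fun u x t => ?_
  simp only [Module.End.mul_apply, capOp_apply, crossOp_cons]
  let e : Letter ι ≃ Letter ι := ⟨Letter.dual, Letter.dual, Letter.dual_dual, Letter.dual_dual⟩
  refine Fintype.sum_equiv e _ _ fun c => ?_
  have : ∀ p : ZMod 2, p * (p + 1) = 0 := by decide
  simp [e, Letter.dual_snd, sgn, this]

/-- The crossing fixes the cap and negates the cup, so a closed loop equals its own negative. -/
theorem capOp_cupOp : (capOp * cupOp : Op ι) = 0 := by
  have h : (capOp * cupOp : Op ι) = (-1 : ℂ) • (capOp * cupOp) := by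
    conv_lhs => rw [← capOp_crossOp, mul_assoc, crossOp_cupOp, mul_smul_comm]
  refine LinearMap.ext fun u => funext fun w => ?_
  have h2 : (capOp * cupOp : Op ι) u w = -1 * (capOp * cupOp : Op ι) u w :=
    congrFun (LinearMap.congr_fun h u) w
  rw [neg_one_mul] at h2
  exact self_eq_neg.1 h2

theorem capOp_shift_crossOp :
    (capOp * shift 0 crossOp : Op ι) = shift 1 capOp * crossOp := by
  refine op_ext fun u x t => ?_
  simp only [Module.End.mul_apply, shift_cons, crossOp_cons, capOp_apply, out_apply,
    sgn_zero_left, one_mul, Finset.mul_sum]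
  refine Finset.sum_congr rfl fun c _ => ?_
  have h : sgn 1 x.2 * sgn x.2 c.2 = sgn c.dual.2 x.2 := by
    rw [Letter.dual_snd, sgn_add_left, sgn_comm x.2 c.2, mul_comm]
  rw [← mul_assoc, h]

theorem crossOp_comm_shift_shift (p : ZMod 2) (T : Op ι) :
    crossOp * shift p (shift p T) = shift p (shift p T) * crossOp := by
  refine op_ext₂ fun u x y t => ?_
  simp only [Module.End.mul_apply, shift_cons, crossOp_cons]
  have : out y (out x (crossOp u)) = sgn x.2 y.2 • out x (out y u) := by
    funext w; rfl
  simp [this]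
  ring

/-- A letter and its dual have total parity 1, so an operator of parity `p` picks up `sgn p 1` when
it moves past the contracted pair. -/
theorem capOp_shift_shift (p : ZMod 2) (T : Op ι) :
    capOp * shift p (shift p T) = sgn p 1 • (T * capOp) := by
  refine op_ext fun u x t => ?_
  simp only [Module.End.mul_apply, shift_cons, capOp_apply, LinearMap.smul_apply, Pi.smul_apply,
    smul_eq_mul]
  have : capOp u = ∑ c : Letter ι, out c.dual (out c u) := by
    funext w; simp
  rw [this, map_sum, Finset.sum_apply, Finset.mul_sum]
  refine Finset.sum_congr rfl fun c _ => ?_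
  rw [← mul_assoc, Letter.dual_snd, sgn_add_right, ← mul_assoc, sgn_mul_self, one_mul]

theorem shift_shift_cupOp (p : ZMod 2) (T : Op ι) :
    shift p (shift p T) * cupOp = sgn p 1 • (cupOp * T) := by
  refine op_ext₂ fun u x y t => ?_
  simp only [Module.End.mul_apply, shift_cons, cupOp_cons, LinearMap.smul_apply, Pi.smul_apply,
    smul_eq_mul]
  have : out y (out x (cupOp u)) = if y = x.dual then sgn 1 x.2 • u else 0 := by
    funext w
    simp only [out_apply, cupOp_cons]
    split_ifs <;> simp
  rw [this]
  split_ifs with h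
  · subst h
    rw [Letter.dual_snd, sgn_add_right, map_smul, Pi.smul_apply, smul_eq_mul]
    linear_combination (sgn p 1 * sgn 1 x.2 * T u t) * sgn_mul_self p x.2
  · simp

end Words
end AffineVW

/-! ### Jucys–Murphy operators and their relations. -/

namespace AffineVW

set_option linter.unusedSectionVars false
set_option linter.unusedVariables false

section Jucys

variable {ι : Type} [Fintype ι] [DecidableEq ι]

variable (ι) in
/-- The crossing of the letters at places `k` and `k + 1`. -/
noncomputable def opS : ℕ → Op ι
  | 0 => crossOp
  | k + 1 => shift 0 (opS k)

variable (ι) in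
/-- Contraction of the letters at places `k` and `k + 1`. -/
noncomputable def opB : ℕ → Op ι
  | 0 => capOp
  | k + 1 => shift 1 (opB k)

variable (ι) in
/-- Creation of a dual pair of letters at places `k` and `k + 1`. -/
noncomputable def opC : ℕ → Op ι
  | 0 => cupOp
  | k + 1 => shift 1 (opC k)

variable (ι) in
/-- The Jucys–Murphy operators. -/
noncomputable def opY : ℕ → Op ι
  | 0 => 0
  | k + 1 => opS ι k * opY k * opS ι k + opS ι k + opC ι k * opB ι k

theorem shift_one_mul_one (T T' : Op ι) : shift 0 (T * T') = shift 1 T * shift 1 T' :=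
  shift_mul 1 1 T T'

theorem opS_sq (k : ℕ) : opS ι k * opS ι k = 1 := by
  induction k with
  | zero => exact crossOp_sq
  | succ k ih => rw [opS, ← shift_zero_mul, ih, shift_one]

theorem opS_braid (k : ℕ) : opS ι k * opS ι (k + 1) * opS ι k =
    opS ι (k + 1) * opS ι k * opS ι (k + 1) := by
  induction k with
  | zero => exact crossOp_braid
  | succ k ih =>
    rw [opS, show opS ι (k + 1 + 1) = shift 0 (opS ι (k + 1)) from rfl, ← shift_zero_mul,
      ← shift_zero_mul, ih, shift_zero_mul, shift_zero_mul]

theorem opB_opC_succ (k : ℕ) : opB ι k * opC ι (k + 1) = (-1 : ℂ) • 1 := by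
  induction k with
  | zero => exact capOp_shift_cupOp
  | succ k ih => rw [opB, opC, ← shift_one_mul_one, ih, shift_smul, shift_one]

theorem opB_succ_opC (k : ℕ) : opB ι (k + 1) * opC ι k = 1 := by
  induction k with
  | zero => exact shift_capOp_cupOp
  | succ k ih => rw [opB, opC, ← shift_one_mul_one, ih, shift_one]

theorem opB_opC (k : ℕ) : opB ι k * opC ι k = 0 := by
  induction k with
  | zero => exact capOp_cupOp
  | succ k ih =>
    rw [opB, opC, ← shift_one_mul_one, ih]
    simpa using shift_smul 0 0 (0 : Op ι)

theorem shift_zero_one_mul (T T' : Op ι) : shift 1 (T * T') = shift 0 T * shift 1 T' := by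
  simpa using shift_mul 0 1 T T'

theorem shift_one_zero_mul (T T' : Op ι) : shift 1 (T * T') = shift 1 T * shift 0 T' := by
  simpa using shift_mul 1 0 T T'

theorem opS_succ_opC (k : ℕ) : opS ι (k + 1) * opC ι k = opS ι k * opC ι (k + 1) := by
  induction k with
  | zero => exact shift_crossOp_cupOp
  | succ k ih => rw [opS, opC, ← shift_zero_one_mul, ih, shift_zero_one_mul]; rfl

theorem opS_opC (k : ℕ) : opS ι k * opC ι k = (-1 : ℂ) • opC ι k := by
  induction k with
  | zero => exact crossOp_cupOp
  | succ k ih => rw [opS, opC, ← shift_zero_one_mul, ih, shift_smul]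

theorem opB_opS (k : ℕ) : opB ι k * opS ι k = opB ι k := by
  induction k with
  | zero => exact capOp_crossOp
  | succ k ih => rw [opS, opB, ← shift_one_zero_mul, ih]

theorem opB_opS_succ (k : ℕ) : opB ι k * opS ι (k + 1) = opB ι (k + 1) * opS ι k := by
  induction k with
  | zero => exact capOp_shift_crossOp
  | succ k ih => rw [opS, opB, ← shift_one_zero_mul, ih, shift_one_zero_mul]; rfl

/-- The families of local operators with their parities. -/
inductive IsLocal : ZMod 2 → (ℕ → Op ι) → Prop
  | opS : IsLocal 0 (opS ι)
  | opB : IsLocal 1 (opB ι)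
  | opC : IsLocal 1 (opC ι)

theorem IsLocal.succ {p : ZMod 2} {T : ℕ → Op ι} (h : IsLocal p T) (k : ℕ) :
    T (k + 1) = shift p (T k) := by
  cases h <;> rfl

theorem opS_comm {p : ZMod 2} {T : ℕ → Op ι} (h : IsLocal p T) (k j : ℕ) :
    T (k + j + 2) * opS ι k = opS ι k * T (k + j + 2) := by
  induction k with
  | zero => rw [h.succ, h.succ, opS, crossOp_comm_shift_shift]
  | succ k ih =>
    rw [show k + 1 + j + 2 = (k + j + 2) + 1 by omega, h.succ (k + j + 2), opS]
    have := congrArg (shift p) ih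
    have h1 := shift_mul p 0 (T (k + j + 2)) (opS ι k)
    have h2 := shift_mul 0 p (opS ι k) (T (k + j + 2))
    rw [add_zero] at h1
    rw [zero_add] at h2
    rw [← h1, ← h2, ih]

theorem opB_comm {p : ZMod 2} {T : ℕ → Op ι} (h : IsLocal p T) (k j : ℕ) :
    T (k + j) * opB ι k = sgn p 1 • (opB ι k * T (k + j + 2)) := by
  induction k with
  | zero =>
    rw [h.succ, h.succ, opB, capOp_shift_shift, smul_smul, sgn_mul_self, one_smul]
  | succ k ih =>
    rw [show k + 1 + j + 2 = (k + j + 2) + 1 by omega, show k + 1 + j = k + j + 1 by omega,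
      h.succ (k + j + 2), h.succ (k + j), opB, ← shift_mul, ih, shift_smul, add_comm p 1,
      shift_mul]

theorem opC_comm {p : ZMod 2} {T : ℕ → Op ι} (h : IsLocal p T) (k j : ℕ) :
    T (k + j + 2) * opC ι k = sgn p 1 • (opC ι k * T (k + j)) := by
  induction k with
  | zero => rw [h.succ, h.succ, opC, shift_shift_cupOp]
  | succ k ih =>
    rw [show k + 1 + j + 2 = (k + j + 2) + 1 by omega, show k + 1 + j = k + j + 1 by omega,
      h.succ (k + j + 2), h.succ (k + j), opC, ← shift_mul, ih, shift_smul, add_comm p 1,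
      shift_mul]

/-! Commutation of the Jucys–Murphy operators with operators further to the right. -/

/-- `T` commutes with the crossing. Passing the cap and passing the cup displace `T` by two places
in opposite directions, each with the sign `sgn p 1`, and these signs cancel in `opC * opB`. -/
theorem opY_comm_local {p : ZMod 2} {T : ℕ → Op ι} (h : IsLocal p T) (k j : ℕ) :
    T (k + j + 1) * opY ι k = opY ι k * T (k + j + 1) := by
  induction k generalizing j with
  | zero => simp [opY]
  | succ k ih =>
    have e : k + 1 + j + 1 = k + j + 2 := by omega
    have h1 := opS_comm h k j
    have h2 := ih (j + 1)
    rw [show k + (j + 1) + 1 = k + j + 2 by omega] at h2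
    have h3 : T (k + j + 2) * (opC ι k * opB ι k) = opC ι k * opB ι k * T (k + j + 2) := by
      rw [← mul_assoc, opC_comm h, smul_mul_assoc, mul_assoc, opB_comm h, mul_smul_comm, smul_smul,
        sgn_mul_self, one_smul, mul_assoc]
    rw [e, opY]
    simp only [mul_add, add_mul]
    rw [h3, h1]
    congr 2
    rw [← mul_assoc, ← mul_assoc, h1, mul_assoc (opS ι k), h2]
    simp only [mul_assoc]
    rw [h1]

theorem opB_mul_opS_opS (k : ℕ) : opB ι k * opS ι (k + 1) * opS ι k = opB ι (k + 1) := by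
  rw [opB_opS_succ, mul_assoc, opS_sq, mul_one]

theorem opS_opS_mul_opC (k : ℕ) : opS ι k * opS ι (k + 1) * opC ι k = opC ι (k + 1) := by
  rw [mul_assoc, opS_succ_opC, ← mul_assoc, opS_sq, one_mul]

theorem opS_opS_mul_opC' (k : ℕ) : opS ι (k + 1) * opS ι k * opC ι (k + 1) = opC ι k := by
  rw [mul_assoc, ← opS_succ_opC, ← mul_assoc, opS_sq, one_mul]

theorem opB_mul_opS_opS' (k : ℕ) : opB ι (k + 1) * opS ι k * opS ι (k + 1) = opB ι k := by
  rw [← opB_opS_succ, mul_assoc, opS_sq, mul_one]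

/-- The interactions of a strand with the two dual letters of a cap cancel. Unfolding `opY` twice
leaves the desired term, together with four terms that annihilate in pairs. -/
theorem opY_two_left (k : ℕ) : opB ι k * opY ι (k + 2) = opY ι k * opB ι k := by
  have hB : opB ι (k + 1) * opY ι k = opY ι k * opB ι (k + 1) := opY_comm_local .opB k 0
  have h1 : opB ι k * (opS ι (k + 1) * (opS ι k * opY ι k * opS ι k) * opS ι (k + 1)) =
      opY ι k * opB ι k := by
    calc _ = (opB ι k * opS ι (k + 1) * opS ι k) * opY ι k * (opS ι k * opS ι (k + 1)) := by
          simp only [mul_assoc]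
      _ = opY ι k * (opB ι (k + 1) * opS ι k * opS ι (k + 1)) := by
          rw [opB_mul_opS_opS, hB]; simp only [mul_assoc]
      _ = _ := by rw [opB_mul_opS_opS']
  have h2 : opB ι k * (opS ι (k + 1) * opS ι k * opS ι (k + 1)) = opB ι (k + 1) := by
    rw [← opS_braid, mul_assoc, ← mul_assoc, opB_opS, ← opB_mul_opS_opS k, mul_assoc]
  have h3 : opB ι k * (opC ι (k + 1) * opB ι (k + 1)) = (-1 : ℂ) • opB ι (k + 1) := by
    rw [← mul_assoc, opB_opC_succ, smul_mul_assoc, one_mul]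
  have h4 : opB ι k * (opS ι (k + 1) * (opC ι k * opB ι k) * opS ι (k + 1)) =
      (-1 : ℂ) • (opB ι k * opS ι (k + 1)) := by
    have : opB ι k * opS ι (k + 1) * opC ι k = (-1 : ℂ) • 1 := by
      rw [mul_assoc, opS_succ_opC, ← mul_assoc, opB_opS, opB_opC_succ]
    calc _ = (opB ι k * opS ι (k + 1) * opC ι k) * (opB ι k * opS ι (k + 1)) := by
          simp only [mul_assoc]
      _ = _ := by rw [this, smul_mul_assoc, one_mul]
  rw [opY, opY]
  simp only [mul_add, add_mul]
  rw [h1, h2, h3, h4]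
  module

theorem opY_two_left' (k : ℕ) : opY ι (k + 2) * opC ι k = opC ι k * opY ι k := by
  have hC : opC ι (k + 1) * opY ι k = opY ι k * opC ι (k + 1) := opY_comm_local .opC k 0
  have h1 : opS ι (k + 1) * (opS ι k * opY ι k * opS ι k) * opS ι (k + 1) * opC ι k =
      opC ι k * opY ι k := by
    calc _ = (opS ι (k + 1) * opS ι k) * opY ι k * (opS ι k * opS ι (k + 1) * opC ι k) := by
          simp only [mul_assoc]
      _ = (opS ι (k + 1) * opS ι k * opC ι (k + 1)) * opY ι k := by
          rw [opS_opS_mul_opC]; simp only [mul_assoc]; rw [hC]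
      _ = _ := by rw [opS_opS_mul_opC']
  have h2 : opS ι (k + 1) * opS ι k * opS ι (k + 1) * opC ι k = (-1 : ℂ) • opC ι (k + 1) := by
    rw [← opS_braid, mul_assoc, opS_opC, mul_smul_comm, opS_opS_mul_opC]
  have h3 : opC ι (k + 1) * opB ι (k + 1) * opC ι k = opC ι (k + 1) := by
    rw [mul_assoc, opB_succ_opC, mul_one]
  have h4 : opS ι (k + 1) * (opC ι k * opB ι k) * opS ι (k + 1) * opC ι k =
      (-1 : ℂ) • (opS ι (k + 1) * opC ι k) := by
    have : opB ι k * (opS ι (k + 1) * opC ι k) = (-1 : ℂ) • 1 := by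
      rw [opS_succ_opC, ← mul_assoc, opB_opS, opB_opC_succ]
    simp only [mul_assoc]
    rw [this, mul_smul_comm, mul_smul_comm, mul_one]
  rw [opY, opY]
  simp only [mul_add, add_mul]
  rw [h1, h2, h3, h4]
  module

theorem opS_opY_two (k : ℕ) : opS ι k * opY ι (k + 2) = opY ι (k + 2) * opS ι k := by
  have hY : opS ι (k + 1) * opY ι k = opY ι k * opS ι (k + 1) := opY_comm_local .opS k 0
  have h1 : opS ι k * (opS ι (k + 1) * (opS ι k * opY ι k * opS ι k) * opS ι (k + 1)) =
      opS ι (k + 1) * (opS ι k * opY ι k * opS ι k) * opS ι (k + 1) * opS ι k := by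
    calc _ = (opS ι k * opS ι (k + 1) * opS ι k) * opY ι k * (opS ι k * opS ι (k + 1)) := by
          simp only [mul_assoc]
      _ = opS ι (k + 1) * opS ι k * (opS ι (k + 1) * opY ι k) * (opS ι k * opS ι (k + 1)) := by
          rw [opS_braid]; simp only [mul_assoc]
      _ = opS ι (k + 1) * opS ι k * opY ι k * (opS ι (k + 1) * opS ι k * opS ι (k + 1)) := by
          rw [hY]; simp only [mul_assoc]
      _ = _ := by rw [← opS_braid]; simp only [mul_assoc]
  have h2 : opS ι k * (opS ι (k + 1) * opS ι k * opS ι (k + 1)) = opS ι (k + 1) * opS ι k := by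
    rw [← opS_braid, mul_assoc, ← mul_assoc, opS_sq, one_mul]
  have h3 : opS ι (k + 1) * opS ι k * opS ι (k + 1) * opS ι k = opS ι k * opS ι (k + 1) := by
    rw [← opS_braid, mul_assoc, opS_sq, mul_one]
  have h4 : opS ι k * (opS ι (k + 1) * (opC ι k * opB ι k) * opS ι (k + 1)) =
      opC ι (k + 1) * opB ι (k + 1) * opS ι k := by
    calc _ = (opS ι k * opS ι (k + 1) * opC ι k) * (opB ι k * opS ι (k + 1)) := by
          simp only [mul_assoc]
      _ = _ := by rw [opS_opS_mul_opC, opB_opS_succ, mul_assoc]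
  have h5 : opS ι (k + 1) * (opC ι k * opB ι k) * opS ι (k + 1) * opS ι k =
      opS ι k * (opC ι (k + 1) * opB ι (k + 1)) := by
    calc _ = (opS ι (k + 1) * opC ι k) * (opB ι k * opS ι (k + 1) * opS ι k) := by
          simp only [mul_assoc]
      _ = _ := by rw [opB_mul_opS_opS, opS_succ_opC, mul_assoc]
  rw [opY, opY]
  simp only [mul_add, add_mul]
  rw [h1, h2, h3, h4, h5]
  abel

theorem opY_succ (k : ℕ) :
    opY ι (k + 1) = opS ι k * opY ι k * opS ι k + opS ι k + opC ι k * opB ι k := rfl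

theorem opS_opY (k j : ℕ) : opS ι k * opY ι (k + j + 2) = opY ι (k + j + 2) * opS ι k := by
  induction j with
  | zero => exact opS_opY_two k
  | succ j ih =>
    have hS : opS ι (k + j + 2) * opS ι k = opS ι k * opS ι (k + j + 2) := opS_comm .opS k j
    have hB : opB ι (k + j + 2) * opS ι k = opS ι k * opB ι (k + j + 2) := opS_comm .opB k j
    have hC : opC ι (k + j + 2) * opS ι k = opS ι k * opC ι (k + j + 2) := opS_comm .opC k j
    rw [show k + (j + 1) + 2 = k + j + 2 + 1 by omega, opY_succ]
    simp only [mul_add, add_mul, mul_assoc]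
    rw [hS, hB]
    simp only [← mul_assoc]
    rw [← hS, ← hC]
    simp only [mul_assoc]
    rw [← mul_assoc (opS ι k) (opY ι _), ih, mul_assoc]

theorem opB_opY (k j : ℕ) : opB ι k * opY ι (k + j + 2) = opY ι (k + j) * opB ι k := by
  induction j with
  | zero => exact opY_two_left k
  | succ j ih =>
    have hS := opB_comm (ι := ι) .opS k j
    have hB := opB_comm (ι := ι) .opB k j
    have hC := opB_comm (ι := ι) .opC k j
    rw [sgn_zero_left, one_smul] at hS
    rw [sgn_one_one] at hB hC
    rw [show k + (j + 1) + 2 = k + j + 2 + 1 by omega, ← add_assoc, opY_succ (k + j + 2),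
      opY_succ (k + j)]
    have h1 : opB ι k * (opS ι (k + j + 2) * opY ι (k + j + 2) * opS ι (k + j + 2)) =
        opS ι (k + j) * opY ι (k + j) * opS ι (k + j) * opB ι k := by
      rw [← mul_assoc, ← mul_assoc, ← hS, mul_assoc _ _ (opY ι _), ih, mul_assoc _ _ (opS ι _),
        mul_assoc _ _ (opS ι _), ← hS]
      simp only [mul_assoc]
    have h2 : opB ι k * (opC ι (k + j + 2) * opB ι (k + j + 2)) =
        opC ι (k + j) * opB ι (k + j) * opB ι k := by
      rw [mul_assoc _ _ (opB ι k), hB, mul_smul_comm, ← mul_assoc, ← mul_assoc (opC ι _), hC,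
        smul_mul_assoc, smul_smul]
      norm_num
    rw [mul_add, mul_add, h1, h2, ← hS]
    simp only [add_mul]

theorem opY_opC (k j : ℕ) : opY ι (k + j + 2) * opC ι k = opC ι k * opY ι (k + j) := by
  induction j with
  | zero => exact opY_two_left' k
  | succ j ih =>
    have hS := opC_comm (ι := ι) .opS k j
    have hB := opC_comm (ι := ι) .opB k j
    have hC := opC_comm (ι := ι) .opC k j
    rw [sgn_zero_left, one_smul] at hS
    rw [sgn_one_one] at hB hC
    rw [show k + (j + 1) + 2 = k + j + 2 + 1 by omega, ← add_assoc, opY_succ (k + j + 2),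
      opY_succ (k + j)]
    have h1 : opS ι (k + j + 2) * opY ι (k + j + 2) * opS ι (k + j + 2) * opC ι k =
        opC ι k * (opS ι (k + j) * opY ι (k + j) * opS ι (k + j)) := by
      rw [mul_assoc, hS, ← mul_assoc, mul_assoc _ _ (opC ι k), ih, ← mul_assoc, hS]
      simp only [mul_assoc]
    have h2 : opC ι (k + j + 2) * opB ι (k + j + 2) * opC ι k =
        opC ι k * (opC ι (k + j) * opB ι (k + j)) := by
      rw [mul_assoc, hB, mul_smul_comm, ← mul_assoc, hC, smul_mul_assoc, smul_smul,
        mul_assoc]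
      norm_num
    rw [add_mul, add_mul, h1, h2, hS]
    simp only [mul_add]

/-- Unfold the operator of smaller index. Its ingredients are the crossing, cup and cap at `k`, past
which `opY (k + j + 2)` slides, and `opY k`, covered by induction. -/
theorem opY_comm_of_lt {k q : ℕ} (h : k < q) : opY ι k * opY ι q = opY ι q * opY ι k := by
  induction k with
  | zero => simp [opY]
  | succ k ih =>
    obtain ⟨j, rfl⟩ : ∃ j, q = k + j + 2 := ⟨q - k - 2, by omega⟩
    have hS := opS_opY (ι := ι) k j
    have hB := opB_opY (ι := ι) k j
    have hC := opY_opC (ι := ι) k j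
    have h1 : opS ι k * opY ι k * opS ι k * opY ι (k + j + 2) =
        opY ι (k + j + 2) * (opS ι k * opY ι k * opS ι k) := by
      rw [mul_assoc, hS, ← mul_assoc, mul_assoc _ _ (opY ι _), ih (by omega), ← mul_assoc, hS]
      simp only [mul_assoc]
    have h2 : opC ι k * opB ι k * opY ι (k + j + 2) =
        opY ι (k + j + 2) * (opC ι k * opB ι k) := by
      rw [mul_assoc, hB, ← mul_assoc, ← hC, mul_assoc]
    rw [opY_succ, add_mul, add_mul, mul_add, mul_add, h1, h2, hS]

theorem opY_comm (k q : ℕ) : opY ι k * opY ι q = opY ι q * opY ι k := by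
  rcases lt_trichotomy k q with h | rfl | h
  · exact opY_comm_of_lt h
  · rfl
  · exact (opY_comm_of_lt h).symm

/-- The symmetry behind the relation `dot_b`: in `opB k * opY (k + 1)` the conjugated summand
becomes `opB k * opY k * opS k`, and the last crossing can then be absorbed. The induction step
transports the claim from `k` to `k + 1` by the braid relation. -/
theorem opB_opY_opS (k : ℕ) : opB ι k * opY ι k * opS ι k = opB ι k * opY ι k := by
  induction k with
  | zero => simp [opY]
  | succ k ih =>
    have hY : opS ι (k + 1) * opY ι k = opY ι k * opS ι (k + 1) := opY_comm_local .opS k 0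
    have h1 : opB ι (k + 1) * (opS ι k * opY ι k * opS ι k) * opS ι (k + 1) =
        opB ι (k + 1) * (opS ι k * opY ι k * opS ι k) := by
      calc _ = (opB ι (k + 1) * opS ι k) * opY ι k * (opS ι k * opS ι (k + 1)) := by
            simp only [mul_assoc]
        _ = opB ι k * (opS ι (k + 1) * opY ι k) * (opS ι k * opS ι (k + 1)) := by
            rw [← opB_opS_succ]; simp only [mul_assoc]
        _ = opB ι k * opY ι k * (opS ι (k + 1) * opS ι k * opS ι (k + 1)) := by
            rw [hY]; simp only [mul_assoc]
        _ = (opB ι k * opY ι k * opS ι k) * opS ι (k + 1) * opS ι k := by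
            rw [← opS_braid]; simp only [mul_assoc]
        _ = opB ι k * (opS ι (k + 1) * opY ι k) * opS ι k := by
            rw [ih, hY]; simp only [mul_assoc]
        _ = (opB ι k * opS ι (k + 1)) * opY ι k * opS ι k := by simp only [mul_assoc]
        _ = _ := by rw [opB_opS_succ]; simp only [mul_assoc]
    have h2 : opB ι (k + 1) * opS ι k * opS ι (k + 1) = opB ι k := opB_mul_opS_opS' k
    have h3 : opB ι (k + 1) * (opC ι k * opB ι k) = opB ι k := by
      rw [← mul_assoc, opB_succ_opC, one_mul]
    have h4 : opB ι k * opS ι (k + 1) = opB ι (k + 1) * opS ι k := opB_opS_succ k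
    rw [opY]
    simp only [mul_add, add_mul]
    rw [h1, h2, h3, h4]
    abel

theorem opB_opY_succ (k : ℕ) : opB ι k * opY ι (k + 1) = opB ι k * opY ι k + opB ι k := by
  rw [opY_succ, mul_add, mul_add, ← mul_assoc (opB ι k) (opC ι k), opB_opC, zero_mul, add_zero,
    opB_opS, ← mul_assoc, ← mul_assoc, opB_opS, opB_opY_opS]

end Jucys
end AffineVW

/-! ### The representation of the supercategory. -/

namespace AffineVW

set_option linter.unusedSectionVars false
set_option linter.unusedVariables false

section Rho

variable {ι : Type} [Fintype ι] [DecidableEq ι]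

variable (ι) in
/-- The operator of an expression placed to the right of `k` letters. -/
noncomputable def rho : ∀ {m n : ℕ}, ℕ → Diag m n → Op ι
  | _, _, _, .id _ => 1
  | _, _, k, .s => opS ι k
  | _, _, k, .b => opB ι k
  | _, _, k, .bs => opC ι k
  | _, _, k, .y => opY ι k
  | _, _, k, .comp f g => rho k f * rho k g
  | _, _, k, .tensor (m := m) f g _ _ => rho k f * rho (k + m) g
  | _, _, _, .zero _ _ => 0
  | _, _, k, .add f g => rho k f + rho k g
  | _, _, k, .smul c f => c • rho k f

/-- The families of operators of the generators with their parities. -/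
inductive IsGen : ZMod 2 → (ℕ → Op ι) → Prop
  | ofLocal {p : ZMod 2} {T : ℕ → Op ι} : IsLocal p T → IsGen p T
  | ofY : IsGen 0 (opY ι)

theorem IsGen.comm_opS {p : ZMod 2} {T : ℕ → Op ι} (h : IsGen p T) (k j : ℕ) :
    T (k + j + 2) * opS ι k = opS ι k * T (k + j + 2) := by
  rcases h with h | _
  · exact opS_comm h k j
  · exact (opS_opY k j).symm

theorem IsGen.comm_opB {p : ZMod 2} {T : ℕ → Op ι} (h : IsGen p T) (k j : ℕ) :
    T (k + j) * opB ι k = sgn p 1 • (opB ι k * T (k + j + 2)) := by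
  rcases h with h | _
  · exact opB_comm h k j
  · rw [sgn_zero_left, one_smul]; exact (opB_opY k j).symm

theorem IsGen.comm_opC {p : ZMod 2} {T : ℕ → Op ι} (h : IsGen p T) (k j : ℕ) :
    T (k + j + 2) * opC ι k = sgn p 1 • (opC ι k * T (k + j)) := by
  rcases h with h | _
  · exact opC_comm h k j
  · rw [sgn_zero_left, one_smul]; exact opY_opC k j

theorem IsGen.comm_opY {p : ZMod 2} {T : ℕ → Op ι} (h : IsGen p T) (k j : ℕ) :
    T (k + j + 1) * opY ι k = opY ι k * T (k + j + 1) := by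
  rcases h with h | _
  · exact opY_comm_local h k j
  · exact opY_comm _ _

theorem IsGen.comm_rho {p : ZMod 2} {T : ℕ → Op ι} (hT : IsGen p T) {l m : ℕ} {h : Diag l m}
    {q : ZMod 2} (hh : h.HasParity q) (k j : ℕ) :
    T (k + j + m) * rho ι k h = sgn p q • (rho ι k h * T (k + j + l)) := by
  induction hh generalizing k j with
  | id n => simp [rho, sgn_zero_right]
  | s => simpa [rho, sgn_zero_right] using hT.comm_opS k j
  | b => simpa [rho] using hT.comm_opB k j
  | bs => simpa [rho] using hT.comm_opC k j
  | y => simpa [rho, sgn_zero_right] using hT.comm_opY k j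
  | comp _ _ ih₁ ih₂ =>
    rw [rho, ← mul_assoc, ih₁, smul_mul_assoc, mul_assoc, ih₂, mul_smul_comm, smul_smul,
      sgn_add_right, mul_assoc]
  | @tensor m n m' n' k' l' f g p' q' hk hl _ _ ih₁ ih₂ =>
    rw [rho, ← mul_assoc, hl, show k + j + (n + n') = k + (j + n') + n by omega, ih₁,
      smul_mul_assoc, mul_assoc, show k + (j + n') + m = k + m + j + n' by omega, ih₂,
      mul_smul_comm, smul_smul, sgn_add_right, mul_assoc, hk,
      show k + m + j + m' = k + j + (m + m') by omega]
  | zero => simp [rho]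
  | add _ _ ih₁ ih₂ => rw [rho, mul_add, add_mul, ih₁, ih₂, smul_add]
  | smul c _ ih => rw [rho, mul_smul_comm, ih, smul_mul_assoc, smul_comm]

/-- The operator form of the super interchange law. The case of a generator `g` is `IsGen.comm_rho`;
the rest is induction on `g`. The displacement of `g` changes from `m` to `l` because `h` converts
`l` strands on its right-hand side of the product into `m`. -/
theorem rho_comm {m' n' : ℕ} {g : Diag m' n'} {p : ZMod 2} (hg : g.HasParity p)
    {l m : ℕ} {h : Diag l m} {q : ZMod 2} (hh : h.HasParity q) (k j : ℕ) :
    rho ι (k + j + m) g * rho ι k h = sgn p q • (rho ι k h * rho ι (k + j + l) g) := by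
  induction hg generalizing j with
  | id n => simp [rho, sgn_zero_left]
  | s => exact IsGen.comm_rho (.ofLocal .opS) hh k j
  | b => exact IsGen.comm_rho (.ofLocal .opB) hh k j
  | bs => exact IsGen.comm_rho (.ofLocal .opC) hh k j
  | y => exact IsGen.comm_rho .ofY hh k j
  | comp _ _ ih₁ ih₂ =>
    rw [rho, rho, mul_assoc, ih₂, mul_smul_comm, ← mul_assoc, ih₁, smul_mul_assoc, smul_smul,
      sgn_add_left, mul_assoc, mul_comm (sgn _ _)]
  | @tensor m₁ n₁ m₂ n₂ k' l' f g p' q' hk hl _ _ ih₁ ih₂ =>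
    rw [rho, rho, mul_assoc, show k + j + m + m₁ = k + (j + m₁) + m by omega, ih₂,
      mul_smul_comm, ← mul_assoc, ih₁, smul_mul_assoc, smul_smul, sgn_add_left,
      mul_comm (sgn _ _), mul_assoc, show k + (j + m₁) + l = k + j + l + m₁ by omega]
  | zero => simp [rho]
  | add _ _ ih₁ ih₂ => rw [rho, rho, add_mul, mul_add, ih₁, ih₂, smul_add]
  | smul c _ ih => rw [rho, rho, smul_mul_assoc, ih, mul_smul_comm, smul_comm]

/-- The representation is well defined for every number `k` of letters on the left. This freedom in
`k` is what makes finite differences, and hence symbols, available. -/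
theorem rho_eq_of_rel {m n : ℕ} {f g : Diag m n} (h : Diag.Rel f g) (k : ℕ) :
    rho ι k f = rho ι k g := by
  induction h generalizing k with
  | refl f => rfl
  | symm _ ih => exact (ih k).symm
  | trans _ _ ih₁ ih₂ => exact (ih₁ k).trans (ih₂ k)
  | comp_congr _ _ ih₁ ih₂ => rw [rho, rho, ih₁, ih₂]
  | tensor_congr hk hl _ _ ih₁ ih₂ => rw [rho, rho, ih₁, ih₂]
  | add_congr _ _ ih₁ ih₂ => rw [rho, rho, ih₁, ih₂]
  | smul_congr c _ ih => rw [rho, rho, ih]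
  | add_assoc f g h => simp only [rho, add_assoc]
  | add_comm f g => simp only [rho, add_comm]
  | zero_add f => simp only [rho, zero_add]
  | neg_add f =>
    simp only [rho]
    module
  | one_smul f => simp only [rho, one_smul]
  | mul_smul c d f => simp only [rho, mul_smul]
  | smul_add c f g => simp only [rho, smul_add]
  | add_smul c d f => simp only [rho, add_smul]
  | add_comp f f' g => simp only [rho, add_mul]
  | comp_add f g g' => simp only [rho, mul_add]
  | smul_comp c f g => simp only [rho, smul_mul_assoc]
  | comp_smul c f g => simp only [rho, mul_smul_comm]
  | comp_assoc f g h => simp only [rho, mul_assoc]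
  | id_comp f => simp only [rho, one_mul]
  | comp_id f => simp only [rho, mul_one]
  | add_tensor f f' g hk hl => simp only [rho, add_mul]
  | tensor_add f g g' hk hl => simp only [rho, mul_add]
  | smul_tensor c f g hk hl => simp only [rho, smul_mul_assoc]
  | tensor_smul c f g hk hl => simp only [rho, mul_smul_comm]
  | tensor_assoc f g h hk hl hk' hl' hm hn hm' hn' =>
    subst hk
    simp only [rho, mul_assoc, add_assoc]
  | unit_tensor f hm hn => simp only [rho, one_mul, add_zero]
  | tensor_unit f hm hn => simp only [rho, mul_one]
  | id_tensor_id hk => simp only [rho, mul_one]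
  | @interchange l m n l' m' n' i j o p q f g h k' hi hj ho hg hh =>
    have := rho_comm (ι := ι) hg hh k 0
    simp only [add_zero] at this
    simp only [rho]
    rw [mul_assoc, ← mul_assoc (rho ι (k + m) g), this]
    simp only [smul_mul_assoc, mul_smul_comm, mul_assoc, sgn]
  | s_sq => simp only [rho, opS_sq]
  | braid =>
    simp only [rho, mul_one, one_mul]
    rw [← mul_assoc, ← mul_assoc]
    exact opS_braid k
  | snake_neg => simpa only [rho, mul_one, one_mul] using opB_opC_succ k
  | snake => simpa only [rho, mul_one, one_mul] using opB_succ_opC k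
  | untwist => simpa only [rho, mul_one, one_mul] using opS_succ_opC k
  | s_bs => exact opS_opC k
  | dot_s =>
    simp only [rho, mul_one, one_mul]
    rw [← mul_assoc]
    exact opY_succ k
  | dot_b => simpa only [rho, mul_one, one_mul] using opB_opY_succ k

variable (ι) in
/-- The operator of a morphism placed to the right of `k` letters. -/
noncomputable def Mor.rep (k : ℕ) {m n : ℕ} : Mor m n →ₗ[ℂ] Op ι where
  toFun := Quotient.lift (rho ι k) fun _ _ h => rho_eq_of_rel h k
  map_add' := by rintro ⟨f⟩ ⟨g⟩; rfl
  map_smul' := by rintro c ⟨f⟩; rfl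

theorem Mor.rep_comp (k : ℕ) {l m n : ℕ} (f : Mor m n) (g : Mor l m) :
    Mor.rep ι k (Mor.comp f g) = Mor.rep ι k f * Mor.rep ι k g := by
  obtain ⟨f⟩ := f
  obtain ⟨g⟩ := g
  rfl

end Rho
end AffineVW

/-! ### Order of operator families under finite differences in the number of letters on the left. -/

namespace AffineVW

set_option linter.unusedSectionVars false
set_option linter.unusedVariables false

section Order

variable {ι : Type} [Fintype ι] [DecidableEq ι]

theorem out_mul_shift_mul_inn (p : ZMod 2) (T : Op ι) (x' x : Letter ι) :
    out x' * shift p T * inn x = if x' = x then sgn p x.2 • T else 0 := by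
  refine LinearMap.ext fun u => funext fun w => ?_
  simp only [Module.End.mul_apply, out_apply, shift_cons]
  have : out x' (inn x u) = if x' = x then u else 0 := by
    funext t
    simp only [out_apply, inn_cons]
    split_ifs <;> rfl
  rw [this]
  split_ifs with h
  · subst h; rfl
  · simp

theorem out_mul_shift (p : ZMod 2) (T : Op ι) (x : Letter ι) :
    out x * shift p T = sgn p x.2 • (T * out x) := rfl

theorem shift_mul_inn (p : ZMod 2) (T : Op ι) (x : Letter ι) :
    shift p T * inn x = sgn p x.2 • (inn x * T) := by
  refine op_ext fun u y t => ?_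
  simp only [Module.End.mul_apply, shift_cons, LinearMap.smul_apply, Pi.smul_apply, smul_eq_mul,
    inn_cons]
  have : out y (inn x u) = if y = x then u else 0 := by
    funext t
    simp only [out_apply, inn_cons]
    split_ifs <;> rfl
  rw [this]
  split_ifs with h
  · subst h; rfl
  · simp

theorem sum_inn_mul_out : ∑ x : Letter ι, inn x * out x = 1 := by
  refine op_ext fun u y t => ?_
  simp [LinearMap.sum_apply, Finset.sum_apply]

/-- The deviation of a family of operators of parity `p` from translation invariance, as a matrix
in the letter on the left. -/
noncomputable def famDelta (p : ZMod 2) (x' x : Letter ι) (T : ℕ → Op ι) : ℕ → Op ι :=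
  fun k => out x' * T (k + 1) * inn x - if x' = x then sgn p x.2 • T k else 0

theorem famDelta_add (p : ZMod 2) (x' x : Letter ι) (T T' : ℕ → Op ι) :
    famDelta p x' x (T + T') = famDelta p x' x T + famDelta p x' x T' := by
  funext k
  simp only [famDelta, Pi.add_apply, mul_add, add_mul]
  split_ifs
  · rw [smul_add]; abel
  · abel

theorem famDelta_smul (p : ZMod 2) (x' x : Letter ι) (c : ℂ) (T : ℕ → Op ι) :
    famDelta p x' x (c • T) = c • famDelta p x' x T := by
  funext k
  simp only [famDelta, Pi.smul_apply, smul_sub, mul_smul_comm, smul_mul_assoc]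
  split_ifs
  · rw [smul_comm]
  · simp

theorem famDelta_zero (p : ZMod 2) (x' x : Letter ι) :
    famDelta p x' x (0 : ℕ → Op ι) = 0 := by
  funext k
  simp [famDelta]

/-- A Leibniz rule: insert the resolution of the identity `sum_inn_mul_out` between the factors and
write each matrix entry as its translation-invariant part plus its deviation. The sum over `z` is
the term in which both factors deviate. -/
theorem famDelta_mul (p q : ZMod 2) (x' x : Letter ι) (T T' : ℕ → Op ι) :
    famDelta (p + q) x' x (T * T') =
      ∑ z, famDelta p x' z T * famDelta q z x T' + sgn q x.2 • (famDelta p x' x T * T')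
        + sgn p x'.2 • (T * famDelta q x' x T') := by
  funext k
  have h1 : out x' * (T (k + 1) * T' (k + 1)) * inn x =
      ∑ z, (out x' * T (k + 1) * inn z) * (out z * T' (k + 1) * inn x) := by
    calc _ = out x' * T (k + 1) * (∑ z, inn z * out z) * (T' (k + 1) * inn x) := by
          rw [sum_inn_mul_out]; simp only [mul_assoc, one_mul]
      _ = _ := by
          rw [Finset.mul_sum, Finset.sum_mul]
          simp only [mul_assoc]
  simp only [famDelta, Pi.mul_apply, Pi.add_apply, Pi.smul_apply, Finset.sum_apply]
  rw [h1]
  simp only [sub_mul, mul_sub, Finset.sum_sub_distrib, ite_mul, mul_ite, zero_mul, mul_zero,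
    Finset.sum_ite_eq, Finset.sum_ite_eq', Finset.mem_univ, if_true]
  split_ifs with h
  · subst h
    simp only [smul_mul_assoc, mul_smul_comm, smul_sub, smul_smul, sgn_add_left,
      mul_comm (sgn q x'.2)]
    abel
  · simp only [smul_mul_assoc, mul_smul_comm, sub_zero]
    abel

/-- Families of operators of parity `p` and of order less than `d`. -/
def OrdLT : ℕ → ZMod 2 → (ℕ → Op ι) → Prop
  | 0, _, T => T = 0
  | d + 1, p, T => ∀ x' x : Letter ι, OrdLT d (p + x'.2 + x.2) (famDelta p x' x T)

theorem OrdLT.zero (d : ℕ) (p : ZMod 2) : OrdLT d p (0 : ℕ → Op ι) := by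
  induction d generalizing p with
  | zero => rfl
  | succ d ih => intro x' x; rw [famDelta_zero]; exact ih _

theorem OrdLT.add {d : ℕ} {p : ZMod 2} {T T' : ℕ → Op ι} (h : OrdLT d p T) (h' : OrdLT d p T') :
    OrdLT d p (T + T') := by
  induction d generalizing p T T' with
  | zero => rw [show T = 0 from h, show T' = 0 from h', add_zero]; rfl
  | succ d ih => intro x' x; rw [famDelta_add]; exact ih (h x' x) (h' x' x)

theorem OrdLT.smul {d : ℕ} {p : ZMod 2} {T : ℕ → Op ι} (c : ℂ) (h : OrdLT d p T) :
    OrdLT d p (c • T) := by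
  induction d generalizing p T with
  | zero => rw [show T = 0 from h, smul_zero]; rfl
  | succ d ih => intro x' x; rw [famDelta_smul]; exact ih (h x' x)

theorem OrdLT.sum {α : Type} (s : Finset α) {d : ℕ} {p : ZMod 2} {T : α → ℕ → Op ι}
    (h : ∀ i ∈ s, OrdLT d p (T i)) : OrdLT d p (∑ i ∈ s, T i) :=
  Finset.sum_induction T (OrdLT d p) (fun _ _ => OrdLT.add) (OrdLT.zero d p) h

theorem OrdLT.succ {d : ℕ} {p : ZMod 2} {T : ℕ → Op ι} (h : OrdLT d p T) :
    OrdLT (d + 1) p T := by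
  induction d generalizing p T with
  | zero => rw [show T = 0 from h]; exact OrdLT.zero _ _
  | succ d ih => intro x' x; exact ih (h x' x)

theorem OrdLT.mono {d e : ℕ} {p : ZMod 2} {T : ℕ → Op ι} (h : OrdLT d p T) (hde : d ≤ e) :
    OrdLT e p T := by
  induction hde with
  | refl => exact h
  | step _ ih => exact ih.succ

/-- Every term of the Leibniz rule `famDelta_mul` contains at least one deviation and so loses an
order; induct on `d + e`. -/
theorem OrdLT.mul {d e : ℕ} {p q : ZMod 2} {T T' : ℕ → Op ι} (h : OrdLT (d + 1) p T)
    (h' : OrdLT (e + 1) q T') : OrdLT (d + e + 1) (p + q) (T * T') := by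
  have par : ∀ p q a b c : ZMod 2, p + a + c + (q + c + b) = p + q + a + b := by decide
  have par2 : ∀ p q a b : ZMod 2, p + a + b + q = p + q + a + b := by decide
  have par3 : ∀ p q a b : ZMod 2, p + (q + a + b) = p + q + a + b := by decide
  induction hn : d + e generalizing d e p q T T' with
  | zero =>
    obtain ⟨rfl, rfl⟩ : d = 0 ∧ e = 0 := by omega
    intro x' x
    rw [famDelta_mul]
    have h1 : ∀ x' x, famDelta p x' x T = 0 := fun x' x => h x' x
    have h2 : ∀ x' x, famDelta q x' x T' = 0 := fun x' x => h' x' x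
    simp only [h1, h2, zero_mul, mul_zero, smul_zero, Finset.sum_const_zero, add_zero]
    rfl
  | succ n ih =>
    intro x' x
    rw [famDelta_mul]
    refine OrdLT.add (OrdLT.add (OrdLT.sum _ fun z _ => ?_) ?_) ?_
    · rw [← par p q x'.2 x.2 z.2]
      rcases d with _ | d
      · rw [show famDelta p x' z T = 0 from h x' z, zero_mul]; exact OrdLT.zero _ _
      rcases e with _ | e
      · rw [show famDelta q z x T' = 0 from h' z x, mul_zero]; exact OrdLT.zero _ _
      · exact ih (h x' z) (h' z x).succ (by omega)
    · refine OrdLT.smul _ ?_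
      rw [← par2]
      rcases d with _ | d
      · rw [show famDelta p x' x T = 0 from h x' x, zero_mul]; exact OrdLT.zero _ _
      · exact ih (h x' x) h' (by omega)
    · refine OrdLT.smul _ ?_
      rw [← par3]
      rcases e with _ | e
      · rw [show famDelta q x' x T' = 0 from h' x' x, mul_zero]; exact OrdLT.zero _ _
      · exact ih h (h' x' x) (by omega)

/-! ### Orders of the generators -/

theorem IsLocal.ordLT {p : ZMod 2} {T : ℕ → Op ι} (h : IsLocal p T) (q : ℕ) :
    OrdLT 1 p (fun k => T (k + q)) := by
  intro x' x
  funext k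
  simp only [famDelta]
  rw [show k + 1 + q = k + q + 1 by omega, h.succ, out_mul_shift_mul_inn, sub_self]
  rfl

theorem ordLT_one : OrdLT 1 0 (1 : ℕ → Op ι) := by
  intro x' x
  funext k
  simp only [famDelta, Pi.one_apply]
  rw [← shift_one, out_mul_shift_mul_inn, shift_one, sub_self]
  rfl

/-- The part of the Jucys–Murphy operators that involves an additional letter on the left. -/
noncomputable def opOmega (x' x : Letter ι) : ℕ → Op ι
  | 0 => sgn x.2 x'.2 • (inn x * out x') + sgn 1 x'.2 • (inn x'.dual * out x.dual)
  | q + 1 => shift (x'.2 + x.2) (opOmega x' x q)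

theorem crossOp_inn_out_crossOp (x y : Letter ι) :
    crossOp * (inn x * out y) * crossOp = shift (x.2 + y.2) (inn x * out y) := by
  refine op_ext₂ fun u z t w => ?_
  simp only [Module.End.mul_apply, crossOp_cons, inn_cons, shift_cons, out_apply]
  split_ifs with h
  · subst h
    rw [sgn_add_left, sgn_comm z.2]
    ring
  · simp

theorem opS_opOmega_opS (x' x : Letter ι) (q : ℕ) :
    opS ι q * opOmega x' x q * opS ι q = opOmega x' x (q + 1) := by
  have par : x'.2 + 1 + (x.2 + 1) = x'.2 + x.2 := by
    have : ∀ a b : ZMod 2, a + 1 + (b + 1) = a + b := by decide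
    exact this _ _
  induction q with
  | zero =>
    rw [opOmega, opOmega, opOmega, opS, mul_add, add_mul, mul_smul_comm, mul_smul_comm,
      smul_mul_assoc, smul_mul_assoc, crossOp_inn_out_crossOp, crossOp_inn_out_crossOp, shift_add,
      shift_smul, shift_smul, Letter.dual_snd, Letter.dual_snd, add_comm x.2,
      par]
  | succ q ih =>
    have h1 := shift_mul (x'.2 + x.2) 0 (opS ι q * opOmega x' x q) (opS ι q)
    have h2 := shift_mul 0 (x'.2 + x.2) (opS ι q) (opOmega x' x q)
    rw [add_zero] at h1
    rw [zero_add] at h2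
    rw [opS, opOmega, ← h2, ← h1, ih, opOmega]
    rfl

/-- Only the base of the recursion, the crossing plus cup-cap at the places 0 and 1, involves the
first letter. Conjugation by the later crossings carries this interaction to the place `q`. -/
theorem out_opY_inn (x' x : Letter ι) (q : ℕ) :
    out x' * opY ι (q + 1) * inn x = (if x' = x then opY ι q else 0) + opOmega x' x q := by
  induction q with
  | zero =>
    rw [opY_succ, show opY ι 0 = 0 from rfl, mul_zero, zero_mul, zero_add, ite_self, zero_add]
    refine op_ext fun u y t => ?_
    simp only [opS, opC, opB, opOmega, Module.End.mul_apply, out_apply, LinearMap.add_apply,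
      Pi.add_apply, crossOp_cons, cupOp_cons, capOp_apply, inn_cons, LinearMap.smul_apply,
      Pi.smul_apply, smul_eq_mul]
    congr 1
    · by_cases h : y = x
      · subst h; simp [sgn_comm]
      · simp [h]
    · by_cases h : y = x'.dual
      · subst h
        rw [if_pos rfl, if_pos rfl, Finset.sum_ite_eq' Finset.univ x]
        simp
      · simp [h]
  | succ q ih =>
    have hS : opS ι (q + 1) = shift 0 (opS ι q) := rfl
    have hCB : opC ι (q + 1) * opB ι (q + 1) = shift 0 (opC ι q * opB ι q) :=
      (shift_one_mul_one _ _).symm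
    have h1 : out x' * (opS ι (q + 1) * opY ι (q + 1) * opS ι (q + 1)) * inn x =
        (if x' = x then opS ι q * opY ι q * opS ι q else 0) + opOmega x' x (q + 1) := by
      calc _ = (out x' * opS ι (q + 1)) * opY ι (q + 1) * (opS ι (q + 1) * inn x) := by
            simp only [mul_assoc]
        _ = opS ι q * (out x' * opY ι (q + 1) * inn x) * opS ι q := by
            rw [hS, out_mul_shift, shift_mul_inn, sgn_zero_left, sgn_zero_left, one_smul, one_smul]
            simp only [mul_assoc]
        _ = _ := by
            rw [ih, mul_add, add_mul, opS_opOmega_opS]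
            split_ifs <;> simp
    rw [opY_succ (q + 1), mul_add, mul_add, add_mul, add_mul, h1, hCB, hS, out_mul_shift_mul_inn,
      out_mul_shift_mul_inn, sgn_zero_left, one_smul, one_smul, opY_succ q]
    split_ifs
    · abel
    · abel

theorem famDelta_opY (x' x : Letter ι) (q : ℕ) :
    famDelta 0 x' x (fun k => opY ι (k + q)) = fun k => opOmega x' x (k + q) := by
  funext k
  simp only [famDelta]
  rw [show k + 1 + q = k + q + 1 by omega, out_opY_inn, sgn_zero_left, one_smul]
  abel

theorem ordLT_opOmega (x' x : Letter ι) (q : ℕ) :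
    OrdLT 1 (x'.2 + x.2) (fun k => opOmega x' x (k + q)) := by
  intro y' y
  funext k
  simp only [famDelta]
  rw [show k + 1 + q = k + q + 1 by omega, opOmega, out_mul_shift_mul_inn, sub_self]
  rfl

theorem ordLT_opY (q : ℕ) : OrdLT 2 0 (fun k => opY ι (k + q)) := by
  intro x' x
  rw [famDelta_opY, zero_add]
  exact ordLT_opOmega x' x q

end Order
end AffineVW

/-! ### Leading symbols. -/

namespace AffineVW

set_option linter.unusedSectionVars false
set_option linter.unusedVariables false

section Symbol

variable {ι : Type} [Fintype ι] [DecidableEq ι]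

/-- The diagonal deviation at an even letter. -/
noncomputable def diagDelta (l : ι) (T : ℕ → Op ι) : ℕ → Op ι :=
  fun k => out (l, 0) * T (k + 1) * inn (l, 0) - T k

theorem famDelta_even (p : ZMod 2) (l : ι) (T : ℕ → Op ι) :
    famDelta p (l, 0) (l, 0) T = diagDelta l T := by
  funext k
  simp [famDelta, diagDelta, sgn_zero_right]

theorem OrdLT.diagDelta {d : ℕ} {p : ZMod 2} {T : ℕ → Op ι} (h : OrdLT (d + 1) p T) (l : ι) :
    OrdLT d p (diagDelta l T) := by
  have := h (l, 0) (l, 0)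
  rwa [famDelta_even, add_zero, add_zero] at this

/-- The projector onto words with label `l` at place `q`. -/
def labelProj (l : ι) (q : ℕ) : Op ι where
  toFun u w := if (w q).1 = l then u w else 0
  map_add' u v := by ext w; simp only [Pi.add_apply]; split_ifs <;> simp
  map_smul' c u := by ext w; simp

theorem labelProj_apply (l : ι) (q : ℕ) (u : Word ι → ℂ) (w : Word ι) :
    labelProj l q u w = if (w q).1 = l then u w else 0 := rfl

theorem labelProj_succ (l : ι) (q : ℕ) : labelProj l (q + 1) = shift 0 (labelProj l q) := by
  refine op_ext fun u x t => ?_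
  simp only [labelProj_apply, sgn_zero_left, shift_cons, one_mul]
  rfl

/-- The crossing part of the interaction detects the letter `(l, 0)` and the cup-cap part detects
its dual `(l, 1)`. Together they detect the label, with no regard to parity. -/
theorem opOmega_even (l : ι) (q : ℕ) : opOmega (l, 0) (l, 0) q = labelProj l q := by
  induction q with
  | zero =>
    refine op_ext fun u y t => ?_
    simp only [opOmega, sgn_zero_right, one_smul, LinearMap.add_apply, Module.End.mul_apply,
      Pi.add_apply, inn_cons, out_apply, labelProj_apply]
    change _ = if y.1 = l then u (Word.cons y t) else 0
    by_cases h : y.1 = l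
    · rw [if_pos h]
      have := Letter.eq_or_eq_dual (x := y) (y := (l, 0)) h
      rcases this with rfl | rfl
      · simp [(Letter.dual_ne _).symm]
      · simp [(Letter.dual_ne _)]
    · rw [if_neg h, if_neg (fun e => h (by rw [e])), if_neg (fun e => h (by rw [e]; rfl)), add_zero]
  | succ q ih => rw [opOmega, ih, labelProj_succ, add_zero]

/-- The unnormalised symbol of degree `d` of a family of operators, as a matrix coefficient. -/
noncomputable def rawSym : ℕ → (ℕ → Op ι) → (Word ι → ℂ) → Word ι → MvPolynomial ι ℂ
  | 0, T, u, w => MvPolynomial.C (T 0 u w)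
  | d + 1, T, u, w => ∑ l : ι, MvPolynomial.X l * rawSym d (diagDelta l T) u w

theorem diagDelta_add (l : ι) (T T' : ℕ → Op ι) :
    diagDelta l (T + T') = diagDelta l T + diagDelta l T' := by
  funext k
  simp only [diagDelta, Pi.add_apply, mul_add, add_mul]
  abel

theorem diagDelta_smul (l : ι) (c : ℂ) (T : ℕ → Op ι) :
    diagDelta l (c • T) = c • diagDelta l T := by
  funext k
  simp only [diagDelta, Pi.smul_apply, smul_sub, mul_smul_comm, smul_mul_assoc]

theorem rawSym_add (d : ℕ) (T T' : ℕ → Op ι) (u : Word ι → ℂ) (w : Word ι) :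
    rawSym d (T + T') u w = rawSym d T u w + rawSym d T' u w := by
  induction d generalizing T T' with
  | zero => simp [rawSym]
  | succ d ih => simp only [rawSym, diagDelta_add, ih, mul_add, Finset.sum_add_distrib]

theorem rawSym_smul (d : ℕ) (c : ℂ) (T : ℕ → Op ι) (u : Word ι → ℂ) (w : Word ι) :
    rawSym d (c • T) u w = c • rawSym d T u w := by
  induction d generalizing T with
  | zero => simp [rawSym, MvPolynomial.smul_eq_C_mul]
  | succ d ih => simp only [rawSym, diagDelta_smul, ih, mul_smul_comm, Finset.smul_sum]

theorem rawSym_zero (d : ℕ) (u : Word ι → ℂ) (w : Word ι) :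
    rawSym d (0 : ℕ → Op ι) u w = 0 := by
  simpa using rawSym_smul d 0 (0 : ℕ → Op ι) u w

theorem OrdLT.rawSym_eq_zero {d : ℕ} {p : ZMod 2} {T : ℕ → Op ι} (h : OrdLT d p T)
    (u : Word ι → ℂ) (w : Word ι) : rawSym d T u w = 0 := by
  induction d generalizing T with
  | zero => rw [show T = 0 from h, rawSym_zero]
  | succ d ih => exact Finset.sum_eq_zero fun l _ => by rw [ih (h.diagDelta l), mul_zero]

theorem rawSym_isHomogeneous (d : ℕ) (T : ℕ → Op ι) (u : Word ι → ℂ) (w : Word ι) :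
    (rawSym d T u w).IsHomogeneous d := by
  induction d generalizing T with
  | zero => exact MvPolynomial.isHomogeneous_C _ _
  | succ d ih =>
    refine MvPolynomial.IsHomogeneous.sum _ _ _ fun l _ => ?_
    rw [add_comm]
    exact (MvPolynomial.isHomogeneous_X _ _).mul (ih _)

/-- Operators that are not affected by a letter on the left. -/
theorem diagDelta_shift_mul (l : ι) {p : ZMod 2} {A : ℕ → Op ι}
    (hA : ∀ k, A (k + 1) = shift p (A k)) (T : ℕ → Op ι) :
    diagDelta l (A * T) = A * diagDelta l T := by
  funext k
  simp only [diagDelta, Pi.mul_apply, hA]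
  rw [← mul_assoc, out_mul_shift, sgn_zero_right, one_smul, mul_sub]
  simp only [mul_assoc]

theorem rawSym_labelProj_mul (d : ℕ) (l : ι) (q : ℕ) (T : ℕ → Op ι) (u : Word ι → ℂ)
    (w : Word ι) : rawSym d ((fun k => labelProj l (k + q)) * T) u w =
      if (w q).1 = l then rawSym d T u w else 0 := by
  induction d generalizing T with
  | zero =>
    simp only [rawSym, Pi.mul_apply, Module.End.mul_apply, zero_add, labelProj_apply]
    split_ifs <;> simp
  | succ d ih =>
    have hA : ∀ k, labelProj l (k + 1 + q) = shift 0 (labelProj l (k + q)) := fun k => by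
      rw [← labelProj_succ, add_right_comm]
    simp only [rawSym, diagDelta_shift_mul (A := fun k => labelProj l (k + q)) _ hA, ih]
    split_ifs <;> simp

theorem diagDelta_mul (p q : ZMod 2) (l : ι) (T T' : ℕ → Op ι) :
    diagDelta l (T * T') = ∑ z, famDelta p (l, 0) z T * famDelta q z (l, 0) T' +
      diagDelta l T * T' + T * diagDelta l T' := by
  rw [← famDelta_even (p + q), famDelta_mul, sgn_zero_right, sgn_zero_right, one_smul, one_smul,
    famDelta_even, famDelta_even]

theorem diagDelta_opY (l : ι) (q : ℕ) :
    diagDelta l (fun k => opY ι (k + q)) = fun k => labelProj l (k + q) := by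
  rw [← famDelta_even 0, famDelta_opY]
  funext k
  rw [opOmega_even]

/-- In the doubly deviating Leibniz term both factors lose an order, which is one more than a symbol
of degree `d` can see. -/
theorem rawSym_correction {d : ℕ} {p q : ZMod 2} {T T' : ℕ → Op ι} (x : Letter ι) {a b : ℕ}
    (hT : OrdLT (a + 1) p T) (hT' : OrdLT (b + 1) q T') (hab : a + b = d + 1) (u : Word ι → ℂ)
    (w : Word ι) (l : ι) :
    rawSym d (∑ z, famDelta p (l, 0) z T * famDelta q z (l, 0) T') u w = 0 := by
  have par : ∀ p q z : ZMod 2, p + 0 + z + (q + z + 0) = p + q := by decide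
  refine OrdLT.rawSym_eq_zero (p := p + q) (OrdLT.sum _ fun z _ => ?_) u w
  rcases a with _ | a
  · rw [show famDelta p (l, 0) z T = 0 from hT _ _, zero_mul]; exact OrdLT.zero _ _
  rcases b with _ | b
  · rw [show famDelta q z (l, 0) T' = 0 from hT' _ _, mul_zero]; exact OrdLT.zero _ _
  have := OrdLT.mul (hT (l, 0) z) (hT' z (l, 0))
  rw [par] at this
  exact this.mono (by omega)

/-- One of the `d + 1` differences must fall on the dot, where it yields the label projector. Each
of the `d + 1` choices contributes the same product; this is the factor removed by the factorial in
`sym`. -/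
theorem rawSym_opY_mul {d : ℕ} {p : ZMod 2} {T : ℕ → Op ι} (hT : OrdLT (d + 1) p T) (q : ℕ)
    (u : Word ι → ℂ) (w : Word ι) : rawSym (d + 1) ((fun k => opY ι (k + q)) * T) u w =
      (d + 1 : ℂ) • (MvPolynomial.X (w q).1 * rawSym d T u w) := by
  induction d generalizing T with
  | zero =>
    have h0 : ∀ l, diagDelta l T = 0 := fun l => hT.diagDelta l
    change ∑ l : ι, MvPolynomial.X l * rawSym 0 (diagDelta l _) u w = _
    simp only [diagDelta_mul 0 p, h0, mul_zero, add_zero, rawSym_add, diagDelta_opY,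
      rawSym_labelProj_mul, rawSym_correction (w 0) (ordLT_opY q) hT rfl, zero_add]
    simp
  | succ d ih =>
    have hR : rawSym (d + 1) T u w =
        ∑ l : ι, MvPolynomial.X l * rawSym d (diagDelta l T) u w := rfl
    change ∑ l : ι, MvPolynomial.X l * rawSym (d + 1) (diagDelta l _) u w = _
    simp only [diagDelta_mul 0 p, rawSym_add, diagDelta_opY, ih (hT.diagDelta _),
      rawSym_labelProj_mul, rawSym_correction (w 0) (ordLT_opY q) hT (add_comm 1 (d + 1)), zero_add,
      mul_add, Finset.sum_add_distrib]
    simp only [mul_ite, mul_zero, Finset.sum_ite_eq, Finset.mem_univ, if_true, mul_smul_comm,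
      ← Finset.smul_sum]
    rw [hR, Finset.mul_sum]
    simp only [mul_left_comm (MvPolynomial.X (w q).1)]
    push_cast
    module

/-- The symbol of degree `d`. -/
noncomputable def sym (d : ℕ) (T : ℕ → Op ι) (u : Word ι → ℂ) (w : Word ι) : MvPolynomial ι ℂ :=
  ((d.factorial : ℂ)⁻¹) • rawSym d T u w

theorem sym_add (d : ℕ) (T T' : ℕ → Op ι) (u : Word ι → ℂ) (w : Word ι) :
    sym d (T + T') u w = sym d T u w + sym d T' u w := by
  rw [sym, rawSym_add, smul_add]; rfl

theorem sym_smul (d : ℕ) (c : ℂ) (T : ℕ → Op ι) (u : Word ι → ℂ) (w : Word ι) :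
    sym d (c • T) u w = c • sym d T u w := by
  rw [sym, rawSym_smul, smul_comm]; rfl

theorem OrdLT.sym_eq_zero {d : ℕ} {p : ZMod 2} {T : ℕ → Op ι} (h : OrdLT d p T)
    (u : Word ι → ℂ) (w : Word ι) : sym d T u w = 0 := by
  rw [sym, h.rawSym_eq_zero, smul_zero]

theorem sym_zero (T : ℕ → Op ι) (u : Word ι → ℂ) (w : Word ι) :
    sym 0 T u w = MvPolynomial.C (T 0 u w) := by
  simp [sym, rawSym]

theorem sym_isHomogeneous (d : ℕ) (T : ℕ → Op ι) (u : Word ι → ℂ) (w : Word ι) :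
    (sym d T u w).IsHomogeneous d := by
  rw [sym, MvPolynomial.smul_eq_C_mul]
  simpa using (MvPolynomial.isHomogeneous_C ι _).mul (rawSym_isHomogeneous d T u w)

theorem sym_opY_mul {d : ℕ} {p : ZMod 2} {T : ℕ → Op ι} (hT : OrdLT (d + 1) p T) (q : ℕ)
    (u : Word ι → ℂ) (w : Word ι) : sym (d + 1) ((fun k => opY ι (k + q)) * T) u w =
      MvPolynomial.X (w q).1 * sym d T u w := by
  have : (d + 1 : ℂ) ≠ 0 := by exact_mod_cast Nat.succ_ne_zero d
  rw [sym, rawSym_opY_mul hT, sym, mul_smul_comm, smul_smul, Nat.factorial_succ]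
  push_cast
  congr 1
  field_simp

/-! ### Symbols and crossings or cups -/

/-- Exchange the letters at places `q` and `q + 1`. -/
def Word.swapAt (q : ℕ) (w : Word ι) : Word ι :=
  fun n => if n = q then w (q + 1) else if n = q + 1 then w q else w n

/-- Delete the letters at places `q` and `q + 1`. -/
def Word.delAt (q : ℕ) (w : Word ι) : Word ι := fun n => if n < q then w n else w (n + 2)

theorem Word.swapAt_swapAt (q : ℕ) (w : Word ι) : (w.swapAt q).swapAt q = w := by
  funext n
  simp only [swapAt]
  split_ifs <;> first | rfl | omega | (subst_vars; rfl)

theorem Word.swapAt_succ_cons (q : ℕ) (x : Letter ι) (t : Word ι) :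
    (Word.cons x t).swapAt (q + 1) = Word.cons x (t.swapAt q) := by
  funext n
  cases n <;> simp [swapAt]

theorem Word.delAt_succ_cons (q : ℕ) (x : Letter ι) (t : Word ι) :
    (Word.cons x t).delAt (q + 1) = Word.cons x (t.delAt q) := by
  funext n
  cases n <;> simp [delAt]

theorem opS_apply (q : ℕ) (u : Word ι → ℂ) (w : Word ι) :
    opS ι q u w = sgn (w q).2 (w (q + 1)).2 * u (w.swapAt q) := by
  induction q generalizing u w with
  | zero =>
    have : w.swapAt 0 = Word.cons (w 1) (Word.cons (w 0) w.tail.tail) := by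
      funext n
      rcases n with _ | _ | n <;> simp [Word.swapAt, Word.tail]
    rw [this]; rfl
  | succ q ih =>
    obtain ⟨x, t, rfl⟩ := w.exists_cons
    rw [opS, shift_cons, ih, Word.swapAt_succ_cons, sgn_zero_left, one_mul]
    rfl

theorem exists_opC_apply (q : ℕ) (w : Word ι) : ∃ ε : ℂ, ε ≠ 0 ∧ ∀ u : Word ι → ℂ,
    opC ι q u w = if w (q + 1) = (w q).dual then ε * u (w.delAt q) else 0 := by
  induction q generalizing w with
  | zero => exact ⟨sgn 1 (w 0).2, sgn_ne_zero _ _, fun u => rfl⟩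
  | succ q ih =>
    obtain ⟨x, t, rfl⟩ := w.exists_cons
    obtain ⟨ε, hε, h⟩ := ih t
    refine ⟨sgn 1 x.2 * ε, mul_ne_zero (sgn_ne_zero _ _) hε, fun u => ?_⟩
    rw [opC, shift_cons, h, Word.delAt_succ_cons]
    simp [mul_assoc]

/-- Crossings are translation invariant, so finite differences pass through them and they act on
symbols as they act on functions. -/
theorem sym_opS_mul (d q : ℕ) (T : ℕ → Op ι) (u : Word ι → ℂ) (w : Word ι) :
    sym d ((fun k => opS ι (k + q)) * T) u w =
      sgn (w q).2 (w (q + 1)).2 • sym d T u (w.swapAt q) := by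
  have : rawSym d ((fun k => opS ι (k + q)) * T) u w =
      sgn (w q).2 (w (q + 1)).2 • rawSym d T u (w.swapAt q) := by
    induction d generalizing T with
    | zero =>
      simp only [rawSym, Pi.mul_apply, Module.End.mul_apply, zero_add, opS_apply]
      rw [MvPolynomial.smul_eq_C_mul, map_mul]
    | succ d ih =>
      have hA : ∀ k, opS ι (k + 1 + q) = shift 0 (opS ι (k + q)) := fun k => by
        rw [add_right_comm]; rfl
      simp only [rawSym, diagDelta_shift_mul (A := fun k => opS ι (k + q)) _ hA, ih,
        mul_smul_comm, Finset.smul_sum]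
  rw [sym, this, smul_comm]
  rfl

theorem exists_sym_opC_mul (q : ℕ) (w : Word ι) : ∃ ε : ℂ, ε ≠ 0 ∧
    ∀ (d : ℕ) (T : ℕ → Op ι) (u : Word ι → ℂ), sym d ((fun k => opC ι (k + q)) * T) u w =
      if w (q + 1) = (w q).dual then ε • sym d T u (w.delAt q) else 0 := by
  obtain ⟨ε, hε, h⟩ := exists_opC_apply q w
  refine ⟨ε, hε, fun d T u => ?_⟩
  have : rawSym d ((fun k => opC ι (k + q)) * T) u w =
      if w (q + 1) = (w q).dual then ε • rawSym d T u (w.delAt q) else 0 := by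
    induction d generalizing T with
    | zero =>
      simp only [rawSym, Pi.mul_apply, Module.End.mul_apply, zero_add, h]
      split_ifs
      · rw [MvPolynomial.smul_eq_C_mul, map_mul]
      · simp
    | succ d ih =>
      have hA : ∀ k, opC ι (k + 1 + q) = shift 1 (opC ι (k + q)) := fun k => by
        rw [add_right_comm]; rfl
      simp only [rawSym, diagDelta_shift_mul (A := fun k => opC ι (k + q)) _ hA, ih]
      split_ifs
      · simp only [mul_smul_comm, Finset.smul_sum]
      · simp
  rw [sym, this]
  split_ifs
  · rw [smul_comm]; rfl
  · simp

end Symbol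
end AffineVW

namespace AffineVW

/-! ### The algebra of morphisms -/

/-- Two integers of even sum can be halved compatibly with a given parity. -/
theorem exists_parity_split (a b c : ℤ) (hc : a + b = c) (p : ZMod 2)
    (h : ∀ t : ℤ, c = 2 * t → p = t) : ∃ q r : ZMod 2, p = q + r ∧
      (∀ t : ℤ, a = 2 * t → q = t) ∧ (∀ t : ℤ, b = 2 * t → r = t) := by
  rcases Int.even_or_odd' b with ⟨t', rfl | rfl⟩
  · refine ⟨p - t', t', by ring, fun t ht => ?_, fun t ht => ?_⟩
    · rw [h (t + t') (by omega)]; push_cast; ring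
    · rw [show t' = t by omega]
  · rcases Int.even_or_odd' a with ⟨t₀, rfl | rfl⟩
    · exact ⟨t₀, p - t₀, by ring, fun t ht => by rw [show t₀ = t by omega], fun t ht => by omega⟩
    · exact ⟨0, p, by ring, fun t ht => by omega, fun t ht => by omega⟩

/-- Caps and cups are odd and change the number of strands by two, so parity is half of `m - n`
modulo 2. For odd `m - n` the hypothesis is vacuous and every parity is admissible. In particular
every expression is homogeneous, and the interchange law applies to all of them. -/
theorem Diag.hasParity_of {m n : ℕ} (f : Diag m n) (p : ZMod 2)
    (h : ∀ t : ℤ, (m : ℤ) - n = 2 * t → p = t) : f.HasParity p := by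
  induction f generalizing p with
  | id n => rw [h 0 (by simp)]; exact .id n
  | s => rw [h 0 (by simp)]; exact .s
  | b => rw [h 1 (by simp)]; exact .b
  | bs => rw [h (-1) (by simp)]; exact .bs
  | y => rw [h 0 (by simp)]; exact .y
  | @comp l m n f g ihf ihg =>
    obtain ⟨q, r, rfl, hq, hr⟩ := exists_parity_split ((m : ℤ) - n) ((l : ℤ) - m) _ rfl p
      (fun t ht => h t (by omega))
    exact .comp (ihf q hq) (ihg r hr)
  | @tensor m n m' n' k l f g hk hl ihf ihg =>
    obtain ⟨q, r, rfl, hq, hr⟩ := exists_parity_split ((m : ℤ) - n) ((m' : ℤ) - n') _ rfl p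
      (fun t ht => h t (by omega))
    exact .tensor hk hl (ihf q hq) (ihg r hr)
  | zero m n => exact .zero m n p
  | add f g ihf ihg => exact .add (ihf p h) (ihg p h)
  | smul c f ih => exact .smul c (ih p h)

theorem Diag.exists_hasParity {m n : ℕ} (f : Diag m n) : ∃ p, f.HasParity p := by
  rcases Int.even_or_odd' ((m : ℤ) - n) with ⟨t, ht | ht⟩
  · exact ⟨t, f.hasParity_of _ fun t' h => by rw [show t = t' by omega]⟩
  · exact ⟨0, f.hasParity_of _ fun t' h => by omega⟩

namespace Mor

theorem mk_eq {m n : ℕ} {f g : Diag m n} (h : Diag.Rel f g) : mk f = mk g := Quotient.sound h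

/-- Horizontal composition. -/
def tensor {m n m' n' k l : ℕ} (hk : k = m + m') (hl : l = n + n') :
    Mor m n → Mor m' n' → Mor k l :=
  Quotient.map₂ (fun f g => Diag.tensor f g hk hl) fun _ _ h _ _ h' =>
    Diag.Rel.tensor_congr hk hl h h'

/-- The identity morphism. -/
def one (n : ℕ) : Mor n n := mk (Diag.id n)

theorem comp_assoc {k l m n : ℕ} (f : Mor m n) (g : Mor l m) (h : Mor k l) :
    comp (comp f g) h = comp f (comp g h) := by
  obtain ⟨f⟩ := f; obtain ⟨g⟩ := g; obtain ⟨h⟩ := h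
  exact mk_eq (.comp_assoc f g h)

theorem one_comp {m n : ℕ} (f : Mor m n) : comp (one n) f = f := by
  obtain ⟨f⟩ := f
  exact mk_eq (.id_comp f)

theorem comp_one {m n : ℕ} (f : Mor m n) : comp f (one m) = f := by
  obtain ⟨f⟩ := f
  exact mk_eq (.comp_id f)

/-- Vertical composition as a bilinear map. -/
def compL {l m n : ℕ} : Mor m n →ₗ[ℂ] Mor l m →ₗ[ℂ] Mor l n :=
  LinearMap.mk₂ ℂ comp
    (by rintro ⟨f⟩ ⟨f'⟩ ⟨g⟩; exact mk_eq (.add_comp f f' g))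
    (by rintro c ⟨f⟩ ⟨g⟩; exact mk_eq (.smul_comp c f g))
    (by rintro ⟨f⟩ ⟨g⟩ ⟨g'⟩; exact mk_eq (.comp_add f g g'))
    (by rintro c ⟨f⟩ ⟨g⟩; exact mk_eq (.comp_smul c f g))

theorem compL_apply {l m n : ℕ} (f : Mor m n) (g : Mor l m) : compL f g = comp f g := rfl

/-- Horizontal composition as a bilinear map. -/
def tensorL {m n m' n' k l : ℕ} (hk : k = m + m') (hl : l = n + n') :
    Mor m n →ₗ[ℂ] Mor m' n' →ₗ[ℂ] Mor k l :=
  LinearMap.mk₂ ℂ (tensor hk hl)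
    (by rintro ⟨f⟩ ⟨f'⟩ ⟨g⟩; exact mk_eq (.add_tensor f f' g hk hl))
    (by rintro c ⟨f⟩ ⟨g⟩; exact mk_eq (.smul_tensor c f g hk hl))
    (by rintro ⟨f⟩ ⟨g⟩ ⟨g'⟩; exact mk_eq (.tensor_add f g g' hk hl))
    (by rintro c ⟨f⟩ ⟨g⟩; exact mk_eq (.tensor_smul c f g hk hl))

theorem tensor_assoc {m₁ n₁ m₂ n₂ m₃ n₃ k l k' l' m n : ℕ}
    (f : Mor m₁ n₁) (g : Mor m₂ n₂) (h : Mor m₃ n₃)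
    (hk : k = m₁ + m₂) (hl : l = n₁ + n₂) (hk' : k' = m₂ + m₃) (hl' : l' = n₂ + n₃)
    (hm : m = k + m₃) (hn : n = l + n₃) (hm' : m = m₁ + k') (hn' : n = n₁ + l') :
    tensor hm hn (tensor hk hl f g) h = tensor hm' hn' f (tensor hk' hl' g h) := by
  obtain ⟨f⟩ := f; obtain ⟨g⟩ := g; obtain ⟨h⟩ := h
  exact mk_eq (.tensor_assoc f g h _ _ _ _ _ _ _ _)

theorem one_tensor {m n : ℕ} (f : Mor m n) (hm : m = 0 + m) (hn : n = 0 + n) :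
    tensor hm hn (one 0) f = f := by
  obtain ⟨f⟩ := f
  exact mk_eq (.unit_tensor f _ _)

theorem tensor_one {m n : ℕ} (f : Mor m n) (hm : m = m + 0) (hn : n = n + 0) :
    tensor hm hn f (one 0) = f := by
  obtain ⟨f⟩ := f
  exact mk_eq (.tensor_unit f _ _)

theorem one_tensor_one {m m' k : ℕ} (hk : k = m + m') :
    tensor hk hk (one m) (one m') = one k := mk_eq (.id_tensor_id hk)

/-- `f ⊗ 1` after `h ⊗ 1`. -/
theorem tensor_one_comp {l m n r i j o : ℕ} (f : Mor m n) (h : Mor l m) (hi : i = l + r)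
    (hj : j = m + r) (ho : o = n + r) :
    comp (tensor hj ho f (one r)) (tensor hi hj h (one r)) = tensor hi ho (comp f h) (one r) := by
  obtain ⟨f⟩ := f; obtain ⟨h⟩ := h
  obtain ⟨q, hq⟩ := h.exists_hasParity
  refine (mk_eq (.interchange f (.id r) h (.id r) hi hj ho (.id r) hq)).trans ?_
  rw [zero_mul]
  refine (mk_eq (.one_smul _)).trans ?_
  exact mk_eq (.tensor_congr _ _ (.refl _) (.id_comp _))

theorem one_tensor_comp {l m n r i j o : ℕ} (f : Mor m n) (h : Mor l m) (hi : i = r + l)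
    (hj : j = r + m) (ho : o = r + n) :
    comp (tensor hj ho (one r) f) (tensor hi hj (one r) h) = tensor hi ho (one r) (comp f h) := by
  obtain ⟨f⟩ := f; obtain ⟨h⟩ := h
  obtain ⟨q, hq⟩ := f.exists_hasParity
  refine (mk_eq (.interchange (.id r) f (.id r) h hi hj ho hq (.id r))).trans ?_
  rw [mul_zero]
  refine (mk_eq (.one_smul _)).trans ?_
  exact mk_eq (.tensor_congr _ _ (.id_comp _) (.refl _))

/-- `f ⊗ 1` after `1 ⊗ g`. -/
theorem tensor_comp_left {m n m' n' i j o : ℕ} (f : Mor m n) (g : Mor m' n') (hi : i = m + m')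
    (hj : j = m + n') (ho : o = n + n') :
    comp (tensor hj ho f (one n')) (tensor hi hj (one m) g) = tensor hi ho f g := by
  obtain ⟨f⟩ := f; obtain ⟨g⟩ := g
  refine (mk_eq (.interchange f (.id n') (.id m) g hi hj ho (.id n') (.id m))).trans ?_
  rw [zero_mul]
  refine (mk_eq (.one_smul _)).trans ?_
  exact mk_eq (.tensor_congr _ _ (.comp_id _) (.id_comp _))

/-- `1 ⊗ g` after `f ⊗ 1`. -/
theorem tensor_comp_right {m n m' n' i j o : ℕ} {f : Diag m n} {g : Diag m' n'} {p q : ZMod 2}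
    (hf : f.HasParity p) (hg : g.HasParity q) (hi : i = m + m') (hj : j = n + m')
    (ho : o = n + n') :
    comp (tensor hj ho (one n) (mk g)) (tensor hi hj (mk f) (one m')) =
      sgn q p • tensor hi ho (mk f) (mk g) := by
  refine (mk_eq (.interchange (.id n) g f (.id m') hi hj ho hg hf)).trans ?_
  exact mk_eq (.smul_congr _ (.tensor_congr _ _ (.id_comp _) (.comp_id _)))

/-- The morphism `1_p ⊗ f ⊗ 1_q`. -/
def el (p q : ℕ) {m n N N' : ℕ} (f : Mor m n) (h : N = p + m + q) (h' : N' = p + n + q) :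
    Mor N N' :=
  tensor h h' (tensor rfl rfl (one p) f) (one q)

theorem el_comp (p q : ℕ) {l m n N N' N'' : ℕ} (f : Mor m n) (g : Mor l m) (h : N = p + l + q)
    (h' : N' = p + m + q) (h'' : N'' = p + n + q) :
    comp (el p q f h' h'') (el p q g h h') = el p q (comp f g) h h'' := by
  rw [el, el, tensor_one_comp, one_tensor_comp]; rfl

theorem el_one (p q : ℕ) {m N : ℕ} (h : N = p + m + q) : el p q (one m) h h = one N := by
  rw [el, one_tensor_one, one_tensor_one]

theorem el_smul (p q : ℕ) {m n N N' : ℕ} (c : ℂ) (f : Mor m n) (h : N = p + m + q)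
    (h' : N' = p + n + q) : el p q (c • f) h h' = c • el p q f h h' := by
  have := (tensorL h h').map_smul₂ c (tensor rfl rfl (one p) f) (one q)
  rw [el, el]
  refine Eq.trans ?_ this
  congr 1
  exact (tensorL rfl rfl (one p)).map_smul c f

theorem el_add (p q : ℕ) {m n N N' : ℕ} (f g : Mor m n) (h : N = p + m + q)
    (h' : N' = p + n + q) : el p q (f + g) h h' = el p q f h h' + el p q g h h' := by
  have := (tensorL h h').map_add₂ (tensor rfl rfl (one p) f) (tensor rfl rfl (one p) g) (one q)
  rw [el, el, el]
  refine Eq.trans ?_ this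
  congr 1
  exact (tensorL rfl rfl (one p)).map_add f g

theorem el_el (p q p' q' : ℕ) {m n M M' N N' : ℕ} (f : Mor m n) (h₁ : M = p' + m + q')
    (h₁' : M' = p' + n + q') (h : N = p + M + q) (h' : N' = p + M' + q)
    (h₂ : N = (p + p') + m + (q' + q)) (h₂' : N' = (p + p') + n + (q' + q)) :
    el p q (el p' q' f h₁ h₁') h h' = el (p + p') (q' + q) f h₂ h₂' := by
  subst h₁ h₁'
  rw [el, el, el]
  rw [← tensor_assoc (one p) (tensor rfl rfl (one p') f) (one q') (rfl : p + (p' + m) = _)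
    (rfl : p + (p' + n) = _) rfl rfl (by omega) (by omega) rfl rfl]
  rw [← tensor_assoc (one p) (one p') f rfl rfl rfl rfl (by omega) (by omega) rfl rfl]
  rw [tensor_assoc _ (one q') (one q) (by omega) (by omega) rfl rfl (by omega) (by omega)
    (by omega) (by omega), one_tensor_one, one_tensor_one]
  have : ∀ (a b : ℕ) (ha : a = p + p' + m) (hb : b = p + p' + n) (h1 : N = a + (q' + q))
      (h2 : N' = b + (q' + q)), tensor h1 h2 (tensor ha hb (one (p + p')) f) (one (q' + q)) =
        tensor h₂ h₂' (tensor rfl rfl (one (p + p')) f) (one (q' + q)) := by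
    intro a b ha hb h1 h2
    subst ha hb
    rfl
  exact this _ _ _ _ _ _

/-- Morphisms on disjoint sets of strands super-commute. -/
theorem el_far {m n m' n' : ℕ} {f : Diag m n} {g : Diag m' n'} {a b : ZMod 2}
    (hf : f.HasParity a) (hg : g.HasParity b) {p q P P' Q Q' N₁ N₂ N₃ N₄ : ℕ} (r : ℕ)
    (hP : P = p + m + r) (hP' : P' = p + n + r) (hQ : Q = r + m' + q) (hQ' : Q' = r + n' + q)
    (h₁ : N₁ = p + m + Q) (h₂ : N₂ = p + n + Q) (h₃ : N₃ = p + m + Q')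
    (h₄ : N₄ = p + n + Q')
    (h₁' : N₁ = P + m' + q) (h₂' : N₂ = P' + m' + q) (h₃' : N₃ = P + n' + q)
    (h₄' : N₄ = P' + n' + q) :
    comp (el P' q (mk g) h₂' h₄') (el p Q (mk f) h₁ h₂) =
      sgn b a • comp (el p Q' (mk f) h₃ h₄) (el P q (mk g) h₁' h₃') := by
  subst hQ hQ'
  have key : ∀ (k P N N' : ℕ) (hP : P = k + r) (hN : N = k + (r + m' + q))
      (hN' : N' = k + (r + n' + q)) (h : N = P + m' + q) (h' : N' = P + n' + q),
      el P q (mk g) h h' = tensor hN hN' (one k) (el r q (mk g) rfl rfl) := by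
    intro k P N N' hP hN hN' h h'
    subst hP
    rw [el, ← one_tensor_one (m := k) (m' := r) rfl,
      tensor_assoc (one k) (one r) (mk g) rfl rfl rfl rfl rfl rfl (by omega) (by omega),
      tensor_assoc (one k) _ (one q) (by omega) (by omega) rfl rfl (by omega) (by omega)
        (by omega) (by omega)]
    rfl
  rw [key (p + n) P' _ _ hP' h₂ h₄, key (p + m) P _ _ hP h₁ h₃, el, el]
  have hF : (Diag.tensor (Diag.id p) f rfl rfl).HasParity a := by
    have := Diag.HasParity.tensor (k := p + m) (l := p + n) rfl rfl (.id p) hf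
    rwa [zero_add] at this
  have hG : (Diag.tensor (Diag.tensor (Diag.id r) g rfl rfl) (Diag.id q) rfl rfl).HasParity b := by
    have := Diag.HasParity.tensor (k := r + m' + q) (l := r + n' + q) rfl rfl
      (Diag.HasParity.tensor (k := r + m') (l := r + n') rfl rfl (.id r) hg) (.id q)
    rwa [zero_add, add_zero] at this
  refine (tensor_comp_right hF hG h₁ h₂ h₄).trans ?_
  congr 1
  exact (tensor_comp_left (tensor rfl rfl (one p) (mk f)) (el r q (mk g) rfl rfl) h₁ h₃ h₄).symm

end Mor
end AffineVW

/-! ### Generators as operators on morphism spaces. -/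

namespace AffineVW
namespace Mor

theorem el_zero_left (q : ℕ) {m n N N' : ℕ} (f : Mor m n) (h : N = 0 + m + q)
    (h' : N' = 0 + n + q) (h₁ : N = m + q) (h₁' : N' = n + q) :
    el 0 q f h h' = tensor h₁ h₁' f (one q) := by
  have : ∀ (k l : ℕ) (hk : k = 0 + m) (hl : l = 0 + n) (h1 : N = k + q) (h2 : N' = l + q),
      tensor h1 h2 (tensor hk hl (one 0) f) (one q) = tensor h₁ h₁' f (one q) := by
    intro k l hk hl h1 h2
    obtain rfl : k = m := by omega
    obtain rfl : l = n := by omega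
    rw [one_tensor]
  exact this _ _ _ _ _ _

theorem el_zero_right (p : ℕ) {m n N N' : ℕ} (f : Mor m n) (h : N = p + m + 0)
    (h' : N' = p + n + 0) (h₁ : N = p + m) (h₁' : N' = p + n) :
    el p 0 f h h' = tensor h₁ h₁' (one p) f := by
  have : ∀ (k l : ℕ) (hk : k = p + m) (hl : l = p + n) (h1 : N = k + 0) (h2 : N' = l + 0),
      tensor h1 h2 (tensor hk hl (one p) f) (one 0) = tensor h₁ h₁' (one p) f := by
    intro k l hk hl h1 h2
    obtain rfl : k = N := by omega
    obtain rfl : l = N' := by omega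
    rw [tensor_one]
  exact this _ _ _ _ _ _

/-- Composition with `f` applied to the strands starting at `p` (zero if out of range). -/
def act (p : ℕ) {m n : ℕ} (f : Mor m n) (M N N' : ℕ) : Mor M N →ₗ[ℂ] Mor M N' :=
  if h : p + m ≤ N ∧ N + n = N' + m then
    compL (el p (N - p - m) f (by omega) (by omega)) else 0

section act
variable {M : ℕ}

theorem act_eq (p q : ℕ) {m n N N' : ℕ} (f : Mor m n) (h : N = p + m + q) (h' : N' = p + n + q)
    (x : Mor M N) : act p f M N N' x = comp (el p q f h h') x := by
  obtain rfl : q = N - p - m := by omega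
  rw [act, dif_pos ⟨by omega, by omega⟩, compL_apply]

theorem act_comp (p : ℕ) {l m n N N' N'' : ℕ} (f : Mor m n) (g : Mor l m) (h : p + l ≤ N)
    (h' : N + m = N' + l) (h'' : N' + n = N'' + m) (x : Mor M N) :
    act p (comp f g) M N N'' x = act p f M N' N'' (act p g M N N' x) := by
  obtain ⟨q, rfl⟩ := Nat.exists_eq_add_of_le h
  rw [act_eq p q (comp f g) rfl (by omega), act_eq p q g rfl (by omega),
    act_eq p q f (by omega) (by omega), ← comp_assoc, el_comp]

theorem act_one (p : ℕ) {m N : ℕ} (h : p + m ≤ N) (x : Mor M N) : act p (one m) M N N x = x := by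
  obtain ⟨q, rfl⟩ := Nat.exists_eq_add_of_le h
  rw [act_eq p q _ rfl rfl, el_one, one_comp]

theorem act_add (p : ℕ) {m n N N' : ℕ} (f g : Mor m n) (h : p + m ≤ N) (h' : N + n = N' + m)
    (x : Mor M N) : act p (f + g) M N N' x = act p f M N N' x + act p g M N N' x := by
  obtain ⟨q, rfl⟩ := Nat.exists_eq_add_of_le h
  rw [act_eq p q (f + g) rfl (by omega), act_eq p q f rfl (by omega), act_eq p q g rfl (by omega),
    el_add]
  exact LinearMap.map_add₂ compL _ _ _

theorem act_smul (p : ℕ) {m n N N' : ℕ} (c : ℂ) (f : Mor m n) (h : p + m ≤ N)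
    (h' : N + n = N' + m) (x : Mor M N) : act p (c • f) M N N' x = c • act p f M N N' x := by
  obtain ⟨q, rfl⟩ := Nat.exists_eq_add_of_le h
  rw [act_eq p q (c • f) rfl (by omega), act_eq p q f rfl (by omega), el_smul]
  exact LinearMap.map_smul₂ compL _ _ _

theorem act_el (p p' q' : ℕ) {m n k l N N' : ℕ} (f : Mor m n) (hk : k = p' + m + q')
    (hl : l = p' + n + q') (h : p + k ≤ N) (h' : N + n = N' + m) (x : Mor M N) :
    act p (el p' q' f hk hl) M N N' x = act (p + p') f M N N' x := by
  obtain ⟨q, rfl⟩ := Nat.exists_eq_add_of_le h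
  rw [act_eq p q _ rfl (by omega), act_eq (p + p') (q' + q) f (by omega) (by omega), el_el]

theorem act_far {m n m' n' : ℕ} {f : Diag m n} {g : Diag m' n'} {a b : ZMod 2}
    (hf : f.HasParity a) (hg : g.HasParity b) {p P P' N₁ N₂ N₃ N₄ : ℕ}
    (hP : p + m ≤ P) (hP' : P' + m = P + n) (h₁ : P + m' ≤ N₁) (h₂ : N₂ + m = N₁ + n)
    (h₃ : N₃ + m' = N₁ + n') (h₄ : N₄ + m' = N₂ + n') (x : Mor M N₁) :
    act P' (mk g) M N₂ N₄ (act p (mk f) M N₁ N₂ x) =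
      sgn b a • act p (mk f) M N₃ N₄ (act P (mk g) M N₁ N₃ x) := by
  obtain ⟨r, rfl⟩ := Nat.exists_eq_add_of_le hP
  obtain ⟨q, rfl⟩ := Nat.exists_eq_add_of_le h₁
  rw [act_eq p (r + m' + q) (mk f) (N' := N₂) (by omega) (by omega),
    act_eq P' q (mk g) (N' := N₄) (by omega) (by omega),
    act_eq _ q (mk g) (N' := N₃) rfl (by omega),
    act_eq p (r + n' + q) (mk f) (by omega) (by omega), ← comp_assoc, ← comp_assoc,
    el_far hf hg r (P := p + m + r) (P' := P') (N₃ := N₃) rfl (by omega) rfl rfl _ _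
      (by omega) (by omega) rfl _ (by omega) _, ← compL_apply, map_smul, LinearMap.smul_apply]
  rfl

end act

/-- The crossing at the strands `i` and `i + 1`, acting by composition. -/
def cross {M N : ℕ} (i : ℕ) : Mor M N →ₗ[ℂ] Mor M N := act i (mk .s) M N N

/-- The cap at the strands `i` and `i + 1`, acting by composition. -/
def cap {M N : ℕ} (i : ℕ) : Mor M (N + 2) →ₗ[ℂ] Mor M N := act i (mk .b) M (N + 2) N

/-- The cup at the strands `i` and `i + 1`, acting by composition. -/
def cup {M N : ℕ} (i : ℕ) : Mor M N →ₗ[ℂ] Mor M (N + 2) := act i (mk .bs) M N (N + 2)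

/-- The dot at the strand `i`, acting by composition. -/
def dotAt {M N : ℕ} (i : ℕ) : Mor M N →ₗ[ℂ] Mor M N := act i (mk .y) M N N

theorem braid_el : comp (el 0 1 (mk .s) rfl rfl)
      (comp (el 1 0 (mk .s) rfl rfl) (el 0 1 (mk .s) rfl rfl)) =
    comp (el 1 0 (mk .s) rfl rfl)
      (comp (el 0 1 (mk .s) rfl rfl) (el 1 0 (mk .s) (N := 3) rfl rfl)) := by
  rw [el_zero_left 1 (mk .s) rfl rfl rfl rfl, el_zero_right 1 (mk .s) rfl rfl rfl rfl]
  exact mk_eq .braid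

theorem snake_neg_el : comp (el 0 1 (mk .b) rfl rfl) (el 1 0 (mk .bs) (N' := 3) rfl rfl) =
    (-1 : ℂ) • one 1 := by
  rw [el_zero_left 1 (mk .b) rfl rfl rfl rfl, el_zero_right 1 (mk .bs) rfl rfl rfl rfl]
  exact mk_eq .snake_neg

theorem snake_el : comp (el 1 0 (mk .b) rfl rfl) (el 0 1 (mk .bs) (N' := 3) rfl rfl) = one 1 := by
  rw [el_zero_left 1 (mk .bs) rfl rfl rfl rfl, el_zero_right 1 (mk .b) rfl rfl rfl rfl]
  exact mk_eq .snake

theorem untwist_el : comp (el 1 0 (mk .s) rfl rfl) (el 0 1 (mk .bs) (N' := 3) rfl rfl) =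
    comp (el 0 1 (mk .s) rfl rfl) (el 1 0 (mk .bs) rfl rfl) := by
  rw [el_zero_left 1 (mk .bs) rfl rfl rfl rfl, el_zero_right 1 (mk .bs) rfl rfl rfl rfl,
    el_zero_left 1 (mk .s) rfl rfl rfl rfl, el_zero_right 1 (mk .s) rfl rfl rfl rfl]
  exact mk_eq .untwist

theorem dot_s_el : el 1 0 (mk .y) rfl rfl =
    comp (mk .s) (comp (el 0 1 (mk .y) rfl rfl) (mk .s)) + mk .s + comp (mk .bs) (mk .b) := by
  rw [el_zero_left 1 (mk .y) rfl rfl rfl rfl, el_zero_right 1 (mk .y) rfl rfl rfl rfl]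
  exact mk_eq .dot_s

theorem dot_b_el : comp (mk .b) (el 1 0 (mk .y) rfl rfl) =
    comp (mk .b) (el 0 1 (mk .y) rfl rfl) + mk .b := by
  rw [el_zero_left 1 (mk .y) rfl rfl rfl rfl, el_zero_right 1 (mk .y) rfl rfl rfl rfl]
  exact mk_eq .dot_b

section relations
variable {M N : ℕ}

theorem cross_cross {i : ℕ} (h : i + 2 ≤ N) (x : Mor M N) : cross i (cross i x) = x := by
  have : comp (mk .s) (mk .s) = one 2 := mk_eq .s_sq
  rw [cross, ← act_comp i _ _ h (N' := N) (by omega) (by omega), this, act_one i h]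

theorem cross_braid {i : ℕ} (h : i + 3 ≤ N) (x : Mor M N) :
    cross i (cross (i + 1) (cross i x)) = cross (i + 1) (cross i (cross (i + 1) x)) := by
  have := congrArg (act i · M N N x) braid_el
  rwa [act_comp i _ _ h (N' := N) (by omega) (by omega), act_comp i _ _ h (N' := N) (by omega) (by omega), act_comp i _ _ h (N' := N) (by omega) (by omega),
    act_comp i _ _ h (N' := N) (by omega) (by omega), act_el i 0 1 _ _ _ h (by omega), act_el i 0 1 _ _ _ h (by omega),
    act_el i 1 0 _ _ _ h (by omega), act_el i 0 1 _ _ _ h (by omega), act_el i 1 0 _ _ _ h (by omega),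
    act_el i 1 0 _ _ _ h (by omega)] at this

theorem cap_cup_succ {i : ℕ} (h : i + 1 ≤ N) (x : Mor M N) : cap i (cup (i + 1) x) = -x := by
  have := congrArg (act i · M N N x) snake_neg_el
  rw [act_comp i _ _ h (N' := N + 2) (by omega) (by omega), act_el i 0 1 _ _ _ (by omega) (by omega),
    act_el i 1 0 _ _ _ h (by omega), act_smul i _ _ h (by omega), act_one i h, neg_one_smul] at this
  exact this

theorem cap_succ_cup {i : ℕ} (h : i + 1 ≤ N) (x : Mor M N) : cap (i + 1) (cup i x) = x := by
  have := congrArg (act i · M N N x) snake_el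
  rw [act_comp i _ _ h (N' := N + 2) (by omega) (by omega), act_el i 1 0 _ _ _ (by omega) (by omega),
    act_el i 0 1 _ _ _ h (by omega), act_one i h] at this
  exact this

theorem cross_succ_cup {i : ℕ} (h : i + 1 ≤ N) (x : Mor M N) :
    cross (i + 1) (cup i x) = cross i (cup (i + 1) x) := by
  have := congrArg (act i · M N (N + 2) x) untwist_el
  rw [act_comp i _ _ h (N' := N + 2) (by omega) (by omega), act_comp i _ _ h (N' := N + 2) (by omega) (by omega),
    act_el i 1 0 (mk .s) _ _ (by omega) (by omega), act_el i 1 0 (mk .bs) _ _ h (by omega),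
    act_el i 0 1 (mk .bs) _ _ h (by omega), act_el i 0 1 (mk .s) _ _ (by omega) (by omega)] at this
  exact this

theorem cross_cup {i : ℕ} (h : i ≤ N) (x : Mor M N) : cross i (cup i x) = -cup i x := by
  have : comp (mk .s) (mk .bs) = (-1 : ℂ) • mk .bs := mk_eq .s_bs
  rw [cross, cup, ← act_comp i _ _ h (N' := N + 2) (by omega) (by omega), this, act_smul i _ _ h (by omega),
    neg_one_smul]

theorem cross_dotAt_cross_self {i : ℕ} (h : i + 2 ≤ N) (x : Mor M (N)) :
    dotAt (i + 1) x = cross i (dotAt i (cross i x)) + cross i x +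
      act i (mk .bs) M (N - 2) N (act i (mk .b) M N (N - 2) x) := by
  have := congrArg (act i · M N N x) dot_s_el
  rwa [act_add i _ _ h (by omega), act_add i _ _ h (by omega), act_comp i (mk .bs) _ h (N' := N - 2)
    (by omega) (by omega), act_comp i _ _ h (N' := N) (by omega) (by omega),
    act_comp i _ _ h (N' := N) (by omega) (by omega), act_el i 1 0 _ _ _ h (by omega),
    act_el i 0 1 _ _ _ h (by omega)] at this

theorem dotAt_succ {i : ℕ} (h : i ≤ N) (x : Mor M (N + 2)) :
    dotAt (i + 1) x = cross i (dotAt i (cross i x)) + cross i x + cup i (cap i x) :=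
  cross_dotAt_cross_self (by omega) x

theorem cap_dotAt_succ {i : ℕ} (h : i ≤ N) (x : Mor M (N + 2)) :
    cap i (dotAt (i + 1) x) = cap i (dotAt i x) + cap i x := by
  have := congrArg (act i · M (N + 2) N x) dot_b_el
  rwa [act_add i _ _ (by omega) (by omega), act_comp i _ _ (by omega) (N' := N + 2) (by omega) (by omega),
    act_comp i _ _ (by omega) (N' := N + 2) (by omega) (by omega), act_el i 1 0 _ _ _ (by omega) (by omega),
    act_el i 0 1 _ _ _ (by omega) (by omega)] at this

theorem cross_comm {i j : ℕ} (h : i + 2 ≤ j) (h' : j + 2 ≤ N) (x : Mor M N) :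
    cross j (cross i x) = cross i (cross j x) := by
  refine (act_far (p := i) (P := j) .s .s h rfl h' rfl rfl rfl x).trans ?_
  rw [sgn_zero_left, one_smul]; rfl

theorem dotAt_comm_of_lt {i j : ℕ} (h : i < j) (h' : j + 1 ≤ N) (x : Mor M N) :
    dotAt j (dotAt i x) = dotAt i (dotAt j x) := by
  refine (act_far (p := i) (P := j) .y .y h rfl h' rfl rfl rfl x).trans ?_
  rw [sgn_zero_left, one_smul]; rfl

theorem dotAt_comm {i j : ℕ} (hi : i < N) (hj : j < N) (x : Mor M N) :
    dotAt j (dotAt i x) = dotAt i (dotAt j x) := by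
  rcases lt_trichotomy i j with h | rfl | h
  · exact dotAt_comm_of_lt h hj x
  · rfl
  · exact (dotAt_comm_of_lt h hi x).symm

theorem dotAt_cross {i j : ℕ} (h : i + 2 ≤ j) (h' : j + 1 ≤ N) (x : Mor M N) :
    dotAt j (cross i x) = cross i (dotAt j x) := by
  refine (act_far (p := i) (P := j) .s .y h rfl h' rfl rfl rfl x).trans ?_
  rw [sgn_zero_left, one_smul]; rfl

theorem cross_dotAt {i j : ℕ} (h : i < j) (h' : j + 2 ≤ N) (x : Mor M N) :
    cross j (dotAt i x) = dotAt i (cross j x) := by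
  refine (act_far (p := i) (P := j) .y .s h rfl h' rfl rfl rfl x).trans ?_
  rw [sgn_zero_left, one_smul]; rfl

theorem cap_cross_far {i j : ℕ} (h : i + 2 ≤ j) (h' : j ≤ N) (x : Mor M (N + 2)) :
    cap j (cross i x) = cross i (cap j x) := by
  refine (act_far (p := i) (P := j) .s .b h rfl (by omega) rfl rfl rfl x).trans ?_
  rw [sgn_zero_right, one_smul]; rfl

theorem cross_cap_far {i j : ℕ} (h : i ≤ j) (h' : j + 2 ≤ N) (x : Mor M (N + 2)) :
    cross j (cap i x) = cap i (cross (j + 2) x) := by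
  refine (act_far (p := i) (P := j + 2) (P' := j) (N₃ := N + 2) .b .s (by omega) rfl (by omega) rfl
    rfl rfl x).trans ?_
  rw [sgn_zero_left, one_smul]; rfl

theorem cup_cross_far {i j : ℕ} (h : i + 2 ≤ j) (h' : j ≤ N) (x : Mor M N) :
    cup j (cross i x) = cross i (cup j x) := by
  refine (act_far (p := i) (P := j) .s .bs h rfl (by omega) rfl rfl rfl x).trans ?_
  rw [sgn_zero_right, one_smul]; rfl

theorem cross_cup_far {i j : ℕ} (h : i ≤ j) (h' : j + 2 ≤ N) (x : Mor M N) :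
    cross (j + 2) (cup i x) = cup i (cross j x) := by
  refine (act_far (p := i) (P := j) (P' := j + 2) .bs .s (by omega) rfl (by omega) rfl
    rfl rfl x).trans ?_
  rw [sgn_zero_left, one_smul]; rfl

theorem cap_dotAt_far {i j : ℕ} (h : i < j) (h' : j ≤ N) (x : Mor M (N + 2)) :
    cap j (dotAt i x) = dotAt i (cap j x) := by
  refine (act_far (p := i) (P := j) .y .b h rfl (by omega) rfl rfl rfl x).trans ?_
  rw [sgn_zero_right, one_smul]; rfl

theorem dotAt_cap_far {i j : ℕ} (h : i ≤ j) (h' : j + 1 ≤ N) (x : Mor M (N + 2)) :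
    dotAt j (cap i x) = cap i (dotAt (j + 2) x) := by
  refine (act_far (p := i) (P := j + 2) (P' := j) (N₃ := N + 2) .b .y (by omega) rfl (by omega) rfl
    rfl rfl x).trans ?_
  rw [sgn_zero_left, one_smul]; rfl

theorem cup_dotAt_far {i j : ℕ} (h : i < j) (h' : j ≤ N) (x : Mor M N) :
    cup j (dotAt i x) = dotAt i (cup j x) := by
  refine (act_far (p := i) (P := j) .y .bs h rfl (by omega) rfl rfl rfl x).trans ?_
  rw [sgn_zero_right, one_smul]; rfl

theorem dotAt_cup_far {i j : ℕ} (h : i ≤ j) (h' : j + 1 ≤ N) (x : Mor M N) :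
    dotAt (j + 2) (cup i x) = cup i (dotAt j x) := by
  refine (act_far (p := i) (P := j) (P' := j + 2) .bs .y (by omega) rfl (by omega) rfl
    rfl rfl x).trans ?_
  rw [sgn_zero_left, one_smul]; rfl

theorem cup_cup {i j : ℕ} (h : i ≤ j) (h' : j ≤ N) (x : Mor M N) :
    cup (j + 2) (cup i x) = -cup i (cup j x) := by
  refine (act_far (p := i) (P := j) (P' := j + 2) (N₃ := N + 2) .bs .bs (by omega) rfl (by omega)
    rfl rfl rfl x).trans ?_
  rw [sgn_one_one, neg_one_smul]; rfl

theorem cap_cap {i j : ℕ} (h : i ≤ j) (h' : j ≤ N) (x : Mor M (N + 2 + 2)) :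
    cap i (cap (j + 2) x) = -cap j (cap i x) := by
  have := act_far (p := i) (P := j + 2) (P' := j) (N₃ := N + 2) (N₄ := N) .b .b (by omega) rfl
    (by omega) rfl rfl rfl x
  rw [sgn_one_one, neg_one_smul] at this
  exact (neg_eq_iff_eq_neg.2 this).symm

theorem cap_cup_far {i j : ℕ} (h : i ≤ j) (h' : j ≤ N) (x : Mor M (N + 2)) :
    cap (j + 2) (cup i x) = -cup i (cap j x) := by
  refine (act_far (p := i) (P := j) (P' := j + 2) .bs .b (by omega) rfl (by omega) rfl
    rfl rfl x).trans ?_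
  rw [sgn_one_one, neg_one_smul]; rfl

end relations
end Mor
end AffineVW

namespace AffineVW
namespace Mor

/-! ### Derived relations -/

section derived
variable {M N : ℕ}

/-- The untwisting relation turned upside down: close `cross_succ_cup` with a cap on either side and
straighten by the snake relations. -/
theorem cap_cross_succ {i : ℕ} (h : i + 1 ≤ N) (x : Mor M (N + 2)) :
    cap i (cross (i + 1) x) = cap (i + 1) (cross i x) := by
  have key := congrArg (fun z => cap i (cap (i + 3) z))
    (cross_succ_cup (i := i + 1) (N := N + 2) (by omega) x)
  rw [cap_cap (j := i + 1) (by omega) (by omega), ← cross_cap_far le_rfl (by omega),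
    cap_cup_succ (by omega), cap_cross_far (j := i + 3) (by omega) (by omega),
    cap_succ_cup (by omega), map_neg, map_neg, neg_neg] at key
  exact key.symm

/-- There is no sign, in contrast to `cross_cup`: rotating the cap into a cup interchanges two odd
caps, and this sign cancels that of `cross_cup`. -/
theorem cap_cross {i : ℕ} (h : i ≤ N) (x : Mor M (N + 2)) : cap i (cross i x) = cap i x := by
  conv_lhs => rw [← cap_succ_cup (i := i + 1) (by omega) x, ← cap_cross_far (by omega) (by omega),
    cap_cap le_rfl h, ← cross_succ_cup (by omega), cap_cross_succ (by omega),
    cross_cup (by omega), map_neg, cap_succ_cup (by omega), map_neg, neg_neg]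

theorem eq_zero_of_eq_neg {m n : ℕ} {x : Mor m n} (h : x = -x) : x = 0 := by
  have h2 : (2 : ℂ) • x = 0 := by
    rw [two_smul]; nth_rewrite 2 [h]; exact add_neg_cancel x
  exact (smul_eq_zero.1 h2).resolve_left two_ne_zero

theorem cap_cup {i : ℕ} (h : i ≤ N) (x : Mor M N) : cap i (cup i x) = 0 := by
  apply eq_zero_of_eq_neg
  conv_lhs => rw [← cap_cross h, cross_cup h, map_neg]

/-- This is `cap_dotAt_succ` turned upside down. Apply the snake relation to the difference of the
two sides; the dots then meet a cap. -/
theorem dotAt_succ_cup {i : ℕ} (h : i ≤ N) (x : Mor M N) :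
    dotAt (i + 1) (cup i x) = dotAt i (cup i x) - cup i x := by
  suffices h' : dotAt i (cup i x) - dotAt (i + 1) (cup i x) = cup i x by
    rw [eq_sub_iff_add_eq, ← eq_sub_iff_add_eq', h']
  rw [← cap_succ_cup (i := i) (by omega) (dotAt i (cup i x) - dotAt (i + 1) (cup i x)), map_sub,
    ← dotAt_cup_far le_rfl (by omega), ← dotAt_cup_far (by omega) (by omega),
    ← neg_eq_iff_eq_neg.2 (cup_cup le_rfl h x)]
  set t := cup i x
  rw [map_neg, map_neg, map_sub, map_neg, map_neg, cap_dotAt_succ (by omega),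
    ← cup_dotAt_far (by omega) (by omega), cap_cup_succ (by omega), cap_cup_succ (by omega),
    ← dotAt_cap_far (by omega) (by omega), cap_cup_succ (by omega), map_neg]
  abel

theorem dotAt_succ_cross {i : ℕ} (h : i ≤ N) (x : Mor M (N + 2)) :
    dotAt (i + 1) (cross i x) = cross i (dotAt i x) + x + cup i (cap i x) := by
  rw [dotAt_succ h, cross_cross (by omega), cap_cross h]

theorem cross_dotAt_succ {i : ℕ} (h : i ≤ N) (x : Mor M (N + 2)) :
    cross i (dotAt (i + 1) x) = dotAt i (cross i x) + x - cup i (cap i x) := by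
  rw [dotAt_succ h, map_add, map_add, cross_cross (by omega), cross_cross (by omega),
    cross_cup h]
  abel

theorem cross_dotAt_self {i : ℕ} (h : i ≤ N) (x : Mor M (N + 2)) :
    cross i (dotAt i x) = dotAt (i + 1) (cross i x) - x - cup i (cap i x) := by
  rw [dotAt_succ_cross h]; abel

theorem dotAt_self_cross {i : ℕ} (h : i ≤ N) (x : Mor M (N + 2)) :
    dotAt i (cross i x) = cross i (dotAt (i + 1) x) - x + cup i (cap i x) := by
  rw [cross_dotAt_succ h]; abel

/-- The sum of two neighbouring dots. -/
def dotSum (i : ℕ) : Mor M N →ₗ[ℂ] Mor M N := dotAt i + dotAt (i + 1)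

theorem cross_dotSum {i : ℕ} (h : i ≤ N) (x : Mor M (N + 2)) :
    cross i (dotSum i x) = dotSum i (cross i x) - (2 : ℂ) • cup i (cap i x) := by
  rw [dotSum, LinearMap.add_apply, LinearMap.add_apply, map_add, cross_dotAt_self h,
    cross_dotAt_succ h, two_smul]
  abel

/-- The crossing commutes with the sum of the two dots up to a cup-cap term, which produces a loop
with fewer dots and vanishes by induction. The crossing is thus absorbed by the cap without sign and
by the cup with sign -1. -/
theorem cap_dotSum_pow_cup {i : ℕ} (h : i ≤ N) (k : ℕ) (x : Mor M N) :
    cap i ((dotSum i ^ k) (cup i x)) = 0 := by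
  induction k using Nat.strong_induction_on generalizing x with
  | _ k ih =>
    have key : ∀ j ≤ k, cross i ((dotSum i ^ j) (cup i x)) = -(dotSum i ^ j) (cup i x) := by
      intro j hj
      induction j with
      | zero => exact cross_cup h x
      | succ j ihj =>
        rw [pow_succ', Module.End.mul_apply, cross_dotSum h, ihj (by omega), ih j (by omega),
          map_zero, smul_zero, sub_zero, map_neg]
    apply eq_zero_of_eq_neg
    conv_lhs => rw [← cap_cross h, key k le_rfl, map_neg]

/-- On a cup the right dot is the left dot minus 1, so the left dot is half of the sum of both dots
plus 1, and dotted loops reduce to `cap_dotSum_pow_cup`. -/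
theorem cap_dotAt_pow_cup {i : ℕ} (h : i ≤ N) (t : ℕ) (x : Mor M N) :
    cap i ((dotAt i ^ t) (cup i x)) = 0 := by
  -- Powers of the sum are kept in the claim because every dot on the left strand is traded for one
  -- factor of the sum.
  suffices H : ∀ k, cap i ((dotSum i ^ k) ((dotAt i ^ t) (cup i x))) = 0 from H 0
  have hcomm : ∀ z : Mor M (N + 2), dotSum i (dotAt i z) = dotAt i (dotSum i z) := fun z => by
    rw [dotSum, LinearMap.add_apply, LinearMap.add_apply, map_add,
      dotAt_comm (i := i) (j := i + 1) (by omega) (by omega)]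
  induction t with
  | zero => exact fun k => cap_dotSum_pow_cup h k x
  | succ t ih =>
    intro k
    have h1 : (dotAt i) (cup i x) = (2⁻¹ : ℂ) • (dotSum i (cup i x) + cup i x) := by
      rw [eq_inv_smul_iff₀ two_ne_zero, dotSum, LinearMap.add_apply, dotAt_succ_cup h, two_smul]
      abel
    have h2 : ∀ (t : ℕ) (z : Mor M (N + 2)),
        (dotAt i ^ t) (dotSum i z) = dotSum i ((dotAt i ^ t) z) := by
      intro t z
      induction t with
      | zero => rfl
      | succ t ih => rw [pow_succ', Module.End.mul_apply, Module.End.mul_apply, ih, hcomm]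
    rw [pow_succ, Module.End.mul_apply, h1, map_smul, map_smul, map_smul, map_add, map_add,
      map_add, ih k, h2, ← Module.End.mul_apply, ← pow_succ, ih (k + 1), add_zero, smul_zero]

end derived

/-! ### Arcs starting at the leftmost strand -/

/-- The arc joining the strands `0` and `j + 1`. -/
def arc {M N : ℕ} : ℕ → Mor M N →ₗ[ℂ] Mor M (N + 2)
  | 0 => cup 0
  | j + 1 => cross (j + 1) ∘ₗ arc j

section arcs
variable {M N : ℕ}

theorem arc_zero (x : Mor M N) : arc 0 x = cup 0 x := rfl

theorem arc_succ (j : ℕ) (x : Mor M N) : arc (j + 1) x = cross (j + 1) (arc j x) := rfl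

theorem cross_self_arc {j : ℕ} (h : j + 1 ≤ N) (x : Mor M N) :
    cross (j + 1) (arc (j + 1) x) = arc j x := by
  rw [arc_succ, cross_cross (by omega)]

theorem cross_arc_right {i j : ℕ} (h : j ≤ i) (h' : i + 2 ≤ N) (x : Mor M N) :
    cross (i + 2) (arc j x) = arc j (cross i x) := by
  induction j with
  | zero => exact cross_cup_far h h' x
  | succ j ih =>
    rw [arc_succ, cross_comm (i := j + 1) (by omega) (by omega), ih (by omega), arc_succ]

theorem cross_arc_mid {i j : ℕ} (h : i + 2 ≤ j) (h' : j ≤ N) (x : Mor M N) :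
    cross (i + 1) (arc j x) = arc j (cross i x) := by
  obtain ⟨k, rfl⟩ := Nat.exists_eq_add_of_le h
  clear h
  induction k with
  | zero =>
    rw [add_zero, arc_succ, arc_succ, cross_braid (by omega), cross_arc_right le_rfl (by omega)]
    rfl
  | succ k ih =>
    rw [← add_assoc, arc_succ, ← cross_comm (i := i + 1) (by omega) (by omega), ih (by omega),
      arc_succ]

/-- Crossing the left ends of two arcs exchanges the order in which they are attached, and the sign
is that of interchanging two odd cups. The case `a = b = 0` is computed; crossings move the right
ends. -/
theorem cross_zero_arc_arc {a b : ℕ} (h : a ≤ b) (h' : b ≤ N) (x : Mor M N) :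
    cross 0 (arc (a + 1) (arc b x)) = -arc (b + 2) (arc a x) := by
  obtain ⟨k, rfl⟩ := Nat.exists_eq_add_of_le h
  clear h
  induction k with
  | zero =>
    induction a with
    | zero =>
      have h1 : cross 0 (arc 1 (arc 0 x)) = cup 1 (cup 0 x) := by
        rw [arc_succ, arc_zero, arc_zero, zero_add, cross_succ_cup (by omega),
          cross_cross (by omega)]
      have h2 : arc 2 (arc 0 x) = -cup 1 (cup 0 x) := by
        rw [arc_succ, arc_succ, arc_zero, arc_zero,
          ← neg_eq_iff_eq_neg.2 (cup_cup le_rfl (Nat.zero_le _) x), map_neg, map_neg, zero_add,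
          zero_add, ← cross_succ_cup (by omega), cross_cross (by omega)]
      rw [add_zero, zero_add, zero_add, h1, h2, neg_neg]
    | succ a ih =>
      have ih := ih (by omega)
      simp only [add_zero] at ih ⊢
      rw [arc_succ (a + 1), arc_succ a x, ← cross_arc_right (i := a + 1) (by omega) (by omega),
        ← cross_comm (i := 0) (by omega) (by omega), ← cross_comm (i := 0) (by omega) (by omega),
        ih, map_neg, map_neg, ← arc_succ (a + 2), cross_arc_mid (by omega) (by omega)]
  | succ k ih =>
    rw [← add_assoc, arc_succ (a + k), ← cross_arc_right (by omega) (by omega),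
      ← cross_comm (i := 0) (by omega) (by omega), ih (by omega), map_neg]
    rfl

theorem cross_zero_arc_arc' {a b : ℕ} (h : a ≤ b) (h' : b ≤ N) (x : Mor M N) :
    cross 0 (arc (b + 2) (arc a x)) = -arc (a + 1) (arc b x) := by
  rw [← neg_eq_iff_eq_neg.2 (cross_zero_arc_arc h h' x), map_neg, cross_cross (by omega)]

theorem cup_arc_right {p j : ℕ} (h : j ≤ p) (h' : p ≤ N) (x : Mor M N) :
    cup (p + 2) (arc j x) = -arc j (cup p x) := by
  induction j with
  | zero => exact cup_cup h h' x
  | succ j ih =>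
    rw [arc_succ, cup_cross_far (by omega) (by omega), ih (by omega), map_neg]
    rfl

theorem cup_arc_left {p j : ℕ} (h : p ≤ j) (h' : j ≤ N) (x : Mor M N) :
    cup (p + 1) (arc j x) = -arc (j + 2) (cup p x) := by
  obtain ⟨k, rfl⟩ := Nat.exists_eq_add_of_le h
  clear h
  induction k with
  | zero =>
    rw [add_zero, arc_succ, arc_succ, ← neg_eq_iff_eq_neg.2 (cup_arc_right le_rfl (by omega) x),
      map_neg, map_neg, neg_neg, ← cross_succ_cup (by omega), cross_cross (by omega)]
  | succ k ih =>
    rw [← add_assoc, arc_succ (p + k), ← cross_cup_far (by omega) (by omega), ih (by omega),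
      map_neg]
    rfl

theorem cap_arc_right {p j : ℕ} (h : j ≤ p) (h' : p ≤ N) (x : Mor M (N + 2)) :
    cap (p + 2) (arc j x) = -arc j (cap p x) := by
  induction j with
  | zero => exact cap_cup_far h h' x
  | succ j ih =>
    rw [arc_succ, cap_cross_far (by omega) (by omega), ih (by omega), map_neg]
    rfl

theorem cap_arc_left {p j : ℕ} (h : p ≤ j) (h' : j ≤ N) (x : Mor M (N + 2)) :
    cap (p + 1) (arc (j + 2) x) = -arc j (cap p x) := by
  obtain ⟨k, rfl⟩ := Nat.exists_eq_add_of_le h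
  clear h
  induction k with
  | zero =>
    rw [add_zero, arc_succ, arc_succ, cap_cross_succ (by omega), cross_cross (by omega),
      cap_arc_right le_rfl (by omega)]
  | succ k ih =>
    rw [← add_assoc, show p + k + 1 + 2 = (p + k + 2) + 1 by ring, arc_succ,
      show p + k + 2 + 1 = (p + k + 1) + 2 by ring, ← cross_cap_far (by omega) (by omega),
      ih (by omega), map_neg]
    rfl

theorem cap_self_arc {j : ℕ} (h : j + 1 ≤ N) (x : Mor M N) :
    cap (j + 1) (arc (j + 1) x) = cap (j + 1) (arc j x) := by
  rw [arc_succ, cap_cross h]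

theorem cap_succ_arc {j : ℕ} (h : j + 2 ≤ N) (x : Mor M N) :
    cap (j + 2) (arc (j + 1) x) = cap (j + 1) (arc j (cross j x)) := by
  rw [arc_succ, ← cap_cross_succ (by omega), cross_arc_right le_rfl h]

theorem cap_zero_arc_one (h : 1 ≤ N) (x : Mor M N) : cap 0 (arc 1 x) = -x := by
  rw [arc_succ, arc_zero, cross_succ_cup (by omega), cap_cross (by omega),
    cap_cup_succ (by omega)]

theorem cap_zero_arc_succ {j : ℕ} (h : j + 2 ≤ N) (x : Mor M N) :
    cap 0 (arc (j + 2) x) = cross j (cap 0 (arc (j + 1) x)) := by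
  rw [arc_succ, cross_cap_far (by omega) (by omega)]

theorem dotAt_arc_right {i j : ℕ} (h : j ≤ i) (h' : i + 1 ≤ N) (x : Mor M N) :
    dotAt (i + 2) (arc j x) = arc j (dotAt i x) := by
  induction j with
  | zero => exact dotAt_cup_far h h' x
  | succ j ih =>
    rw [arc_succ, dotAt_cross (by omega) (by omega), ih (by omega), arc_succ]

end arcs
end Mor
end AffineVW

namespace AffineVW
namespace Mor

/-! ### Spanning sets of the morphism spaces `0 ⟶ N` -/

/-- The span of the dotted arc diagrams `0 ⟶ N` with dots at the left ends of the arcs only, at most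
`d` in number. -/
def reg : (N d : ℕ) → Submodule ℂ (Mor 0 N)
  | 0, _ => Submodule.span ℂ {one 0}
  | 1, _ => ⊥
  | N + 2, d => Submodule.span ℂ {z | ∃ t e j, t + e ≤ d ∧ j ≤ N ∧ ∃ r ∈ reg N e,
      z = (dotAt 0 ^ t) (arc j r)}

theorem mem_reg {N d t e j : ℕ} (h : t + e ≤ d) (hj : j ≤ N) {r : Mor 0 N} (hr : r ∈ reg N e) :
    (dotAt 0 ^ t) (arc j r) ∈ reg (N + 2) d := by
  rw [reg]
  exact Submodule.subset_span ⟨t, e, j, h, hj, r, hr, rfl⟩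

theorem arc_mem_reg {N e j : ℕ} (hj : j ≤ N) {r : Mor 0 N} (hr : r ∈ reg N e) :
    arc j r ∈ reg (N + 2) e := mem_reg (t := 0) (by omega) hj hr

theorem reg_induction {N d : ℕ} {S : Submodule ℂ (Mor 0 (N + 2))}
    (h : ∀ t e j, t + e ≤ d → j ≤ N → ∀ r ∈ reg N e, (dotAt 0 ^ t) (arc j r) ∈ S) :
    reg (N + 2) d ≤ S := by
  rw [reg, Submodule.span_le]
  rintro z ⟨t, e, j, h1, h2, r, hr, rfl⟩
  exact h t e j h1 h2 r hr

theorem reg_mono {N d e : ℕ} (h : d ≤ e) : reg N d ≤ reg N e := by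
  match N with
  | 0 => exact le_rfl
  | 1 => exact le_rfl
  | N + 2 => exact reg_induction fun t e' j h1 h2 r hr => mem_reg (h1.trans h) h2 hr

theorem dotAt_eq_zero {M : ℕ} (i : ℕ) (x : Mor M 0) : dotAt i x = 0 := by
  rw [dotAt, act, dif_neg (by omega), LinearMap.zero_apply]

theorem dotAt_zero_mem_reg {N d : ℕ} {x : Mor 0 N} (hx : x ∈ reg N d) :
    dotAt 0 x ∈ reg N (d + 1) := by
  match N with
  | 0 => rw [dotAt_eq_zero]; exact zero_mem _
  | 1 =>
    rw [reg, Submodule.mem_bot] at hx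
    rw [hx, map_zero]
    exact zero_mem _
  | N + 2 =>
    suffices reg (N + 2) d ≤ (reg (N + 2) (d + 1)).comap (dotAt 0) from this hx
    refine reg_induction fun t e' j h1 h2 r hr => ?_
    rw [Submodule.mem_comap, ← Module.End.mul_apply, ← pow_succ']
    exact mem_reg (by omega) h2 hr

theorem dotAt_zero_pow_mem_reg {N d : ℕ} (t : ℕ) {x : Mor 0 N} (hx : x ∈ reg N d) :
    (dotAt 0 ^ t) x ∈ reg N (t + d) := by
  induction t with
  | zero => rwa [zero_add, pow_zero]
  | succ t ih =>
    rw [pow_succ', Module.End.mul_apply, add_right_comm]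
    exact dotAt_zero_mem_reg ih

theorem cross_dotAt_zero_pow {M N i : ℕ} (t : ℕ) (h : i + 3 ≤ N) (x : Mor M N) :
    cross (i + 1) ((dotAt 0 ^ t) x) = (dotAt 0 ^ t) (cross (i + 1) x) := by
  induction t with
  | zero => rfl
  | succ t ih =>
    rw [pow_succ', Module.End.mul_apply, cross_dotAt (by omega) h, ih, Module.End.mul_apply]

theorem cup_dotAt_zero_pow {M N i : ℕ} (t : ℕ) (h : i + 1 ≤ N) (x : Mor M N) :
    cup (i + 1) ((dotAt 0 ^ t) x) = (dotAt 0 ^ t) (cup (i + 1) x) := by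
  induction t with
  | zero => rfl
  | succ t ih =>
    rw [pow_succ', Module.End.mul_apply, cup_dotAt_far (by omega) h, ih, pow_succ',
      Module.End.mul_apply]

theorem cap_dotAt_zero_pow {M N i : ℕ} (t : ℕ) (h : i + 1 ≤ N) (x : Mor M (N + 2)) :
    cap (i + 1) ((dotAt 0 ^ t) x) = (dotAt 0 ^ t) (cap (i + 1) x) := by
  induction t with
  | zero => rfl
  | succ t ih =>
    rw [pow_succ', Module.End.mul_apply, cap_dotAt_far (by omega) h, ih, pow_succ',
      Module.End.mul_apply]

theorem dotAt_dotAt_zero_pow {M N i : ℕ} (t : ℕ) (h : i < N) (x : Mor M N) :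
    dotAt i ((dotAt 0 ^ t) x) = (dotAt 0 ^ t) (dotAt i x) := by
  induction t with
  | zero => rfl
  | succ t ih =>
    rw [pow_succ', Module.End.mul_apply, dotAt_comm (i := 0) (by omega) h, ih, Module.End.mul_apply]

/-- Closure of the filtration under the undotted generators. -/
structure RegClosed (N d : ℕ) : Prop where
  cross : ∀ i, i + 2 ≤ N → ∀ x ∈ reg N d, cross i x ∈ reg N d
  cup : ∀ i, i ≤ N → ∀ x ∈ reg N d, cup i x ∈ reg (N + 2) d
  cap : ∀ i N', N = N' + 2 → i ≤ N' → ∀ x : Mor 0 (N' + 2), x ∈ reg (N' + 2) d →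
    cap i x ∈ reg N' d

section errors
variable {e : ℕ} (A : ∀ N, RegClosed N e)
include A

/-- A dot crosses the arc at the cost of terms without that dot. These stay in filtration degree
`e`, one less than the degree of the dotted term itself. -/
theorem dotAt_arc_mid {N i j : ℕ} (h : i + 1 ≤ j) (h' : j ≤ N) {r : Mor 0 N} (hr : r ∈ reg N e) :
    dotAt (i + 1) (arc j r) - arc j (dotAt i r) ∈ reg (N + 2) e := by
  obtain ⟨k, rfl⟩ := Nat.exists_eq_add_of_le h
  clear h
  induction k with
  | zero =>
    rw [add_zero, arc_succ, dotAt_self_cross (by omega), dotAt_arc_right le_rfl (by omega),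
      ← arc_succ]
    have hU := arc_mem_reg (j := i) (by omega) hr
    have := sub_mem ((A _).cup _ (by omega) _ ((A _).cap (i + 1) N rfl (by omega) _ hU)) hU
    convert this using 1
    abel
  | succ k ih =>
    rw [← add_assoc, arc_succ, ← cross_dotAt (by omega) (by omega), arc_succ, ← map_sub]
    exact (A _).cross _ (by omega) _ (ih (by omega))

theorem dotAt_arc_end {N j : ℕ} (h' : j ≤ N) {r : Mor 0 N} (hr : r ∈ reg N e) :
    dotAt (j + 1) (arc j r) - dotAt 0 (arc j r) ∈ reg (N + 2) e := by
  induction j with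
  | zero =>
    have := arc_mem_reg h' hr
    rw [arc_zero] at this ⊢
    rw [dotAt_succ_cup h', sub_sub_cancel_left]
    exact neg_mem this
  | succ j ih =>
    have hU := arc_mem_reg (j := j) (by omega) hr
    have h1 := (A _).cross (j + 1) (by omega) _ (ih (by omega))
    have h2 := add_mem h1 (add_mem hU ((A _).cup _ (by omega) _
      ((A _).cap (j + 1) N rfl (by omega) _ hU)))
    convert h2 using 1
    rw [arc_succ, dotAt_succ_cross (by omega), map_sub, cross_dotAt (i := 0) (by omega) (by omega)]
    abel

end errors

/-- Move the dot through the outermost arc: to the left end of the arc if it sits on the arc, and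
into the remaining diagram otherwise. The closure hypotheses absorb the error terms, so that this
statement can be used inside the induction of `regClosed`. -/
theorem dotAt_mem_reg {e : ℕ} (A : ∀ N, RegClosed N e) (B : ∀ e' < e, ∀ N, RegClosed N e') {N : ℕ} :
    ∀ i < N, ∀ x ∈ reg N e, dotAt i x ∈ reg N (e + 1) := by
  induction e using Nat.strong_induction_on generalizing N with
  | _ e ihe =>
  induction N using Nat.twoStepInduction with
  | zero => exact fun i hi => absurd hi (by omega)
  | one =>
    intro i hi x hx
    rw [reg, Submodule.mem_bot] at hx
    rw [hx, map_zero]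
    exact zero_mem _
  | more N ih _ =>
    intro i hi x hx
    have ih' : ∀ e' ≤ e, ∀ i < N, ∀ x ∈ reg N e', dotAt i x ∈ reg N (e' + 1) := by
      intro e' he'
      rcases he'.lt_or_eq with h | rfl
      · exact ihe e' h (B e' h) (fun e'' h'' => B e'' (by omega))
      · exact ih
    have A' : ∀ e' ≤ e, ∀ N, RegClosed N e' := by
      intro e' he'
      rcases he'.lt_or_eq with h | rfl
      · exact B e' h
      · exact A
    suffices reg (N + 2) e ≤ (reg (N + 2) (e + 1)).comap (dotAt i) from this hx
    refine reg_induction fun t e' j h1 h2 r hr => ?_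
    rw [Submodule.mem_comap, dotAt_dotAt_zero_pow _ hi]
    have raise : ∀ z ∈ reg (N + 2) (e' + 1), (dotAt 0 ^ t) z ∈ reg (N + 2) (e + 1) :=
      fun z hz => reg_mono (by omega) (dotAt_zero_pow_mem_reg t hz)
    apply raise
    have A'' := A' e' (by omega)
    rcases Nat.lt_or_ge (j + 1) i with hij | hij
    · obtain ⟨i, rfl⟩ : ∃ k, i = k + 2 := ⟨i - 2, by omega⟩
      rw [dotAt_arc_right (by omega) (by omega)]
      exact arc_mem_reg h2 (ih' e' (by omega) i (by omega) _ hr)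
    · rcases hij.eq_or_lt with rfl | hij
      · have := add_mem (reg_mono (Nat.le_succ _) (dotAt_arc_end A'' h2 hr))
          (dotAt_zero_mem_reg (arc_mem_reg h2 hr))
        rwa [sub_add_cancel] at this
      · rcases i with _ | i
        · exact dotAt_zero_mem_reg (arc_mem_reg h2 hr)
        · have := add_mem (reg_mono (Nat.le_succ _) (dotAt_arc_mid A'' (i := i) (j := j) (by omega) h2 hr))
            (arc_mem_reg h2 (ih' e' (by omega) i (by omega) _ hr))
          rwa [sub_add_cancel] at this

section closure
variable {d N : ℕ} (A : ∀ e < d, ∀ N, RegClosed N e) (H : ∀ e ≤ d, RegClosed N e)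
include A H

/-- If the second arc has no dots, `cross_zero_arc_arc` exchanges the two left ends. A dot on the
second arc is pulled through the crossing to the strand 0, and everything else has fewer dots. -/
theorem cross_zero_arc_mem_reg {e j : ℕ} (he : e ≤ d) (hj : j ≤ N) {r : Mor 0 N}
    (hr : r ∈ reg N e) : cross 0 (arc j r) ∈ reg (N + 2) e := by
  rcases j with _ | j
  · rw [arc_zero, cross_cup (Nat.zero_le _)]
    exact neg_mem (arc_mem_reg hj hr)
  match N, r with
  | 0, r => omega
  | 1, r =>
    rw [reg, Submodule.mem_bot] at hr
    rw [hr, map_zero, map_zero]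
    exact zero_mem _
  | N + 2, r =>
    suffices reg (N + 2) e ≤ (reg (N + 2 + 2) e).comap (cross 0 ∘ₗ arc (j + 1)) from this hr
    refine reg_induction fun t e' l h1 h2 r' hr' => ?_
    rw [Submodule.mem_comap, LinearMap.comp_apply]
    rcases t with _ | t
    · rw [pow_zero, Module.End.one_apply]
      rcases Nat.lt_or_ge l j with hl | hl
      · obtain ⟨j, rfl⟩ : ∃ k, j = k + 1 := ⟨j - 1, by omega⟩
        rw [cross_zero_arc_arc' (by omega) (by omega)]
        exact neg_mem (arc_mem_reg (by omega) (reg_mono (by omega) (arc_mem_reg (by omega) hr')))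
      · rw [cross_zero_arc_arc hl h2]
        exact neg_mem (arc_mem_reg (by omega) (reg_mono (by omega) (arc_mem_reg (by omega) hr')))
    · rw [pow_succ', Module.End.mul_apply]
      have hw : (dotAt 0 ^ t) (arc l r') ∈ reg (N + 2) (e - 1) := mem_reg (by omega) h2 hr'
      set w := (dotAt 0 ^ t) (arc l r')
      have A' := A (e - 1) (by omega)
      have h3 := dotAt_arc_mid A' (i := 0) (j := j + 1) (by omega) hj hw
      have hv := arc_mem_reg hj hw
      have h4 := (A' _).cross 0 (by omega) _ hv
      have h5 := (A' _).cup 0 (by omega) _ ((A' _).cap 0 (N + 2) rfl (by omega) _ hv)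
      have h6 := sub_mem (add_mem (dotAt_zero_mem_reg h4) (reg_mono (by omega)
        (sub_mem hv h5))) (reg_mono (by omega) ((A' _).cross 0 (by omega) _ h3))
      rw [show e - 1 + 1 = e by omega] at h6
      convert h6 using 1
      rw [map_sub, cross_dotAt_succ (i := 0) (by omega)]
      abel

theorem cross_mem_reg (i : ℕ) (hi : i ≤ N) (x : Mor 0 (N + 2)) (hx : x ∈ reg (N + 2) d) :
    cross i x ∈ reg (N + 2) d := by
  suffices reg (N + 2) d ≤ (reg (N + 2) d).comap (cross i) from this hx
  refine reg_induction fun t e j h1 h2 r hr => ?_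
  rw [Submodule.mem_comap]
  rcases i with _ | i
  · rcases t with _ | t
    · exact reg_mono (by omega) (cross_zero_arc_mem_reg A H (by omega) h2 hr)
    · rw [pow_succ', Module.End.mul_apply]
      have hw : (dotAt 0 ^ t) (arc j r) ∈ reg (N + 2) (d - 1) := mem_reg (by omega) h2 hr
      set w := (dotAt 0 ^ t) (arc j r)
      have A' := A (d - 1) (by omega)
      have h3 := dotAt_mem_reg A' (fun e' he' => A e' (by omega)) 1 (by omega) _
        ((A' _).cross 0 (by omega) _ hw)
      rw [show d - 1 + 1 = d by omega] at h3
      rw [cross_dotAt_self (by omega)]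
      refine sub_mem (sub_mem h3 (reg_mono (by omega) hw)) (reg_mono (Nat.sub_le d 1) ?_)
      exact (A' _).cup 0 (by omega) _ ((A' _).cap 0 N rfl (by omega) _ hw)
  · rw [cross_dotAt_zero_pow _ (by omega)]
    refine reg_mono h1 (dotAt_zero_pow_mem_reg t ?_)
    rcases Nat.lt_or_ge i j with hij | hij
    · rcases Nat.lt_or_ge (i + 1) j with hij' | hij'
      · rw [cross_arc_mid (by omega) h2]
        exact arc_mem_reg h2 ((H e (by omega)).cross _ (by omega) _ hr)
      · obtain rfl : j = i + 1 := by omega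
        rw [cross_self_arc (by omega)]
        exact arc_mem_reg (by omega) hr
    · rcases hij.eq_or_lt with rfl | hij'
      · rw [← arc_succ]
        exact arc_mem_reg hi hr
      · obtain ⟨i, rfl⟩ : ∃ k, i = k + 1 := ⟨i - 1, by omega⟩
        rw [cross_arc_right (by omega) (by omega)]
        exact arc_mem_reg h2 ((H e (by omega)).cross _ (by omega) _ hr)

omit A in
theorem cup_mem_reg (i : ℕ) (hi : i ≤ N + 2) (x : Mor 0 (N + 2)) (hx : x ∈ reg (N + 2) d) :
    cup i x ∈ reg (N + 2 + 2) d := by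
  rcases i with _ | i
  · exact arc_mem_reg (j := 0) (by omega) hx
  suffices reg (N + 2) d ≤ (reg (N + 2 + 2) d).comap (cup (i + 1)) from this hx
  refine reg_induction fun t e j h1 h2 r hr => ?_
  rw [Submodule.mem_comap, cup_dotAt_zero_pow _ hi]
  refine reg_mono h1 (dotAt_zero_pow_mem_reg t ?_)
  rcases Nat.lt_or_ge j i with hij | hij
  · obtain ⟨i, rfl⟩ : ∃ k, i = k + 1 := ⟨i - 1, by omega⟩
    rw [cup_arc_right (by omega) (by omega)]
    exact neg_mem (arc_mem_reg (by omega) ((H e (by omega)).cup _ (by omega) _ hr))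
  · rw [cup_arc_left hij h2]
    exact neg_mem (arc_mem_reg (by omega) ((H e (by omega)).cup _ (by omega) _ hr))

omit A in
theorem cap_succ_arc_mem_reg {e j : ℕ} (he : e ≤ d) (hj : j + 1 ≤ N) {r : Mor 0 N}
    (hr : r ∈ reg N e) : cap (j + 1) (arc j r) ∈ reg N e := by
  induction j generalizing r with
  | zero => rw [arc_zero, cap_succ_cup hj]; exact hr
  | succ j ih =>
    rw [cap_succ_arc (by omega)]
    exact ih (by omega) ((H e he).cross _ (by omega) _ hr)

omit A in
theorem cap_zero_arc_mem_reg {e j : ℕ} (he : e ≤ d) (hj : j ≤ N) {r : Mor 0 N}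
    (hr : r ∈ reg N e) : cap 0 (arc j r) ∈ reg N e := by
  induction j generalizing r with
  | zero => rw [arc_zero, cap_cup (by omega)]; exact zero_mem _
  | succ j ih =>
    rcases j with _ | j
    · rw [cap_zero_arc_one hj]; exact neg_mem hr
    · rw [cap_zero_arc_succ (by omega)]
      exact (H e he).cross _ (by omega) _ (ih (by omega) hr)

theorem cap_mem_reg (i : ℕ) (hi : i ≤ N) (x : Mor 0 (N + 2)) (hx : x ∈ reg (N + 2) d) :
    cap i x ∈ reg N d := by
  suffices reg (N + 2) d ≤ (reg N d).comap (cap i) from this hx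
  refine reg_induction fun t e j h1 h2 r hr => ?_
  rw [Submodule.mem_comap]
  rcases i with _ | i
  · rcases j with _ | j
    · rw [arc_zero, cap_dotAt_pow_cup (by omega)]; exact zero_mem _
    -- The dots on the strand 0 pass over the cap to the strand 1, one at a time, and from there
    -- into `r`. The dot is not lost, so `t` decreases while `e` increases; the errors have fewer
    -- dots.
    · induction t generalizing e r with
      | zero => exact reg_mono (by omega) (cap_zero_arc_mem_reg H (by omega) h2 hr)
      | succ t ih =>
        have A' := A (d - 1) (by omega)
        have hw : (dotAt 0 ^ t) (arc (j + 1) r) ∈ reg (N + 2) (d - 1) := mem_reg (by omega) h2 hr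
        have h3 := dotAt_mem_reg (A e (by omega)) (fun e' he' => A e' (by omega)) 0 (by omega) _ hr
        have h4 := ih (e + 1) (by omega) _ h3
        have h5 := dotAt_zero_pow_mem_reg t
          (dotAt_arc_mid (A e (by omega)) (i := 0) (by omega) h2 hr)
        have h6 := (A' _).cap 0 N rfl (by omega) _ (reg_mono (e := d - 1) (by omega) h5)
        have h7 := (A' _).cap 0 N rfl (by omega) _ hw
        have h8 := add_mem h4 (reg_mono (Nat.sub_le d 1) (sub_mem h6 h7))
        convert h8 using 1
        rw [map_sub, map_sub, ← dotAt_dotAt_zero_pow _ (by omega), cap_dotAt_succ (by omega),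
          pow_succ', Module.End.mul_apply]
        abel
  · rw [cap_dotAt_zero_pow _ (by omega)]
    refine reg_mono h1 (dotAt_zero_pow_mem_reg t ?_)
    rcases Nat.lt_or_ge j i with hij | hij
    · obtain ⟨i, rfl⟩ : ∃ k, i = k + 1 := ⟨i - 1, by omega⟩
      obtain ⟨N, rfl⟩ : ∃ k, N = k + 2 := ⟨N - 2, by omega⟩
      rw [cap_arc_right (by omega) (by omega)]
      exact neg_mem (arc_mem_reg (by omega) ((H e (by omega)).cap _ _ rfl (by omega) _ hr))
    · rcases hij.eq_or_lt with rfl | hij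
      · exact cap_succ_arc_mem_reg H (by omega) hi hr
      · rcases Nat.lt_or_ge (i + 1) j with hij' | hij'
        · obtain ⟨j, rfl⟩ : ∃ k, j = k + 2 := ⟨j - 2, by omega⟩
          obtain ⟨N, rfl⟩ : ∃ k, N = k + 2 := ⟨N - 2, by omega⟩
          rw [cap_arc_left (by omega) (by omega)]
          exact neg_mem (arc_mem_reg (by omega) ((H e (by omega)).cap _ _ rfl (by omega) _ hr))
        · obtain rfl : j = i + 1 := by omega
          rw [cap_self_arc (by omega)]
          exact cap_succ_arc_mem_reg H (by omega) hi hr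

end closure

/-- The closure properties hold by simultaneous induction. Straightening a dot needs fewer dots on
arbitrarily many strands, and removing the leftmost arc needs at most as many dots on two strands
fewer. -/
theorem regClosed (d N : ℕ) : RegClosed N d := by
  induction d using Nat.strong_induction_on generalizing N with
  | _ d ihd =>
  induction N using Nat.twoStepInduction with
  | zero =>
    refine ⟨fun i hi => by omega, fun i hi x hx => ?_, fun i N' h => by omega⟩
    obtain rfl : i = 0 := by omega
    exact arc_mem_reg (j := 0) (by omega) hx
  | one =>
    have : ∀ x ∈ reg 1 d, x = 0 := fun x hx => by rwa [reg, Submodule.mem_bot] at hx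
    refine ⟨fun i hi => by omega, fun i hi x hx => ?_, fun i N' h => by omega⟩
    rw [this x hx, map_zero]
    exact zero_mem _
  | more N ih _ =>
    have H : ∀ e ≤ d, RegClosed N e := by
      intro e he
      rcases he.lt_or_eq with h | rfl
      · exact ihd e h N
      · exact ih
    refine ⟨fun i hi => cross_mem_reg ihd H i (by omega), fun i hi => cup_mem_reg H i hi, ?_⟩
    intro i N' h hi
    obtain rfl : N = N' := by omega
    exact cap_mem_reg ihd H i hi

theorem act_eq_zero {p m n M N N' : ℕ} (f : Mor m n) (h : ¬ (p + m ≤ N ∧ N + n = N' + m))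
    (x : Mor M N) : act p f M N N' x = 0 := by
  rw [act, dif_neg h, LinearMap.zero_apply]

theorem exists_act_mem_reg {m n : ℕ} (f : Diag m n) (p N N' e : ℕ) (r : Mor 0 N)
    (hr : r ∈ reg N e) : ∃ d, act p (mk f) 0 N N' r ∈ reg N' d := by
  by_cases h : p + m ≤ N ∧ N + n = N' + m
  swap
  · exact ⟨0, by rw [act_eq_zero _ h]; exact zero_mem _⟩
  obtain ⟨h, h'⟩ := h
  induction f generalizing p N N' e with
  | id n =>
    obtain rfl : N = N' := by omega
    refine ⟨e, ?_⟩
    rwa [show mk (.id n) = one n from rfl, act_one p h]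
  | s =>
    obtain rfl : N = N' := by omega
    exact ⟨e, (regClosed e N).cross p h r hr⟩
  | b =>
    obtain rfl : N = N' + 2 := by omega
    exact ⟨e, (regClosed e _).cap p N' rfl (by omega) r hr⟩
  | bs =>
    obtain rfl : N' = N + 2 := by omega
    exact ⟨e, (regClosed e _).cup p (by omega) r hr⟩
  | y =>
    obtain rfl : N = N' := by omega
    exact ⟨e + 1, dotAt_mem_reg (regClosed e) (fun e' _ => regClosed e') p (by omega) r hr⟩
  | @comp l m n f g ihf ihg =>
    obtain ⟨d, hd⟩ := ihg p N (N + m - l) e r hr h (by omega)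
    obtain ⟨d', hd'⟩ := ihf p _ N' d _ hd (by omega) (by omega)
    refine ⟨d', ?_⟩
    rw [show mk (.comp f g) = comp (mk f) (mk g) from rfl,
      act_comp p _ _ h (N' := N + m - l) (by omega) (by omega)]
    exact hd'
  | @tensor m n m' n' k l f g hk hl ihf ihg =>
    obtain ⟨d, hd⟩ := ihg (p + m) N (N + n' - m') e r hr (by omega) (by omega)
    obtain ⟨d', hd'⟩ := ihf p _ N' d _ hd (by omega) (by omega)
    refine ⟨d', ?_⟩
    have : mk (.tensor f g hk hl) = comp (el 0 n' (mk f) (N := m + n') (by omega) (by omega))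
        (el m 0 (mk g) (by omega) (by omega)) := by
      rw [el_zero_left n' (mk f) _ _ rfl hl, el_zero_right m (mk g) _ _ hk rfl, tensor_comp_left]
      rfl
    rw [this, act_comp p _ _ h (N' := N + n' - m') (by omega) (by omega),
      act_el p 0 n' _ _ _ (by omega) (by omega), act_el p m 0 _ _ _ (by omega) (by omega)]
    exact hd'
  | zero m n =>
    have : act p (mk (.zero m n)) 0 N N' r = 0 := by
      have h0 : mk (.zero m n) = (0 : ℂ) • (0 : Mor m n) := (zero_smul _ _).symm
      rw [h0, act_smul p _ _ h h', zero_smul]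
    exact ⟨0, this ▸ zero_mem _⟩
  | add f g ihf ihg =>
    obtain ⟨d, hd⟩ := ihf p N N' e r hr h h'
    obtain ⟨d', hd'⟩ := ihg p N N' e r hr h h'
    refine ⟨max d d', ?_⟩
    rw [show mk (.add f g) = mk f + mk g from rfl, act_add p _ _ h h']
    exact add_mem (reg_mono (le_max_left _ _) hd) (reg_mono (le_max_right _ _) hd')
  | smul c f ih =>
    obtain ⟨d, hd⟩ := ih p N N' e r hr h h'
    refine ⟨d, ?_⟩
    rw [show mk (.smul c f) = c • mk f from rfl, act_smul p _ _ h h']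
    exact Submodule.smul_mem _ _ hd

/-- The spanning half of a basis theorem: an expression is applied, generator by generator, to the
empty diagram, and `reg` is stable under each of them. -/
theorem exists_mem_reg {N : ℕ} (x : Mor 0 N) : ∃ d, x ∈ reg N d := by
  obtain ⟨f⟩ := x
  have h1 : one 0 ∈ reg 0 0 := by rw [reg]; exact Submodule.mem_span_singleton_self _
  obtain ⟨d, hd⟩ := exists_act_mem_reg f 0 0 N 0 (one 0) h1
  refine ⟨d, ?_⟩
  have : act 0 (mk f) 0 0 N (one 0) = mk f := by
    rw [act_eq 0 0 (mk f) (by omega) (by omega), comp_one]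
    obtain ⟨N, rfl⟩ : ∃ k, k = N := ⟨_, rfl⟩
    rw [el_zero_left 0 _ _ _ (by omega) (by omega), tensor_one]
  rwa [this] at hd

end Mor
end AffineVW

namespace AffineVW
namespace Mor

/-! ### Bending strands -/

theorem act_comp_right {p k l M M' N N' : ℕ} (g : Mor k l) (x : Mor M N) (z : Mor M' M) :
    act p g M' N N' (comp x z) = comp (act p g M N N' x) z := by
  by_cases h : p + k ≤ N ∧ N + l = N' + k
  · obtain ⟨q, hq⟩ := Nat.exists_eq_add_of_le h.1
    rw [act_eq p q g hq (by omega), act_eq p q g hq (by omega), comp_assoc]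
  · rw [act_eq_zero _ h, act_eq_zero _ h, ← compL_apply, map_zero, LinearMap.zero_apply]

theorem el_tensor_one (p q : ℕ) {m n N N' K K' : ℕ} (f : Mor m n) (h : N = p + m + q)
    (h' : N' = p + n + q) (hK : K = N + 1) (hK' : K' = N' + 1) :
    tensor hK hK' (el p q f h h') (one 1) =
      el p (q + 1) f (by omega) (by omega) := by
  rw [el, tensor_assoc _ (one q) (one 1) _ _ rfl rfl _ _ (by omega) (by omega), one_tensor_one]
  rfl

theorem el_eq_act_one (p q : ℕ) {m n N N' : ℕ} (f : Mor m n) (h : N = p + m + q)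
    (h' : N' = p + n + q) : el p q f h h' = act p f N N N' (one N) := by
  rw [act_eq p q f h h', comp_one]

/-- Bending the last source strand to the target. -/
def rot {m n : ℕ} : Mor (m + 1) n →ₗ[ℂ] Mor m (n + 1) :=
  (compL.flip (cup m (one m))) ∘ₗ ((tensorL rfl rfl).flip (one 1))

theorem rot_eq {m n : ℕ} (f : Mor (m + 1) n) :
    rot f = comp (tensor rfl rfl f (one 1)) (cup m (one m)) := rfl

theorem rot_one (m : ℕ) : rot (one (m + 1)) = cup m (one m) := by
  rw [rot_eq, one_tensor_one]
  exact one_comp _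

theorem rot_act {p k l m n n' : ℕ} (g : Mor k l) (h : p + k ≤ n) (h' : n + l = n' + k)
    (x : Mor (m + 1) n) :
    rot (act p g (m + 1) n n' x) = act p g m (n + 1) (n' + 1) (rot x) := by
  obtain ⟨q, rfl⟩ := Nat.exists_eq_add_of_le h
  rw [rot_eq, rot_eq, act_eq p q g rfl (by omega), act_eq p (q + 1) g (by omega) (by omega),
    ← tensor_one_comp _ x rfl rfl rfl, el_tensor_one, comp_assoc]

theorem rot_comp_dotAt {m n i : ℕ} (h : i < m) (f : Mor (m + 1) n) :
    rot (comp f (dotAt i (one (m + 1)))) = comp (rot f) (dotAt i (one m)) := by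
  rw [rot_eq, rot_eq, comp_assoc, ← tensor_one_comp _ _ rfl rfl rfl, comp_assoc]
  congr 1
  obtain ⟨q, rfl⟩ := Nat.exists_eq_add_of_le h
  have h1 : dotAt i (one (i + 1 + q + 1)) = el i (q + 1) (mk .y) (by omega) (by omega) := by
    rw [el_eq_act_one]; rfl
  rw [h1, el_tensor_one, ← act_eq i (q + 1 + 1) (mk .y)]
  refine (cup_dotAt_far (i := i) (by omega) le_rfl (one (i + 1 + q))).symm.trans ?_
  conv_lhs => rw [← one_comp (dotAt i (one (i + 1 + q)))]
  exact act_comp_right _ _ _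

/-- The 1 is the price of sliding the dot over the new cup, `dotAt_succ_cup`. -/
theorem rot_comp_dotAt_last {m n : ℕ} (f : Mor (m + 1) n) :
    rot (comp f (dotAt m (one (m + 1)))) = dotAt n (rot f) + rot f := by
  have h1 : dotAt m (one (m + 1)) = el m 0 (mk .y) (by omega) (by omega) := by
    rw [el_eq_act_one]; rfl
  have h2 : comp (tensor rfl rfl (dotAt m (one (m + 1))) (one 1)) (cup m (one m)) =
      dotAt (m + 1) (cup m (one m)) + cup m (one m) := by
    rw [h1, el_tensor_one, ← act_eq m (0 + 1) (mk .y)]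
    refine Eq.trans ?_ (sub_eq_iff_eq_add.1 (dotAt_succ_cup (le_refl m) (one m)).symm)
    rfl
  have h3 : ∀ c : Mor m (m + 1 + 1), comp (tensor rfl rfl f (one 1)) (dotAt (m + 1) c) =
      dotAt n (comp (tensor rfl rfl f (one 1)) c) := by
    intro c
    obtain ⟨f⟩ := f
    obtain ⟨p, hp⟩ := f.exists_hasParity
    have h4 := tensor_comp_right hp .y (i := m + 1 + 1) (j := n + 1) (o := n + 1) rfl rfl rfl
    rw [sgn_zero_left, one_smul, ← tensor_comp_left (mk f) (mk .y) rfl rfl rfl] at h4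
    rw [dotAt, dotAt, act_eq (m + 1) 0 (mk .y) (by omega) (by omega),
      act_eq n 0 (mk .y) (by omega) (by omega), el_zero_right _ _ _ _ (by omega) (by omega),
      el_zero_right _ _ _ _ (by omega) (by omega), ← comp_assoc, ← comp_assoc]
    exact congrArg (comp · c) h4.symm
  rw [rot_eq, ← tensor_one_comp _ _ rfl rfl rfl, comp_assoc, h2, rot_eq, ← h3]
  exact map_add (compL _) _ _

/-- A cap against one additional strand unbends the strand by a snake relation, up to the sign of
moving the odd cap past `f`. -/
theorem rot_injective {m n : ℕ} : Function.Injective (rot (m := m) (n := n)) := by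
  rw [← LinearMap.ker_eq_bot, LinearMap.ker_eq_bot']
  intro f hf
  have key : ∃ ε : ℂ, ε ≠ 0 ∧
      cap n (tensor (n := n + 1) (n' := 1) rfl rfl (rot f) (one 1) : Mor (m + 1) (n + 2)) = ε • f := by
    obtain ⟨f⟩ := f
    obtain ⟨p, hp⟩ := f.exists_hasParity
    refine ⟨sgn 1 p, sgn_ne_zero _ _, ?_⟩
    have h1 := tensor_comp_right hp .b (i := m + 1 + 2) (j := n + 2) (o := n) rfl rfl rfl
    rw [← tensor_comp_left (mk f) (mk .b) rfl rfl rfl, tensor_one] at h1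
    have h2 : tensor rfl rfl (rot (mk f)) (one 1) = comp (tensor rfl rfl (mk f) (one 2))
        (el m 1 (mk .bs) (N := m + 1) (N' := m + 1 + 2) (by omega) (by omega)) := by
      rw [rot_eq, ← tensor_one_comp (j := m + 1 + 1 + 1) _ _ rfl rfl rfl,
        tensor_assoc (mk f) (one 1) (one 1) rfl rfl rfl rfl rfl rfl rfl rfl, one_tensor_one,
        cup, ← el_eq_act_one m 0 (mk .bs) (N := m) (N' := m + 2) rfl rfl, el_tensor_one]
    change cap n (tensor (n := n + 1) (n' := 1) rfl rfl (rot (mk f)) (one 1) :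
      Mor (m + 1) (n + 2)) = sgn 1 p • mk f
    rw [h2, cap, act_eq n 0 (mk .b) (N := n + 2) (N' := n) rfl rfl,
      el_zero_right n (mk .b) (N := n + 2) (N' := n) _ _ rfl rfl, ← comp_assoc,
      h1, ← compL_apply, map_smul, LinearMap.smul_apply, compL_apply, comp_assoc,
      ← el_zero_right (m + 1) (mk .b) (N := m + 1 + 2) (N' := m + 1) rfl rfl, el_eq_act_one m 1,
      ← act_eq]
    have h3 := cap_succ_cup (i := m) le_rfl (one (m + 1))
    exact congrArg (sgn 1 p • ·) ((congrArg (comp (mk f)) h3).trans (comp_one _))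
  obtain ⟨ε, h0, hε⟩ := key
  have h0' : tensor (n := n + 1) (n' := 1) rfl rfl (0 : Mor m (n + 1)) (one 1) =
      (0 : Mor (m + 1) (n + 2)) := by
    change tensorL (n := n + 1) (n' := 1) rfl rfl (0 : Mor m (n + 1)) (one 1) = 0
    rw [map_zero, LinearMap.zero_apply]
  rw [hf, h0', map_zero] at hε
  exact (smul_eq_zero.1 hε.symm).resolve_left h0

/-- The number `n + m`, computed so that it fits `rotAll`. -/
def bent : ℕ → ℕ → ℕ
  | 0, n => n
  | m + 1, n => bent m (n + 1)

theorem bent_eq (m n : ℕ) : bent m n = n + m := by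
  induction m generalizing n with
  | zero => rfl
  | succ m ih => rw [bent, ih]; omega

/-- Bending all source strands to the target. -/
def rotAll : (m n : ℕ) → Mor m n →ₗ[ℂ] Mor 0 (bent m n)
  | 0, _ => LinearMap.id
  | m + 1, n => rotAll m (n + 1) ∘ₗ rot

theorem rotAll_succ (m n : ℕ) (f : Mor (m + 1) n) :
    rotAll (m + 1) n f = rotAll m (n + 1) (rot f) := rfl

theorem rotAll_injective (m n : ℕ) : Function.Injective (rotAll m n) := by
  induction m generalizing n with
  | zero => exact fun _ _ h => h
  | succ m ih => exact (ih (n + 1)).comp rot_injective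

theorem rotAll_act {p k l m n n' : ℕ} (g : Mor k l) (h : p + k ≤ n) (h' : n + l = n' + k)
    (x : Mor m n) :
    rotAll m n' (act p g m n n' x) = act p g 0 (bent m n) (bent m n') (rotAll m n x) := by
  induction m generalizing n n' with
  | zero => rfl
  | succ m ih =>
    rw [rotAll_succ, rot_act g h h', ih (by omega) (by omega)]
    rfl

theorem rotAll_dotAt {i m n : ℕ} (h : i < n) (x : Mor m n) :
    rotAll m n (dotAt i x) = dotAt i (rotAll m n x) := rotAll_act _ h rfl x

/-- Bending reverses the order of the source strands, so `i` becomes the target strand `n + m - 1 -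
i`; the dot passes exactly one cup and hence is shifted by 1 exactly once. -/
theorem rotAll_comp_dotAt {i m n : ℕ} (h : i < m) (f : Mor m n) :
    rotAll m n (comp f (dotAt i (one m))) = dotAt (n + m - 1 - i) (rotAll m n f) + rotAll m n f := by
  induction m generalizing n with
  | zero => omega
  | succ m ih =>
    rw [rotAll_succ, rotAll_succ]
    rcases Nat.lt_succ_iff_lt_or_eq.1 h with h | rfl
    · rw [rot_comp_dotAt h, ih h, show n + 1 + m - 1 - i = n + (m + 1) - 1 - i by omega]
      rfl
    · rw [rot_comp_dotAt_last, map_add, rotAll_dotAt (by omega),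
        show n + (i + 1) - 1 - i = n by omega]
      rfl

theorem rotAll_one_succ (m : ℕ) : rotAll (m + 1) (m + 1) (one (m + 1)) =
    act m (mk .bs) 0 (bent m m) (bent m (m + 2)) (rotAll m m (one m)) := by
  rw [rotAll_succ, rot_one]
  exact rotAll_act (mk .bs) le_rfl rfl (one m)

/-! ### Polynomials in the dots -/

/-- Out of range `dotAt` is zero by default, so no bounds are needed and polynomials in the
variables indexed by all of `ℕ` can be evaluated. -/
theorem dotAt_comm' {M N : ℕ} (i j : ℕ) :
    (dotAt i * dotAt j : Module.End ℂ (Mor M N)) = dotAt j * dotAt i := by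
  have h0 : ∀ k, ¬ k < N → (dotAt k : Module.End ℂ (Mor M N)) = 0 := fun k hk =>
    LinearMap.ext fun x => act_eq_zero _ (by omega) x
  by_cases hi : i < N
  · by_cases hj : j < N
    · exact LinearMap.ext fun x => dotAt_comm hj hi x
    · rw [h0 j hj, mul_zero, zero_mul]
  · rw [h0 i hi, mul_zero, zero_mul]

/-- Evaluation of polynomials at the dots, acting by composition. -/
noncomputable def polyAct (M N : ℕ) : MvPolynomial ℕ ℂ →ₐ[ℂ] Module.End ℂ (Mor M N) :=
  letI : CommRing (Algebra.adjoin ℂ (Set.range fun i => (dotAt i : Module.End ℂ (Mor M N)))) :=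
    { (Algebra.adjoin ℂ (Set.range fun i => (dotAt i : Module.End ℂ (Mor M N)))).toRing with
      mul_comm := (Algebra.isMulCommutative_adjoin ℂ (by
        rintro _ ⟨i, rfl⟩ _ ⟨j, rfl⟩
        exact dotAt_comm' i j)).is_comm.comm }
  (Algebra.adjoin ℂ (Set.range fun i => (dotAt i : Module.End ℂ (Mor M N)))).val.comp
    (MvPolynomial.aeval fun i => ⟨dotAt i, Algebra.subset_adjoin ⟨i, rfl⟩⟩)

theorem polyAct_X {M N : ℕ} (i : ℕ) : polyAct M N (MvPolynomial.X i) = dotAt i := by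
  simp [polyAct]

theorem polyAct_X_mul {M N : ℕ} (i : ℕ) (P : MvPolynomial ℕ ℂ) (x : Mor M N) :
    polyAct M N (MvPolynomial.X i * P) x = dotAt i (polyAct M N P x) := by
  rw [map_mul, polyAct_X, Module.End.mul_apply]

theorem polyAct_C {M N : ℕ} (c : ℂ) (x : Mor M N) :
    polyAct M N (MvPolynomial.C c) x = c • x := by
  rw [← MvPolynomial.algebraMap_eq, AlgHom.commutes, Module.algebraMap_end_apply]

/-- A linear map intertwining dots intertwines polynomials in them. -/
theorem polyAct_intertwine {M N M' N' : ℕ} (φ : Mor M N →ₗ[ℂ] Mor M' N')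
    (g : ℕ → MvPolynomial ℕ ℂ) {s : Set ℕ}
    (h : ∀ i ∈ s, ∀ x, φ (dotAt i x) = polyAct M' N' (g i) (φ x))
    {P : MvPolynomial ℕ ℂ} (hP : P ∈ Algebra.adjoin ℂ (MvPolynomial.X '' s)) (x : Mor M N) :
    φ (polyAct M N P x) = polyAct M' N' (MvPolynomial.bind₁ g P) (φ x) := by
  induction hP using Algebra.adjoin_induction generalizing x with
  | mem P hP =>
    obtain ⟨i, hi, rfl⟩ := hP
    rw [polyAct_X, h i hi, MvPolynomial.bind₁_X_right]
  | algebraMap c => simp [Module.algebraMap_end_apply]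
  | add P Q _ _ ihP ihQ => simp only [map_add, LinearMap.add_apply, ihP, ihQ]
  | mul P Q _ _ ihP ihQ => simp only [map_mul, Module.End.mul_apply, ihP, ihQ]

end Mor

open MvPolynomial in
theorem dotPoly_eq {a : ℕ} (p : MvPolynomial (Fin a) ℂ) :
    dotPoly a p = Mor.polyAct a a (rename Fin.val p) (Mor.one a) := by
  induction p using MvPolynomial.induction_on with
  | C c =>
    rw [rename_C, Mor.polyAct_C, ← algebraMap_eq, AlgHom.commutes, Algebra.algebraMap_eq_smul_one]
    rfl
  | add p q hp hq => rw [map_add, hp, hq, map_add, map_add]; rfl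
  | mul_X p i hp =>
    rw [mul_comm, map_mul, dotPoly_X, hp, map_mul, rename_X, Mor.polyAct_X_mul]
    generalize Mor.polyAct a a (rename Fin.val p) (Mor.one a) = x
    change Mor.comp (dot i) x = _
    rw [Mor.dotAt, Mor.act_eq i (a - 1 - i) _ (by omega) (by omega)]
    rfl

end AffineVW

namespace AffineVW

set_option linter.unusedSectionVars false

section Test

variable {ι : Type} [Fintype ι] [DecidableEq ι]

namespace Mor

/-! ### Representations of the generators -/

theorem rep_act {p m n M N N' : ℕ} (f : Mor m n) (k : ℕ) (h : p + m ≤ N) (h' : N + n = N' + m)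
    (x : Mor M N) : rep ι k (act p f M N N' x) = rep ι (k + p) f * rep ι k x := by
  obtain ⟨q, rfl⟩ := Nat.exists_eq_add_of_le h
  rw [act_eq p q f rfl (by omega), rep_comp]
  congr 1
  obtain ⟨f⟩ := f
  change 1 * rho ι (k + p) f * 1 = rho ι (k + p) f
  rw [one_mul, mul_one]

variable {M N : ℕ}

/-- The family of operators of a morphism. -/
noncomputable def fam (x : Mor M N) : ℕ → Op ι := fun k => rep ι k x

theorem fam_add (x y : Mor M N) : (fam (x + y) : ℕ → Op ι) = fam x + fam y :=
  funext fun _ => map_add _ _ _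

theorem fam_smul (c : ℂ) (x : Mor M N) : (fam (c • x) : ℕ → Op ι) = c • fam x :=
  funext fun _ => map_smul _ _ _

theorem fam_zero : (fam (0 : Mor M N) : ℕ → Op ι) = 0 :=
  funext fun _ => map_zero _

theorem fam_one (n : ℕ) : (fam (one n) : ℕ → Op ι) = 1 := rfl

theorem fam_cross {i : ℕ} (h : i + 2 ≤ N) (x : Mor M N) :
    (fam (cross i x) : ℕ → Op ι) = (fun k => opS ι (k + i)) * fam x :=
  funext fun k => rep_act _ k h rfl x

theorem fam_dotAt {i : ℕ} (h : i < N) (x : Mor M N) :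
    (fam (dotAt i x) : ℕ → Op ι) = (fun k => opY ι (k + i)) * fam x :=
  funext fun k => rep_act _ k h rfl x

theorem fam_act_bs {i N' : ℕ} (h : i ≤ N) (h' : N + 2 = N') (x : Mor M N) :
    (fam (act i (mk .bs) M N N' x) : ℕ → Op ι) = (fun k => opC ι (k + i)) * fam x :=
  funext fun k => rep_act _ k h (by omega) x

theorem ordLT_cross {i d : ℕ} {p : ZMod 2} (h : i + 2 ≤ N) {x : Mor M N}
    (hx : OrdLT (d + 1) p (fam x : ℕ → Op ι)) : OrdLT (d + 1) p (fam (cross i x) : ℕ → Op ι) := by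
  rw [fam_cross h]
  have := (IsLocal.opS.ordLT (ι := ι) i).mul (d := 0) hx
  rwa [zero_add, zero_add] at this

theorem ordLT_dotAt {i d : ℕ} {p : ZMod 2} (h : i < N) {x : Mor M N}
    (hx : OrdLT (d + 1) p (fam x : ℕ → Op ι)) :
    OrdLT (d + 1 + 1) p (fam (dotAt i x) : ℕ → Op ι) := by
  rw [fam_dotAt h]
  have := (ordLT_opY (ι := ι) i).mul (d := 1) hx
  rwa [zero_add, add_comm 1 d] at this

theorem ordLT_arc {j d : ℕ} {p : ZMod 2} (h : j ≤ N) {x : Mor M N}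
    (hx : OrdLT (d + 1) p (fam x : ℕ → Op ι)) :
    OrdLT (d + 1) (1 + p) (fam (arc j x) : ℕ → Op ι) := by
  induction j with
  | zero =>
    have := (IsLocal.opC.ordLT (ι := ι) 0).mul (d := 0) hx
    rw [← fam_act_bs (Nat.zero_le _) rfl, zero_add] at this
    exact this
  | succ j ih => exact ordLT_cross (by omega) (ih (by omega))

theorem ordLT_dotAt_zero_pow {d t : ℕ} {p : ZMod 2} (h : 0 < N) {x : Mor M N}
    (hx : OrdLT (d + 1) p (fam x : ℕ → Op ι)) :
    OrdLT (t + d + 1) p (fam ((dotAt 0 ^ t) x) : ℕ → Op ι) := by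
  induction t with
  | zero => rwa [zero_add]
  | succ t ih =>
    rw [pow_succ', Module.End.mul_apply, add_right_comm t 1 d]
    exact ordLT_dotAt h ih

/-- The number of dots bounds the order. The parity counts arcs, each of which is odd. -/
theorem ordLT_of_mem_reg {d : ℕ} {x : Mor 0 N} (hx : x ∈ reg N d) :
    OrdLT (d + 1) (N / 2 : ℕ) (fam x : ℕ → Op ι) := by
  induction N using Nat.twoStepInduction generalizing d with
  | zero =>
    rw [reg, Submodule.mem_span_singleton] at hx
    obtain ⟨c, rfl⟩ := hx
    rw [fam_smul, fam_one]
    exact (ordLT_one.smul c).mono (by omega)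
  | one =>
    rw [reg, Submodule.mem_bot] at hx
    rw [hx, fam_zero]
    exact OrdLT.zero _ _
  | more N ih _ =>
    rw [reg] at hx
    induction hx using Submodule.span_induction with
    | mem x hx =>
      obtain ⟨t, e, j, h1, h2, r, hr, rfl⟩ := hx
      rw [show ((N + 2) / 2) = 1 + N / 2 by omega, Nat.cast_add, Nat.cast_one]
      exact (ordLT_dotAt_zero_pow (by omega) (ordLT_arc h2 (ih hr))).mono (by omega)
    | zero => rw [fam_zero]; exact OrdLT.zero _ _
    | add x y _ _ hx hy => rw [fam_add]; exact hx.add hy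
    | smul c x _ hx => rw [fam_smul]; exact hx.smul c

theorem sym_fam_dotAt {i d : ℕ} {p : ZMod 2} (h : i < N) {x : Mor M N}
    (hx : OrdLT (d + 1) p (fam x : ℕ → Op ι)) (u : Word ι → ℂ) (w : Word ι) :
    sym (d + 1) (fam (dotAt i x)) u w = MvPolynomial.X (w i).1 * sym d (fam x) u w := by
  rw [fam_dotAt h, sym_opY_mul hx]

theorem sym_fam_dotAt_zero_pow {d t : ℕ} {p : ZMod 2} (h : 0 < N) {x : Mor M N}
    (hx : OrdLT (d + 1) p (fam x : ℕ → Op ι)) (u : Word ι → ℂ) (w : Word ι) :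
    sym (t + d) (fam ((dotAt 0 ^ t) x)) u w =
      MvPolynomial.X (w 0).1 ^ t * sym d (fam x) u w := by
  induction t with
  | zero => rw [zero_add, pow_zero, pow_zero, one_mul]; rfl
  | succ t ih =>
    rw [pow_succ', Module.End.mul_apply, add_right_comm t 1 d,
      sym_fam_dotAt h (ordLT_dotAt_zero_pow h hx), ih, pow_succ', mul_assoc]

theorem sym_sum {α : Type} (s : Finset α) (d : ℕ) (x : α → Mor M N) (u : Word ι → ℂ) (w : Word ι) :
    sym d (fam (∑ i ∈ s, x i)) u w = ∑ i ∈ s, sym d (fam (x i)) u w := by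
  classical
  induction s using Finset.induction_on with
  | empty => rw [Finset.sum_empty, Finset.sum_empty, fam_zero]
             exact (OrdLT.zero d 0).sym_eq_zero u w
  | insert a s ha ih => rw [Finset.sum_insert ha, Finset.sum_insert ha, fam_add, sym_add, ih]

end Mor

/-- Delete the letters at places `0` and `j + 1`. -/
def Word.arcDel (j : ℕ) (w : Word ι) : Word ι := fun n => if n < j then w (n + 1) else w (n + 2)

theorem Word.arcDel_swapAt (j : ℕ) (w : Word ι) :
    (w.swapAt (j + 1)).arcDel j = w.arcDel (j + 1) := by
  funext n
  simp only [arcDel, swapAt]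
  split_ifs <;> first | rfl | omega | (congr 1; omega)

theorem Mor.exists_sym_arc {N j : ℕ} (h : j ≤ N) (w : Word ι) : ∃ ε : ℂ, ε ≠ 0 ∧
    ∀ (M d : ℕ) (x : Mor M N) (u : Word ι → ℂ), sym d (fam (arc j x)) u w =
      if w (j + 1) = (w 0).dual then ε • sym d (fam x) u (w.arcDel j) else 0 := by
  induction j generalizing w with
  | zero =>
    obtain ⟨ε, hε, H⟩ := exists_sym_opC_mul 0 w
    refine ⟨ε, hε, fun M d x u => ?_⟩
    rw [show w.arcDel 0 = w.delAt 0 from rfl, ← H, ← fam_act_bs (Nat.zero_le _) rfl]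
    rfl
  | succ j ih =>
    obtain ⟨ε, hε, H⟩ := ih (by omega) (w.swapAt (j + 1))
    refine ⟨_ * ε, mul_ne_zero (sgn_ne_zero (w (j + 1)).2 (w (j + 1 + 1)).2) hε, fun M d x u => ?_⟩
    rw [arc_succ, fam_cross (by omega), sym_opS_mul, H, Word.arcDel_swapAt, mul_smul, smul_ite,
      smul_zero]
    have h1 : w.swapAt (j + 1) (j + 1) = w (j + 1 + 1) := by simp [Word.swapAt]
    have h2 : w.swapAt (j + 1) 0 = w 0 := by simp [Word.swapAt]
    rw [h1, h2]

/-! ### Test words -/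

/-- Words on which an arc diagram with arcs labelled `cs` (in the order of their left ends) does not
vanish; `v` is what remains after deletion of the arcs. -/
def IsTest (v : Word ι) : List ι → Word ι → Prop
  | [], w => w = v
  | c :: cs, w => w 0 = (c, 0) ∧ ∃ j ≤ 2 * cs.length, w (j + 1) = (c, 1) ∧
      (∀ n < 2 * cs.length, (w.arcDel j n).1 ≠ c) ∧ IsTest v cs (w.arcDel j)

theorem IsTest.mem {v : Word ι} {cs : List ι} {w : Word ι} (h : IsTest v cs w) {n : ℕ}
    (hn : n < 2 * cs.length) : (w n).1 ∈ cs := by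
  induction cs generalizing w n with
  | nil => simp at hn
  | cons c cs ih =>
    obtain ⟨h0, j, hj, hj1, _, h⟩ := h
    rw [List.length_cons] at hn
    rcases n with _ | n
    · rw [h0]; exact List.mem_cons_self
    · rcases lt_trichotomy n j with hnj | rfl | hnj
      · have := ih h (n := n) (by omega)
        rw [Word.arcDel, if_pos hnj] at this
        exact List.mem_cons_of_mem _ this
      · rw [hj1]; exact List.mem_cons_self
      · obtain ⟨n, rfl⟩ : ∃ k, n = k + 1 := ⟨n - 1, by omega⟩
        have := ih h (n := n) (by omega)
        rw [Word.arcDel, if_neg (by omega)] at this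
        exact List.mem_cons_of_mem _ this

/-- Insert the letters `(c, 0)` and `(c, 1)` at places `0` and `j + 1`. -/
def Word.arcIns (c : ι) (j : ℕ) (w : Word ι) : Word ι := fun n =>
  if n = 0 then (c, 0) else if n ≤ j then w (n - 1) else if n = j + 1 then (c, 1) else w (n - 2)

theorem Word.arcDel_arcIns (c : ι) (j : ℕ) (w : Word ι) : (w.arcIns c j).arcDel j = w := by
  funext n
  simp only [arcDel, arcIns]
  by_cases h : n < j
  · rw [if_pos h, if_neg (by omega), if_pos (by omega), Nat.add_sub_cancel]
  · rw [if_neg h, if_neg (by omega), if_neg (by omega), if_neg (by omega), Nat.add_sub_cancel]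

theorem IsTest.arcIns {v : Word ι} {c : ι} {cs : List ι} {w : Word ι} (h : IsTest v cs w)
    (hc : c ∉ cs) {j : ℕ} (hj : j ≤ 2 * cs.length) : IsTest v (c :: cs) (w.arcIns c j) := by
  refine ⟨by simp [Word.arcIns], j, hj, by simp [Word.arcIns], fun n hn e => hc ?_, ?_⟩
  · rw [Word.arcDel_arcIns] at e
    exact e ▸ h.mem hn
  · rwa [Word.arcDel_arcIns]

namespace Mor

theorem exists_reg_expansion {N d : ℕ} {x : Mor 0 (N + 2)} (hx : x ∈ reg (N + 2) d) :
    ∃ ρ : ℕ → ℕ → Mor 0 N, (∀ t j, ρ t j ∈ reg N (d - t)) ∧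
      x = ∑ t ∈ Finset.range (d + 1), ∑ j ∈ Finset.range (N + 1), (dotAt 0 ^ t) (arc j (ρ t j)) := by
  rw [reg] at hx
  induction hx using Submodule.span_induction with
  | mem x hx =>
    obtain ⟨t, e, j, h1, h2, r, hr, rfl⟩ := hx
    refine ⟨fun t' j' => if t' = t ∧ j' = j then r else 0, fun t' j' => ?_, ?_⟩
    · dsimp only
      split_ifs with h
      · obtain ⟨rfl, rfl⟩ := h
        exact reg_mono (by omega) hr
      · exact zero_mem _
    · rw [Finset.sum_eq_single t, Finset.sum_eq_single j]
      · simp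
      · intro j' _ hj'
        simp [hj']
      · intro h
        simp only [Finset.mem_range] at h
        omega
      · intro t' _ ht'
        simp [ht']
      · intro h
        simp only [Finset.mem_range] at h
        omega
  | zero => exact ⟨fun _ _ => 0, fun _ _ => zero_mem _, by simp⟩
  | add x y _ _ hx hy =>
    obtain ⟨ρ, h1, h2⟩ := hx
    obtain ⟨ρ', h1', h2'⟩ := hy
    refine ⟨fun t j => ρ t j + ρ' t j, fun t j => add_mem (h1 t j) (h1' t j), ?_⟩
    conv_lhs => rw [h2, h2']
    simp only [map_add, Finset.sum_add_distrib]
  | smul c x _ hx =>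
    obtain ⟨ρ, h1, h2⟩ := hx
    refine ⟨fun t j => c • ρ t j, fun t j => Submodule.smul_mem _ _ (h1 t j), ?_⟩
    conv_lhs => rw [h2]
    simp only [map_smul, Finset.smul_sum]

/-- The label `c` occurs at the two places 0 and `j + 1` only, so every diagram whose first arc ends
elsewhere has symbol zero. What remains is a polynomial in `X c`, whose exponents count the dots on
that arc. -/
theorem exists_sym_expansion {cs : List ι} {c : ι} {w : Word ι} {N d j : ℕ}
    (hN : N = 2 * cs.length) (h0 : w 0 = (c, 0)) (hj : j ≤ N) (hj1 : w (j + 1) = (c, 1))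
    (hc : ∀ n < N, (w.arcDel j n).1 ≠ c) :
    ∃ ε : ℂ, ε ≠ 0 ∧ ∀ (ρ : ℕ → ℕ → Mor 0 N), (∀ t j, ρ t j ∈ reg N (d - t)) →
      sym d (fam (∑ t ∈ Finset.range (d + 1), ∑ j ∈ Finset.range (N + 1),
        (dotAt 0 ^ t) (arc j (ρ t j)))) 1 w = ∑ t ∈ Finset.range (d + 1),
          MvPolynomial.X c ^ t * (ε • sym (d - t) (fam (ρ t j)) 1 (w.arcDel j)) := by
  obtain ⟨ε, hε, H⟩ := exists_sym_arc hj w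
  refine ⟨ε, hε, fun ρ hρ => ?_⟩
  rw [sym_sum]
  refine Finset.sum_congr rfl fun t ht => ?_
  have ht : t ≤ d := Nat.lt_succ_iff.1 (Finset.mem_range.1 ht)
  have hd : (w 0).dual = (c, 1) := by rw [h0]; rfl
  have key : ∀ j' ≤ N, sym d (fam ((dotAt 0 ^ t) (arc j' (ρ t j')))) 1 w =
      MvPolynomial.X c ^ t * sym (d - t) (fam (arc j' (ρ t j'))) 1 w := by
    intro j' hj'
    have := sym_fam_dotAt_zero_pow (ι := ι) (t := t) (by omega)
      (ordLT_arc hj' (ordLT_of_mem_reg (hρ t j'))) 1 w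
    rwa [Nat.add_sub_cancel' ht, h0] at this
  rw [sym_sum, Finset.sum_eq_single j]
  · rw [key j hj, H, hj1, hd, if_pos rfl]
  · intro j' hj' hne
    have hj' : j' ≤ N := Nat.lt_succ_iff.1 (Finset.mem_range.1 hj')
    obtain ⟨ε', _, H'⟩ := exists_sym_arc hj' w
    rw [key j' hj', H', if_neg, mul_zero]
    intro e
    rw [hd] at e
    rcases Nat.lt_or_ge j' j with h | h
    · refine hc j' (by omega) ?_
      rw [Word.arcDel, if_pos h, e]
    · obtain ⟨k, rfl⟩ : ∃ k, j' = k + 1 := ⟨j' - 1, by omega⟩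
      refine hc k (by omega) ?_
      rw [Word.arcDel, if_neg (by omega), e]
  · intro h
    exact absurd (Finset.mem_range.2 (by omega)) h

/-- The filtration shifted by one. -/
def regLT (N : ℕ) : ℕ → Submodule ℂ (Mor 0 N)
  | 0 => ⊥
  | d + 1 => reg N d

/-- Ensures that the coefficients in `exists_sym_expansion` do not involve the label of the first
arc, so that powers of its variable can be compared. -/
theorem sym_mem_supported {cs : List ι} {v w : Word ι} (hw : IsTest v cs w) {N d : ℕ}
    (hN : N = 2 * cs.length) {x : Mor 0 N} (hx : x ∈ reg N d) :
    sym d (fam x) 1 w ∈ MvPolynomial.supported ℂ {c | c ∈ cs} := by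
  induction cs generalizing w N d with
  | nil =>
    obtain rfl : N = 0 := by simpa using hN
    rcases d with _ | d
    · rw [sym_zero, ← MvPolynomial.algebraMap_eq]
      exact Subalgebra.algebraMap_mem _ _
    · rw [(ordLT_of_mem_reg (d := d) hx).sym_eq_zero]
      exact zero_mem _
  | cons c cs ih =>
    obtain ⟨N, rfl⟩ : ∃ k, N = k + 2 := ⟨N - 2, by rw [List.length_cons] at hN; omega⟩
    have hN' : N = 2 * cs.length := by rw [List.length_cons] at hN; omega
    obtain ⟨h0, j, hj, hj1, hc, hw⟩ := hw
    obtain ⟨ρ, hρ, rfl⟩ := exists_reg_expansion hx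
    obtain ⟨ε, hε, H⟩ := exists_sym_expansion (d := d) hN' h0 (hN' ▸ hj) hj1 (hN' ▸ hc)
    rw [H ρ hρ]
    refine sum_mem fun t _ => mul_mem (pow_mem ?_ _) (Subalgebra.smul_mem _ ?_ _)
    · exact MvPolynomial.X_mem_supported.2 List.mem_cons_self
    · exact MvPolynomial.supported_mono (fun _ h => List.mem_cons_of_mem _ h)
        (ih hw hN' (hρ t j))

end Mor

open MvPolynomial in
theorem eq_zero_of_sum_X_pow_mul {s : Set ι} {c : ι} (hc : c ∉ s) {n : ℕ}
    {q : ℕ → MvPolynomial ι ℂ} (hq : ∀ t, q t ∈ supported ℂ s)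
    (h : ∑ t ∈ Finset.range n, X c ^ t * q t = 0) {t : ℕ} (ht : t < n) : q t = 0 := by
  let φ : MvPolynomial ι ℂ →ₐ[ℂ] Polynomial (MvPolynomial ι ℂ) :=
    aeval fun i => if i = c then Polynomial.X else Polynomial.C (X i)
  have hφ : ∀ p ∈ supported ℂ s, φ p = Polynomial.C p := by
    intro p hp
    rw [supported] at hp
    induction hp using Algebra.adjoin_induction with
    | mem p hp =>
      obtain ⟨i, hi, rfl⟩ := hp
      have : i ≠ c := fun e => hc (e ▸ hi)
      simp [φ, this]
    | algebraMap c => rw [AlgHom.commutes]; rfl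
    | add p q _ _ hp hq => rw [map_add, hp, hq, map_add]
    | mul p q _ _ hp hq => rw [map_mul, hp, hq, map_mul]
  have h1 := congrArg φ h
  simp only [map_sum, map_mul, map_pow, map_zero, hφ _ (hq _)] at h1
  have h2 := congrArg (Polynomial.coeff · t) h1
  simp only [Polynomial.finsetSum_coeff, φ, aeval_X, if_true, Polynomial.X_pow_mul,
    Polynomial.coeff_C_mul, Polynomial.coeff_X_pow, Polynomial.coeff_zero] at h2
  simpa [Finset.sum_ite_eq, ht] using h2

namespace Mor

/-- The graded form of linear independence of dotted arc diagrams. A test word with an inserted pair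
labelled `c` isolates the end of the first arc, the power of `X c` isolates its dots, and induction
treats the remaining arcs. -/
theorem mem_regLT_of_sym_eq_zero {v : Word ι} {cs : List ι} (hcs : cs.Nodup) {N d : ℕ}
    (hN : N = 2 * cs.length) {x : Mor 0 N} (hx : x ∈ reg N d)
    (h : ∀ w, IsTest v cs w → sym d (fam x) 1 w = 0) : x ∈ regLT N d := by
  induction cs generalizing N d with
  | nil =>
    obtain rfl : N = 0 := by simpa using hN
    rcases d with _ | d
    · rw [reg, Submodule.mem_span_singleton] at hx
      obtain ⟨c, rfl⟩ := hx
      have h1 := h v rfl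
      rw [sym_zero, fam_smul, fam_one] at h1
      have : c = 0 := by simpa using h1
      rw [this, zero_smul]
      exact zero_mem _
    · exact hx
  | cons c cs ih =>
    obtain ⟨N, rfl⟩ : ∃ k, N = k + 2 := ⟨N - 2, by rw [List.length_cons] at hN; omega⟩
    have hN' : N = 2 * cs.length := by rw [List.length_cons] at hN; omega
    rw [List.nodup_cons] at hcs
    obtain ⟨ρ, hρ, rfl⟩ := exists_reg_expansion hx
    refine sum_mem fun t ht => sum_mem fun j hj => ?_
    have ht : t ≤ d := Nat.lt_succ_iff.1 (Finset.mem_range.1 ht)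
    have hj : j ≤ N := Nat.lt_succ_iff.1 (Finset.mem_range.1 hj)
    have key : ρ t j ∈ regLT N (d - t) := by
      refine ih hcs.2 hN' (hρ t j) fun w hw => ?_
      have hw' := hw.arcIns hcs.1 (j := j) (hN' ▸ hj)
      have hdel := Word.arcDel_arcIns c j w
      obtain ⟨ε, hε, H⟩ := exists_sym_expansion (d := d) (w := w.arcIns c j) (j := j) hN'
        hw'.1 hj (by simp [Word.arcIns]) (fun n hn e => hcs.1 (by
          rw [hdel] at e
          exact e ▸ hw.mem (hN' ▸ hn)))
      have h1 := h _ hw'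
      rw [H ρ hρ, hdel] at h1
      have := eq_zero_of_sum_X_pow_mul (s := {c | c ∈ cs}) hcs.1
        (fun t => Subalgebra.smul_mem _ (sym_mem_supported hw hN' (hρ t j)) ε) h1
        (Nat.lt_succ_of_le ht)
      exact (smul_eq_zero.1 this).resolve_left hε
    rcases hdt : d - t with _ | e
    · rw [hdt, regLT, Submodule.mem_bot] at key
      rw [key, map_zero, map_zero]
      exact zero_mem _
    · rw [hdt] at key
      obtain ⟨d, rfl⟩ : ∃ k, d = k + 1 := ⟨d - 1, by omega⟩
      exact mem_reg (by omega) hj key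

end Mor
end Test
end AffineVW

namespace AffineVW

set_option linter.unusedSectionVars false

section Standard

variable {ι : Type} [Fintype ι] [DecidableEq ι]

/-! ### Test words of nested arc diagrams -/

/-- The test words of nested arc diagrams. -/
def IsStd (v : Word ι) : List ι → Word ι → Prop
  | [], w => w = v
  | c :: cs, w => w 0 = (c, 0) ∧ w (2 * cs.length + 1) = (c, 1) ∧
      IsStd v cs (w.arcDel (2 * cs.length))

/-- Each label occurs twice. If mirror image places carry equal labels, the partner of the first
letter must be the last place, and the same holds after deletion of this outermost pair. -/
theorem IsTest.isStd {v : Word ι} {cs : List ι} {w : Word ι} (h : IsTest v cs w)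
    (hw : ∀ i < cs.length, (w i).1 = (w (2 * cs.length - 1 - i)).1) : IsStd v cs w := by
  induction cs generalizing w with
  | nil => exact h
  | cons c cs ih =>
    obtain ⟨h0, j, hj, hj1, hc, h⟩ := h
    rw [List.length_cons] at hw
    have hjN : j = 2 * cs.length := by
      by_contra hne
      obtain ⟨k, hk⟩ : ∃ k, 2 * cs.length = k + 1 := ⟨2 * cs.length - 1, by omega⟩
      refine hc k (by omega) ?_
      have := hw 0 (by omega)
      rw [h0, show 2 * (cs.length + 1) - 1 - 0 = k + 2 by omega] at this
      rw [Word.arcDel, if_neg (by omega), ← this]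
    subst hjN
    refine ⟨h0, hj1, ih h fun i hi => ?_⟩
    have := hw (i + 1) (by omega)
    rw [Word.arcDel, Word.arcDel, if_pos (by omega), if_pos (by omega), this]
    congr 2
    omega

theorem IsStd.unique {v : Word ι} {cs : List ι} {w w' : Word ι} (h : IsStd v cs w)
    (h' : IsStd v cs w') : w = w' := by
  induction cs generalizing w w' with
  | nil => rw [show w = v from h, show w' = v from h']
  | cons c cs ih =>
    have := ih h.2.2 h'.2.2
    funext n
    rcases n with _ | n
    · rw [h.1, h'.1]
    rcases lt_trichotomy n (2 * cs.length) with hn | rfl | hn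
    · have := congrFun this n
      simpa [Word.arcDel, hn] using this
    · rw [h.2.1, h'.2.1]
    · obtain ⟨n, rfl⟩ : ∃ k, n = k + 1 := ⟨n - 1, by omega⟩
      have := congrFun this n
      simpa [Word.arcDel, show ¬ n < 2 * cs.length by omega] using this

theorem IsStd.apply {v : Word ι} {cs : List ι} {w : Word ι} (h : IsStd v cs w) {i : ℕ}
    (hi : i < cs.length) : w i = (cs[i], 0) ∧ w (2 * cs.length - 1 - i) = (cs[i], 1) := by
  induction cs generalizing w i with
  | nil => simp at hi
  | cons c cs ih =>
    obtain ⟨h0, h1, h⟩ := h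
    rcases i with _ | i
    · rw [List.length_cons, show 2 * (cs.length + 1) - 1 - 0 = 2 * cs.length + 1 by omega]
      exact ⟨h0, h1⟩
    · rw [List.length_cons] at hi ⊢
      have := ih h (i := i) (by omega)
      rw [Word.arcDel, Word.arcDel, if_pos (by omega), if_pos (by omega)] at this
      rw [show 2 * (cs.length + 1) - 1 - (i + 1) = 2 * cs.length - 1 - i + 1 by omega]
      exact this

namespace Mor

theorem act_bs_mem_reg {p N N' d : ℕ} (h : N' = N + 2) (hp : p ≤ N) {x : Mor 0 N}
    (hx : x ∈ reg N d) : act p (mk .bs) 0 N N' x ∈ reg N' d := by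
  subst h
  exact (regClosed d N).cup p hp x hx

theorem rotAll_one_mem_reg (m : ℕ) : rotAll m m (one m) ∈ reg (bent m m) 0 := by
  induction m with
  | zero =>
    change one 0 ∈ reg 0 0
    rw [reg]
    exact Submodule.mem_span_singleton_self _
  | succ m ih =>
    rw [rotAll_one_succ]
    exact act_bs_mem_reg (by rw [bent_eq, bent_eq]; omega) (by rw [bent_eq]; omega) ih

theorem exists_sym_rotAll_one (m : ℕ) {w : Word ι} (hw : ∀ i < m, w (2 * m - 1 - i) = (w i).dual) :
    ∃ ε : ℂ, ε ≠ 0 ∧ sym 0 (fam (rotAll m m (one m))) 1 w = MvPolynomial.C ε := by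
  induction m generalizing w with
  | zero => exact ⟨1, one_ne_zero, by rw [sym_zero]; rfl⟩
  | succ m ih =>
    obtain ⟨ε, hε, h⟩ := ih (w := w.delAt m) (by
      intro i hi
      have := hw i (by omega)
      rw [Word.delAt, Word.delAt, if_neg (by omega), if_pos hi, ← this]
      congr 1
      omega)
    obtain ⟨ε', hε', h'⟩ := exists_sym_opC_mul m w
    refine ⟨ε' * ε, mul_ne_zero hε' hε, ?_⟩
    have h1 := hw m (by omega)
    rw [show 2 * (m + 1) - 1 - m = m + 1 by omega] at h1
    rw [rotAll_one_succ]
    change sym 0 (fam (act m (mk .bs) 0 (bent m m) (bent m (m + 2)) (rotAll m m (one m)))) 1 w = _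
    rw [fam_act_bs (by rw [bent_eq]; omega) (by rw [bent_eq, bent_eq]; omega), h',
      if_pos h1, h, MvPolynomial.smul_eq_C_mul, map_mul]

/-- The bent identity is built by nested cups, and each of them vanishes unless the two places it
joins carry dual letters. -/
theorem sym_rotAll_one_eq_zero (m : ℕ) {w : Word ι} {i : ℕ} (hi : i < m)
    (hw : w (2 * m - 1 - i) ≠ (w i).dual) : sym 0 (fam (rotAll m m (one m))) 1 w = 0 := by
  induction m generalizing w with
  | zero => omega
  | succ m ih =>
    obtain ⟨ε, _, h⟩ := exists_sym_opC_mul m w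
    rw [rotAll_one_succ]
    change sym 0 (fam (act m (mk .bs) 0 (bent m m) (bent m (m + 2)) (rotAll m m (one m)))) 1 w = _
    rw [fam_act_bs (by rw [bent_eq]; omega) (by rw [bent_eq, bent_eq]; omega), h]
    split_ifs with h1
    · rcases Nat.lt_succ_iff_lt_or_eq.1 hi with hi' | rfl
      · rw [ih hi', smul_zero]
        rw [Word.delAt, Word.delAt, if_neg (by omega), if_pos hi']
        convert hw using 2
        omega
      · rw [show 2 * (i + 1) - 1 - i = i + 1 by omega] at hw
        exact absurd h1 hw
    · rfl

theorem act_y_mem_reg {i N d : ℕ} (h : i < N) {x : Mor 0 N} (hx : x ∈ reg N d) :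
    dotAt i x ∈ reg N (d + 1) :=
  dotAt_mem_reg (regClosed d) (fun e _ => regClosed e) i h x hx

open MvPolynomial in
theorem polyAct_monomial {κ : Type} {pos : κ → ℕ} {N d e : ℕ} (hpos : ∀ i, pos i < N) {x : Mor 0 N}
    (hx : x ∈ reg N e) (w : Word ι) (s : κ →₀ ℕ) (c : ℂ) (hs : s.degree = d) :
    polyAct 0 N (rename pos (monomial s c)) x ∈ reg N (d + e) ∧
      sym (d + e) (fam (polyAct 0 N (rename pos (monomial s c)) x)) 1 w =
        rename (fun i => (w (pos i)).1) (monomial s c) * sym e (fam x) 1 w := by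
  induction d generalizing s with
  | zero =>
    obtain rfl := (Finsupp.degree_eq_zero_iff s).1 hs
    rw [show (monomial 0 c : MvPolynomial κ ℂ) = C c from rfl, rename_C, rename_C, polyAct_C,
      zero_add, fam_smul, sym_smul, smul_eq_C_mul]
    exact ⟨Submodule.smul_mem _ _ hx, rfl⟩
  | succ d ih =>
    obtain ⟨i, hi⟩ : ∃ i, s i ≠ 0 := by
      by_contra! h
      rw [show s = 0 from Finsupp.ext h] at hs
      simp at hs
    obtain ⟨s', rfl⟩ : ∃ s', s = s' + Finsupp.single i 1 :=
      ⟨s - Finsupp.single i 1, (tsub_add_cancel_of_le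
        (Finsupp.single_le_iff.2 (Nat.one_le_iff_ne_zero.2 hi))).symm⟩
    have hs' : s'.degree = d := by
      rw [map_add, Finsupp.degree_single] at hs
      omega
    obtain ⟨h1, h2⟩ := ih s' hs'
    rw [monomial_add_single, pow_one, mul_comm (monomial s' c), map_mul (rename pos),
      map_mul (rename fun i => (w (pos i)).1), rename_X, rename_X, polyAct_X_mul, add_right_comm d 1 e]
    refine ⟨act_y_mem_reg (hpos i) h1, ?_⟩
    rw [sym_fam_dotAt (hpos i) (ordLT_of_mem_reg h1), h2, mul_assoc]

open MvPolynomial in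
theorem polyAct_homogeneous {κ : Type} {pos : κ → ℕ} {N d e : ℕ} (hpos : ∀ i, pos i < N)
    {x : Mor 0 N} (hx : x ∈ reg N e) (w : Word ι) {P : MvPolynomial κ ℂ}
    (hP : P.IsHomogeneous d) :
    polyAct 0 N (rename pos P) x ∈ reg N (d + e) ∧
      sym (d + e) (fam (polyAct 0 N (rename pos P) x)) 1 w =
        rename (fun i => (w (pos i)).1) P * sym e (fam x) 1 w := by
  have key : ∀ s ∈ P.support, s.degree = d := fun s hs => by
    have := hP (mem_support_iff.1 hs)
    rwa [Finsupp.degree_eq_weight_one]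
  rw [P.as_sum, map_sum, map_sum, map_sum, LinearMap.sum_apply, sym_sum, Finset.sum_mul]
  exact ⟨sum_mem fun s hs => (polyAct_monomial hpos hx w s _ (key s hs)).1,
    Finset.sum_congr rfl fun s hs => (polyAct_monomial hpos hx w s _ (key s hs)).2⟩

open MvPolynomial in
theorem polyAct_mem_reg {κ : Type} {pos : κ → ℕ} {N d : ℕ} (hpos : ∀ i, pos i < N) {x : Mor 0 N}
    (hx : x ∈ reg N 0) {P : MvPolynomial κ ℂ} (hP : P.totalDegree ≤ d) :
    polyAct 0 N (rename pos P) x ∈ reg N d := by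
  rw [P.as_sum, map_sum, map_sum, LinearMap.sum_apply]
  refine sum_mem fun s hs => reg_mono ((le_totalDegree hs).trans hP) ?_
  exact (polyAct_monomial (ι := PUnit) hpos hx (fun _ => (⟨⟩, 0)) s _ rfl).1

open MvPolynomial in
/-- If the symbol of a morphism without dots does not vanish at a word that has different letters
at certain places, then polynomials in the dots at these places act freely on it. -/
theorem eq_zero_of_polyAct_add_eq_zero {κ : Type} {pos : κ → ℕ} {N : ℕ} (hpos : ∀ i, pos i < N)
    {x z : Mor 0 N} (hx : x ∈ reg N 0) {w : Word ι}
    (hw : Function.Injective fun i => (w (pos i)).1) (hsym : sym 0 (fam x) 1 w ≠ 0)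
    {G : MvPolynomial κ ℂ} (hz : z ∈ regLT N G.totalDegree)
    (h : polyAct 0 N (rename pos G) x + z = 0) : G = 0 := by
  by_contra hG
  have h1 := congrArg (fun y => sym G.totalDegree (fam y : ℕ → Op ι) 1 w) h
  simp only [fam_add, fam_zero, sym_add] at h1
  have hz0 : sym G.totalDegree (fam z : ℕ → Op ι) 1 w = 0 := by
    rcases hd : G.totalDegree with _ | d
    · rw [hd, regLT, Submodule.mem_bot] at hz
      rw [hz, fam_zero]
      exact (OrdLT.zero 0 0).sym_eq_zero 1 w
    · rw [hd] at hz
      exact (ordLT_of_mem_reg hz).sym_eq_zero 1 w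
  have hG1 : sym G.totalDegree (fam (polyAct 0 N (rename pos G) x) : ℕ → Op ι) 1 w =
      rename (fun i => (w (pos i)).1) (homogeneousComponent G.totalDegree G) *
        sym 0 (fam x) 1 w := by
    have hsum : polyAct 0 N (rename pos G) x =
        ∑ s ∈ G.support, polyAct 0 N (rename pos (monomial s (coeff s G))) x := by
      conv_lhs => rw [G.as_sum]
      rw [map_sum, map_sum, LinearMap.sum_apply]
    rw [homogeneousComponent_apply, map_sum, Finset.sum_mul, Finset.sum_filter, hsum, sym_sum]
    refine Finset.sum_congr rfl fun s hs => ?_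
    obtain ⟨h2, h3⟩ := polyAct_monomial hpos hx w s (coeff s G) rfl
    split_ifs with hd
    · rw [← hd]
      exact h3
    · have : s.degree < G.totalDegree := lt_of_le_of_ne (le_totalDegree hs) hd
      exact ((ordLT_of_mem_reg h2).mono this).sym_eq_zero 1 w
  rw [hz0, hG1, add_zero, (OrdLT.zero _ 0).sym_eq_zero 1 w] at h1
  have h2 := (mul_eq_zero.1 h1).resolve_right hsym
  -- Distinct labels make the substitution injective, so the homogeneous component of top degree
  -- vanishes, which is impossible for `G ≠ 0`.
  rw [map_eq_zero_iff _ (rename_injective _ hw)] at h2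
  obtain ⟨s, hs, hd⟩ := Finset.exists_mem_eq_sup G.support (support_nonempty.2 hG)
    (fun s => s.degree)
  have h3 := congrArg (coeff s) h2
  have hd' : s.degree = G.totalDegree := hd.symm
  rw [coeff_homogeneousComponent, if_pos hd', coeff_zero] at h3
  exact mem_support_iff.1 hs h3

open MvPolynomial in
theorem rename_val_mem {a : ℕ} (P : MvPolynomial (Fin a) ℂ) :
    rename Fin.val P ∈ Algebra.adjoin ℂ (X '' {i | i < a} : Set (MvPolynomial ℕ ℂ)) := by
  induction P using MvPolynomial.induction_on with
  | C c => rw [rename_C]; exact Subalgebra.algebraMap_mem _ c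
  | add p q hp hq => rw [map_add]; exact add_mem hp hq
  | mul_X p i hp =>
    rw [map_mul, rename_X]
    exact mul_mem hp (Algebra.subset_adjoin ⟨i, i.2, rfl⟩)

theorem rotAll_polyAct {m n : ℕ} (P : MvPolynomial (Fin n) ℂ) (x : Mor m n) :
    rotAll m n (polyAct m n (MvPolynomial.rename Fin.val P) x) =
      polyAct 0 (bent m n) (MvPolynomial.rename Fin.val P) (rotAll m n x) := by
  have := polyAct_intertwine (rotAll m n) MvPolynomial.X (s := {i | i < n})
    (fun i hi x => by rw [polyAct_X]; exact rotAll_dotAt hi x) (rename_val_mem P) x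
  rwa [MvPolynomial.bind₁_X_left] at this

end Mor
end Standard

theorem dot_eq {a : ℕ} (i : Fin a) : dot i = Mor.dotAt i (Mor.one a) := by
  have := dotPoly_eq (MvPolynomial.X i)
  rwa [dotPoly_X, MvPolynomial.rename_X, Mor.polyAct_X] at this

theorem dot_mul {a : ℕ} (i : Fin a) (z : sVW a) : dot i * z = Mor.dotAt (i : ℕ) z := by
  change Mor.comp (dot i) z = _
  rw [dot_eq, Mor.dotAt, ← Mor.act_comp_right, Mor.one_comp]

theorem rotAll_mul_dot {a : ℕ} (i : Fin a) (z : sVW a) : Mor.rotAll a a (z * dot i) =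
    Mor.dotAt (a + a - 1 - i) (Mor.rotAll a a z) + Mor.rotAll a a z := by
  rw [dot_eq]
  exact Mor.rotAll_comp_dotAt i.2 z

theorem dotPoly_mul_dot {a : ℕ} (P : MvPolynomial (Fin a) ℂ) (i : Fin a) :
    dotPoly a P * dot i = dot i * dotPoly a P := by
  rw [← dotPoly_X, ← map_mul, ← map_mul, mul_comm]

open Mor in
/-- The elements that commute with all dots are the polynomials in the dots. -/
theorem exists_eq_dotPoly {a : ℕ} (ha : 0 < a) (z : sVW a) (hz : ∀ i, z * dot i = dot i * z) :
    ∃ P, z = dotPoly a P := by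
  suffices H : ∀ d (z : sVW a), (∀ i, z * dot i = dot i * z) →
      rotAll a a z ∈ regLT (bent a a) d → ∃ P, z = dotPoly a P by
    obtain ⟨d, hd⟩ := exists_mem_reg (rotAll a a z)
    exact H (d + 1) z hz hd
  intro d
  induction d with
  | zero =>
    intro z _ h
    rw [regLT, Submodule.mem_bot, ← map_zero (rotAll a a)] at h
    exact ⟨0, by rw [map_zero]; exact rotAll_injective a a h⟩
  | succ d ih =>
    intro z hz hd
    rw [regLT] at hd
    let v : Word (Fin a) := fun _ => (⟨0, ha⟩, 0)
    let cs := List.finRange a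
    have hlen : cs.length = a := List.length_finRange
    have hN : bent a a = 2 * cs.length := by rw [bent_eq, hlen]; omega
    have hN1 : reg (bent a a) (d + 0) = reg (bent a a) d := rfl
    -- After bending, commuting with the dot `i` compares the dot at the mirror place, plus 1, with
    -- the dot at `i`. In leading symbols the 1 disappears, and the difference of the two label
    -- variables kills the symbol. So the symbol lives on words with mirror symmetric labels, which
    -- are standard.
    have hvanish : ∀ z : sVW a, (∀ i, z * dot i = dot i * z) → rotAll a a z ∈ reg (bent a a) d →
        ∀ w, IsTest v cs w → ¬ IsStd v cs w → sym d (fam (rotAll a a z)) 1 w = 0 := by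
      intro z hz hd w hw hstd
      obtain ⟨i, hi, hne⟩ : ∃ i < a, (w i).1 ≠ (w (a + a - 1 - i)).1 := by
        by_contra! h
        refine hstd (hw.isStd fun i hi => ?_)
        rw [hlen, two_mul]
        exact h i (hlen ▸ hi)
      have h1 := congrArg (rotAll a a) (hz ⟨i, hi⟩)
      rw [rotAll_mul_dot, dot_mul] at h1
      have h2 := h1.trans (rotAll_dotAt hi z)
      have h3 := congrArg (fun x => sym (d + 1) (fam x) 1 w) h2
      have hord : OrdLT (d + 1) _ (fam (rotAll a a z) : ℕ → Op (Fin a)) := ordLT_of_mem_reg hd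
      simp only at h3
      rw [fam_add, sym_add, hord.sym_eq_zero, add_zero,
        sym_fam_dotAt (by rw [bent_eq]; omega) hord, sym_fam_dotAt (by rw [bent_eq]; omega) hord,
        ← sub_eq_zero, ← sub_mul] at h3
      refine (mul_eq_zero.1 h3).resolve_left fun h => hne ?_
      exact (MvPolynomial.X_injective (sub_eq_zero.1 h)).symm
    by_cases hex : ∃ w, IsTest v cs w ∧ IsStd v cs w
    · obtain ⟨w₀, -, hw₀⟩ := hex
      have hlab : ∀ i : Fin a, (w₀ i).1 = i := fun i => by
        rw [(hw₀.apply (i := i) (by rw [hlen]; exact i.2)).1]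
        simp [cs]
      obtain ⟨ε, hε, hN0⟩ := exists_sym_rotAll_one a (w := w₀) (by
        intro i hi
        have := hw₀.apply (i := i) (by rw [hlen]; exact hi)
        rw [this.1, show 2 * a - 1 - i = 2 * cs.length - 1 - i by rw [hlen], this.2]
        rfl)
      -- The bent identity has constant symbol `ε` at `w₀`, so the polynomial `C ε⁻¹ * σ` in the
      -- dots has the same symbol as `z` there. Subtracting it lowers the filtration degree.
      set σ := sym d (fam (rotAll a a z)) 1 w₀ with hσ
      have hP : (MvPolynomial.C ε⁻¹ * σ).IsHomogeneous d := by
        simpa using (MvPolynomial.isHomogeneous_C (Fin a) ε⁻¹).mul (sym_isHomogeneous d _ 1 w₀)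
      obtain ⟨h1, h2⟩ := polyAct_homogeneous (pos := Fin.val) (N := bent a a)
        (fun i => by rw [bent_eq]; omega) (rotAll_one_mem_reg a) w₀ hP
      rw [show (fun i : Fin a => (w₀ (i : ℕ)).1) = id from funext hlab,
        MvPolynomial.rename_id_apply] at h2
      have h3 : rotAll a a (dotPoly a (MvPolynomial.C ε⁻¹ * σ)) = _ :=
        (congrArg _ (dotPoly_eq _)).trans (rotAll_polyAct _ (one a))
      rw [← h3, add_zero] at h1 h2
      have hz' : ∀ i, (z - dotPoly a (MvPolynomial.C ε⁻¹ * σ)) * dot i =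
          dot i * (z - dotPoly a (MvPolynomial.C ε⁻¹ * σ)) := fun i => by
        rw [sub_mul, mul_sub, hz, dotPoly_mul_dot]
      have h4 : rotAll a a (z - dotPoly a (MvPolynomial.C ε⁻¹ * σ)) =
          rotAll a a z + (-1 : ℂ) • rotAll a a (dotPoly a (MvPolynomial.C ε⁻¹ * σ)) := by
        rw [neg_one_smul, ← sub_eq_add_neg]
        exact map_sub _ _ _
      have hd' : rotAll a a (z - dotPoly a (MvPolynomial.C ε⁻¹ * σ)) ∈ reg (bent a a) d := by
        rw [h4]
        exact add_mem hd (Submodule.smul_mem _ _ h1)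
      obtain ⟨P, hP'⟩ := ih _ hz' (by
        refine mem_regLT_of_sym_eq_zero (v := v) (List.nodup_finRange a) hN hd' fun w hw => ?_
        by_cases hs : IsStd v cs w
        · obtain rfl := hs.unique hw₀
          rw [h4, fam_add, fam_smul, sym_add, sym_smul, h2, hN0, mul_comm, ← mul_assoc, ← map_mul,
            mul_inv_cancel₀ hε, map_one, one_mul, ← hσ, neg_one_smul, add_neg_cancel]
        · exact hvanish _ hz' hd' w hw hs)
      exact ⟨P + MvPolynomial.C ε⁻¹ * σ, by rw [map_add, ← hP', sub_add_cancel]⟩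
    · push Not at hex
      exact ih z hz (mem_regLT_of_sym_eq_zero (v := v) (List.nodup_finRange a) hN hd
        fun w hw => hvanish z hz hd w hw (hex w hw))

end AffineVW

namespace AffineVW
namespace Mor

/-! ### Morphisms without dots -/

/-- Dots of number at most `d` applied to morphisms without dots. -/
def dotted (N : ℕ) : ℕ → Submodule ℂ (Mor 0 N)
  | 0 => reg N 0
  | d + 1 => dotted N d ⊔ ⨆ i : Fin N, (dotted N d).map (dotAt (i : ℕ))

theorem dotted_le_reg (N d : ℕ) : dotted N d ≤ reg N d := by
  induction d with
  | zero => exact le_rfl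
  | succ d ih =>
    refine sup_le (ih.trans (reg_mono (Nat.le_succ d))) (iSup_le fun i => ?_)
    rintro _ ⟨x, hx, rfl⟩
    exact act_y_mem_reg i.2 (ih hx)

theorem dotAt_mem_dotted {N d i : ℕ} (hi : i < N) {x : Mor 0 N} (hx : x ∈ dotted N d) :
    dotAt i x ∈ dotted N (d + 1) :=
  Submodule.mem_sup_right (Submodule.mem_iSup_of_mem (⟨i, hi⟩ : Fin N) ⟨x, hx, rfl⟩)

/-- All dots can be moved to the target end, up to terms with fewer dots. A polynomial in the dots
therefore acts by zero as soon as it kills the undotted morphisms, `polyAct_eq_zero`. -/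
theorem reg_le_dotted (d N : ℕ) : reg N d ≤ dotted N d := by
  induction d generalizing N with
  | zero => exact le_rfl
  | succ d ihd =>
  induction N using Nat.twoStepInduction with
  | zero => exact (ihd 0).trans le_sup_left
  | one => exact (ihd 1).trans le_sup_left
  | more N ih _ =>
    have low : reg (N + 2) d ≤ dotted (N + 2) (d + 1) := (ihd _).trans le_sup_left
    refine reg_induction fun t e j h1 h2 r hr => ?_
    rcases t with _ | t
    · rcases Nat.lt_or_ge d e with he | he
      · obtain rfl : e = d + 1 := by omega
        have hr' := ih hr
        suffices dotted N (d + 1) ≤ (dotted (N + 2) (d + 1)).comap (arc j) from this hr'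
        refine sup_le (fun x hx => low (arc_mem_reg h2 (dotted_le_reg N d hx)))
          (iSup_le fun i => ?_)
        rintro _ ⟨x, hx, rfl⟩
        rw [Submodule.mem_comap]
        have hi := i.2
        have hx' := dotted_le_reg N d hx
        have hU : arc j x ∈ dotted (N + 2) d := ihd _ (arc_mem_reg h2 hx')
        rcases Nat.lt_or_ge (i : ℕ) j with hij | hij
        · have := sub_mem (dotAt_mem_dotted (i := i + 1) (by omega) hU)
            (low (dotAt_arc_mid (regClosed d) hij h2 hx'))
          rwa [sub_sub_cancel] at this
        · rw [← dotAt_arc_right hij hi]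
          exact dotAt_mem_dotted (by omega) hU
      · exact low (arc_mem_reg h2 (reg_mono he hr))
    · rw [pow_succ', Module.End.mul_apply]
      exact dotAt_mem_dotted (by omega) (ihd _ (mem_reg (by omega) h2 hr))

theorem polyAct_dotAt {M N i : ℕ} (P : MvPolynomial ℕ ℂ) (x : Mor M N) :
    polyAct M N P (dotAt i x) = dotAt i (polyAct M N P x) := by
  rw [← polyAct_X, ← Module.End.mul_apply, ← Module.End.mul_apply, ← map_mul, ← map_mul, mul_comm]

theorem polyAct_eq_zero {N : ℕ} {P : MvPolynomial ℕ ℂ}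
    (h : ∀ x ∈ reg N 0, polyAct 0 N P x = 0) (x : Mor 0 N) : polyAct 0 N P x = 0 := by
  obtain ⟨d, hd⟩ := exists_mem_reg x
  suffices H : ∀ d, dotted N d ≤ LinearMap.ker (polyAct 0 N P) from H d (reg_le_dotted d N hd)
  intro d
  induction d with
  | zero => exact h
  | succ d ih =>
    refine sup_le ih (iSup_le fun i => ?_)
    rintro _ ⟨x, hx, rfl⟩
    rw [LinearMap.mem_ker, polyAct_dotAt, LinearMap.mem_ker.1 (ih hx), map_zero]

/-! ### Reduction of matchings of two blocks of points -/

/-- Nested arc diagrams. -/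
inductive IsNested : (p N : ℕ) → Mor 0 N → Prop
  | zero : IsNested 0 0 (one 0)
  | succ {p N : ℕ} {x : Mor 0 N} (h : IsNested p N x) : IsNested (p + 1) (N + 2) (cup p x)

theorem IsNested.eq_two_mul {p N : ℕ} {x : Mor 0 N} (h : IsNested p N x) : N = 2 * p := by
  induction h with
  | zero => rfl
  | succ _ ih => omega

theorem IsNested.eq {p N : ℕ} {x y : Mor 0 N} (h : IsNested p N x) (h' : IsNested p N y) :
    x = y := by
  induction h with
  | zero => cases h'; rfl
  | succ h ih =>
    cases h' with
    | succ h' => rw [ih h']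

theorem IsNested.act_bs {p N N' : ℕ} {x : Mor 0 N} (h : IsNested p N x) (hN : N' = N + 2) :
    IsNested (p + 1) N' (act p (mk .bs) 0 N N' x) := by
  subst hN
  exact h.succ

theorem isNested_rotAll_one (m : ℕ) : IsNested m (bent m m) (rotAll m m (one m)) := by
  induction m with
  | zero => exact .zero
  | succ m ih =>
    rw [rotAll_one_succ]
    exact ih.act_bs (by rw [bent_eq, bent_eq]; omega)

theorem IsNested.exists_arc {p N : ℕ} {x : Mor 0 N} (h : IsNested p N x) :
    ∃ (ε : ℂ) (z : Mor 0 (N + 2)), IsNested (p + 1) (N + 2) z ∧ arc N x = ε • z := by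
  induction h with
  | zero => exact ⟨1, _, .succ .zero, by rw [one_smul]; rfl⟩
  | @succ p N x h ih =>
    obtain ⟨ε, z, hz, e⟩ := ih
    have := h.eq_two_mul
    refine ⟨-ε, _, hz.succ, ?_⟩
    have h1 := cup_arc_left (p := p) (j := N) (by omega) le_rfl x
    rw [e, map_smul] at h1
    rw [neg_smul, h1, neg_neg]

/-- An induction principle for matchings of a left block of `p` points and a right block of `q`
points. Either some arc has both ends in one block, and crossings inside that block turn it into a
cup of neighbours, or all arcs join the blocks; then `p = q` and crossings inside the blocks make
the diagram nested. -/
theorem reg_zero_le (p q : ℕ) {N : ℕ} (hN : N = p + q) (K : Submodule ℂ (Mor 0 N))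
    (hcross : ∀ i, i + 2 ≤ N → i + 1 ≠ p → ∀ x ∈ K, cross i x ∈ K)
    (hcup : ∀ i N' (x : Mor 0 N'), N' + 2 = N → i ≤ N' → i + 1 ≠ p → x ∈ reg N' 0 →
      act i (mk .bs) 0 N' N x ∈ K)
    (hnest : p = q → ∀ x, IsNested p N x → x ∈ K) : reg N 0 ≤ K := by
  induction p generalizing q N with
  | zero =>
    match N, K with
    | 0, K =>
      rw [reg, Submodule.span_singleton_le_iff_mem]
      exact hnest (by omega) _ .zero
    | 1, K => exact bot_le
    | N + 2, K =>
      refine reg_induction fun t e j h1 h2 r hr => ?_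
      obtain rfl : t = 0 := by omega
      obtain rfl : e = 0 := by omega
      rw [pow_zero, Module.End.one_apply]
      induction j with
      | zero => exact hcup 0 N r rfl (by omega) (by omega) hr
      | succ j ih => exact hcross _ (by omega) (by omega) _ (ih (by omega))
  | succ p ih =>
    match N, K with
    | 0, K => omega
    | 1, K => exact bot_le
    | N + 2, K =>
      refine reg_induction fun t e j h1 h2 r hr => ?_
      obtain rfl : t = 0 := by omega
      obtain rfl : e = 0 := by omega
      rw [pow_zero, Module.End.one_apply]
      rcases Nat.lt_or_ge j p with hj | hj
      · induction j with
        | zero => exact hcup 0 N r rfl (by omega) (by omega) hr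
        | succ j ihj => exact hcross _ (by omega) (by omega) _ (ihj (by omega) (by omega))
      · have hlast : arc N r ∈ K := by
          suffices reg N 0 ≤ K.comap (arc N) from this hr
          refine ih (q - 1) (by omega) _ (fun i hi hip x hx => ?_)
            (fun i N' x hN' hi hip hx => ?_) (fun hpq x hx => ?_)
          · rw [Submodule.mem_comap, ← cross_arc_mid hi le_rfl]
            exact hcross _ (by omega) (by omega) _ hx
          · subst hN'
            have h1 := cup_arc_left (p := i) (j := N') hi le_rfl x
            change arc (N' + 2) (cup i x) ∈ K
            rw [← neg_eq_iff_eq_neg.2 h1]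
            refine neg_mem (hcup (i + 1) (N' + 2) _ rfl (by omega) (by omega) ?_)
            exact arc_mem_reg le_rfl hx
          · obtain ⟨ε, z, hz, e⟩ := hx.exists_arc
            rw [Submodule.mem_comap, e]
            exact Submodule.smul_mem _ _ (hnest (by omega) z hz)
        obtain ⟨k, rfl⟩ : ∃ k, N = j + k := ⟨N - j, by omega⟩
        have : ∀ l ≤ k, arc (j + (k - l)) r ∈ K := by
          intro l hl
          induction l with
          | zero => exact hlast
          | succ l ihl =>
            have := hcross (j + (k - (l + 1)) + 1) (by omega) (by omega) _ (ihl (by omega))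
            rw [show j + (k - l) = j + (k - (l + 1)) + 1 by omega, cross_self_arc (by omega)] at this
            exact this
        have := this k le_rfl
        rwa [Nat.sub_self, add_zero] at this

/-! ### Polynomials in the dots and crossings -/

open MvPolynomial

theorem cross_dotAt_other {M N i k : ℕ} (hi : i + 2 ≤ N) (h : k ≠ i) (h' : k ≠ i + 1)
    (x : Mor M N) : cross i (dotAt k x) = dotAt k (cross i x) := by
  rcases Nat.lt_or_ge k i with hk | hk
  · exact cross_dotAt hk hi x
  · by_cases hkN : k < N
    · exact (dotAt_cross (by omega) hkN x).symm
    · have h0 : ∀ x : Mor M N, dotAt k x = 0 := fun x => act_eq_zero _ (by omega) x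
      rw [h0, h0, map_zero]

theorem dotAt_cup_other {M N i : ℕ} (hi : i ≤ N) (x : Mor M N) :
    polyAct M (N + 2) (X i - X (i + 1) - 1) (cup i x) = 0 := by
  rw [map_sub, map_sub, polyAct_X, polyAct_X, map_one, LinearMap.sub_apply, LinearMap.sub_apply,
    dotAt_succ_cup hi, Module.End.one_apply]
  abel

/-- The polynomial `(X_i - X_{i+1})² - 1`. -/
noncomputable def gap (i : ℕ) : MvPolynomial ℕ ℂ := (X i - X (i + 1)) ^ 2 - 1

/-- Of the two linear factors of `gap i`, the one vanishing at difference 1 kills the cup. -/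
theorem polyAct_gap_mul_cup {M N i : ℕ} (hi : i ≤ N) (g : MvPolynomial ℕ ℂ) (x : Mor M N) :
    polyAct M (N + 2) (gap i * g) (cup i x) = 0 := by
  rw [show gap i * g = (X i - X (i + 1) + 1) * g * (X i - X (i + 1) - 1) by rw [gap]; ring,
    map_mul, Module.End.mul_apply, dotAt_cup_other hi, map_zero]

/-- Exchange of two neighbouring variables. -/
noncomputable def swapHom (i : ℕ) : MvPolynomial ℕ ℂ →ₐ[ℂ] MvPolynomial ℕ ℂ :=
  rename (Equiv.swap i (i + 1))

theorem swapHom_X_self (i : ℕ) : swapHom i (X i) = X (i + 1) := by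
  simp [swapHom]

theorem swapHom_X_succ (i : ℕ) : swapHom i (X (i + 1)) = X i := by
  simp [swapHom]

theorem swapHom_X_other {i k : ℕ} (h : k ≠ i) (h' : k ≠ i + 1) : swapHom i (X k) = X k := by
  simp [swapHom, Equiv.swap_apply_of_ne_of_ne h h']

/-- Moving a polynomial through a crossing exchanges two variables and creates the divided
difference `r`, as in a degenerate affine Hecke algebra. The additional cup-cap terms are destroyed
by the factor `gap i`. -/
theorem exists_cross_polyAct (M : ℕ) {N i : ℕ} (hi : i ≤ N) (p : MvPolynomial ℕ ℂ) :
    ∃ r, (X i - X (i + 1)) * r = p - swapHom i p ∧ ∀ x : Mor M (N + 2),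
      polyAct M (N + 2) (gap i) (cross i (polyAct M (N + 2) p x)) =
        polyAct M (N + 2) (gap i * swapHom i p) (cross i x) -
          polyAct M (N + 2) (gap i * r) x := by
  induction p using MvPolynomial.induction_on with
  | C c =>
    refine ⟨0, by simp [swapHom], fun x => ?_⟩
    rw [swapHom, rename_C, polyAct_C, map_smul, map_smul, mul_zero, map_zero, mul_comm, map_mul,
      Module.End.mul_apply, polyAct_C, LinearMap.zero_apply, sub_zero]
  | add p q hp hq =>
    obtain ⟨r, h1, h2⟩ := hp
    obtain ⟨r', h1', h2'⟩ := hq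
    refine ⟨r + r', by rw [mul_add, h1, h1', map_add]; ring, fun x => ?_⟩
    simp only [map_add, mul_add, LinearMap.add_apply, h2, h2']
    abel
  | mul_X p k hp =>
    obtain ⟨r, h1, h2⟩ := hp
    have hE : ∀ (q : MvPolynomial ℕ ℂ) (x : Mor M (N + 2)),
        polyAct M (N + 2) (gap i * q) (cup i (cap i x)) = 0 :=
      fun q x => polyAct_gap_mul_cup hi q _
    have hmul : ∀ (q : MvPolynomial ℕ ℂ) (k : ℕ) (x : Mor M (N + 2)),
        polyAct M (N + 2) q (dotAt k x) = polyAct M (N + 2) (q * X k) x := fun q k x => by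
      rw [map_mul, polyAct_X, Module.End.mul_apply]
    rcases eq_or_ne k i with rfl | hk
    · refine ⟨swapHom k p + r * X k, ?_, fun x => ?_⟩
      · rw [map_mul, swapHom_X_self]
        linear_combination X k * h1
      · rw [← hmul, h2, cross_dotAt_self hi, map_sub, map_sub, hE, hmul, hmul, map_mul (swapHom k),
          swapHom_X_self, mul_add, map_add, LinearMap.add_apply, mul_assoc, mul_assoc]
        abel
    rcases eq_or_ne k (i + 1) with rfl | hk'
    · refine ⟨-swapHom i p + r * X (i + 1), ?_, fun x => ?_⟩
      · rw [map_mul, swapHom_X_succ]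
        linear_combination X (i + 1) * h1
      · rw [← hmul, h2, cross_dotAt_succ hi, map_sub, map_add, hE, hmul, hmul, map_mul (swapHom i),
          swapHom_X_succ, mul_add, map_add, LinearMap.add_apply, mul_assoc, mul_assoc, mul_neg,
          map_neg, LinearMap.neg_apply]
        abel
    · refine ⟨r * X k, ?_, fun x => ?_⟩
      · rw [map_mul, swapHom_X_other hk hk']
        linear_combination X k * h1
      · rw [← hmul, h2, cross_dotAt_other (by omega) hk hk', hmul, hmul, map_mul (swapHom i),
          swapHom_X_other hk hk', mul_assoc, mul_assoc]

theorem X_sub_X_ne_zero (i : ℕ) : (X i - X (i + 1) : MvPolynomial ℕ ℂ) ≠ 0 := fun h =>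
  absurd (X_injective (sub_eq_zero.1 h)) (by omega)

/-- In the difference of the two dots the cup-cap terms cancel: it anticommutes with the crossing up
to the constant -2. Its square therefore commutes with the crossing. -/
theorem cross_gap {M N i : ℕ} (hi : i ≤ N) (x : Mor M (N + 2)) :
    cross i (polyAct M (N + 2) (gap i) x) = polyAct M (N + 2) (gap i) (cross i x) := by
  have h : ∀ x : Mor M (N + 2), cross i (polyAct M (N + 2) (X i - X (i + 1)) x) =
      -polyAct M (N + 2) (X i - X (i + 1)) (cross i x) - (2 : ℂ) • x := by
    intro x
    simp only [map_sub, polyAct_X, LinearMap.sub_apply]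
    rw [cross_dotAt_self hi, cross_dotAt_succ hi, two_smul]
    abel
  rw [gap, sq, map_sub, map_mul, map_one, LinearMap.sub_apply, LinearMap.sub_apply,
    Module.End.mul_apply, Module.End.mul_apply, map_sub, h, h, map_sub, map_neg, map_smul,
    Module.End.one_apply, Module.End.one_apply]
  abel

theorem cross_polyAct_gap_mul {M N i : ℕ} (hi : i ≤ N) {g : MvPolynomial ℕ ℂ}
    (hg : swapHom i g = g) (x : Mor M (N + 2)) :
    cross i (polyAct M (N + 2) (gap i * g) x) = polyAct M (N + 2) (gap i * g) (cross i x) := by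
  obtain ⟨r, h1, h2⟩ := exists_cross_polyAct M hi g
  rw [hg, sub_self] at h1
  have hr : r = 0 := (mul_eq_zero.1 h1).resolve_left (X_sub_X_ne_zero i)
  rw [map_mul, Module.End.mul_apply, cross_gap hi, h2, hg, hr, mul_zero, map_zero,
    LinearMap.zero_apply, sub_zero, map_mul]

/-- Polynomials in the variables `X_0, …, X_{n-1}` divisible by all `(X_i - X_{i+1})² - 1` with
symmetric quotient. -/
structure IsGood (n : ℕ) (Q : MvPolynomial ℕ ℂ) : Prop where
  mem : Q ∈ Algebra.adjoin ℂ (X '' {i | i < n} : Set (MvPolynomial ℕ ℂ))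
  exists_eq : ∀ i, i + 1 < n → ∃ g, Q = gap i * g ∧ swapHom i g = g

theorem IsGood.shift {n : ℕ} {Q : MvPolynomial ℕ ℂ} (h : IsGood n Q) (p i : ℕ) (hi : i + 1 < n) :
    ∃ g, rename (p + ·) Q = gap (p + i) * g ∧ swapHom (p + i) g = g := by
  obtain ⟨g, h1, h2⟩ := h.exists_eq i hi
  refine ⟨rename (p + ·) g, ?_, ?_⟩
  · rw [h1, map_mul]
    congr 1
    simp [gap, add_assoc]
  · conv_rhs => rw [← h2]
    rw [swapHom, swapHom, rename_rename, rename_rename]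
    congr 1
    have : ((Equiv.swap (p + i) (p + i + 1)) ∘ (p + ·)) = ((p + ·) ∘ Equiv.swap i (i + 1)) := by
      funext k
      simp only [Function.comp_apply, Equiv.swap_apply_def]
      split_ifs <;> omega
    rw [this]

/-- A polynomial in the dots of a block commutes with morphisms away from that block. -/
theorem polyAct_shift_comm {M N N' n p p' : ℕ} (φ : Mor M N →ₗ[ℂ] Mor M N')
    (h : ∀ i < n, ∀ x, φ (dotAt (p + i) x) = dotAt (p' + i) (φ x)) {Q : MvPolynomial ℕ ℂ}
    (hQ : Q ∈ Algebra.adjoin ℂ (X '' {i | i < n} : Set (MvPolynomial ℕ ℂ))) (x : Mor M N) :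
    φ (polyAct M N (rename (p + ·) Q) x) = polyAct M N' (rename (p' + ·) Q) (φ x) := by
  induction hQ using Algebra.adjoin_induction generalizing x with
  | mem P hP =>
    obtain ⟨i, hi, rfl⟩ := hP
    rw [rename_X, rename_X, polyAct_X, polyAct_X, h i hi]
  | algebraMap c => simp [Module.algebraMap_end_apply]
  | add P Q _ _ ihP ihQ => simp only [map_add, LinearMap.add_apply, ihP, ihQ]
  | mul P Q _ _ ihP ihQ => simp only [map_mul, Module.End.mul_apply, ihP, ihQ]

theorem IsGood.cross_comm {n p N : ℕ} {Q : MvPolynomial ℕ ℂ} (h : IsGood n Q) (hN : p + n ≤ N)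
    {i : ℕ} (hi : i + 2 ≤ N) (hip : i + 1 ≠ p) (hin : i + 1 ≠ p + n) {M : ℕ} (x : Mor M N) :
    cross i (polyAct M N (rename (p + ·) Q) x) = polyAct M N (rename (p + ·) Q) (cross i x) := by
  obtain ⟨N, rfl⟩ : ∃ k, N = k + 2 := ⟨N - 2, by omega⟩
  by_cases hin' : p ≤ i ∧ i + 1 < p + n
  · obtain ⟨k, rfl⟩ := Nat.exists_eq_add_of_le hin'.1
    obtain ⟨g, hg, hs⟩ := h.shift p k (by omega)
    rw [hg, cross_polyAct_gap_mul (by omega) hs]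
  · exact polyAct_shift_comm (cross i)
      (fun k hk x => cross_dotAt_other (by omega) (by omega) (by omega) x) h.mem x

theorem IsGood.cup_eq_zero {n p N : ℕ} {Q : MvPolynomial ℕ ℂ} (h : IsGood n Q)
    {i : ℕ} (hi : i ≤ N) (hip : p ≤ i) (hin : i + 1 < p + n) {M : ℕ} (x : Mor M N) :
    polyAct M (N + 2) (rename (p + ·) Q) (cup i x) = 0 := by
  obtain ⟨k, rfl⟩ := Nat.exists_eq_add_of_le hip
  obtain ⟨g, hg, hs⟩ := h.shift p k (by omega)
  rw [hg, polyAct_gap_mul_cup hi]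

/-- If the right block is larger, some arc has both ends in it, and a good polynomial kills such an
arc. Cups inside the left block are stripped off by induction on `p`. -/
theorem IsGood.right_eq_zero {p q N : ℕ} (hpq : p < q) (hN : N = p + q) {Q : MvPolynomial ℕ ℂ}
    (h : IsGood q Q) {x : Mor 0 N} (hx : x ∈ reg N 0) :
    polyAct 0 N (rename (p + ·) Q) x = 0 := by
  induction p using Nat.strong_induction_on generalizing N with
  | _ p ih =>
    suffices reg N 0 ≤ LinearMap.ker (polyAct 0 N (rename (p + ·) Q)) from this hx
    refine reg_zero_le p q hN _ (fun i hi hip y hy => ?_) (fun i N' y hN' hi hip hy => ?_)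
      (fun h => by omega)
    · rw [LinearMap.mem_ker] at hy ⊢
      rw [← h.cross_comm (by omega) hi hip (by omega), hy, map_zero]
    · rw [LinearMap.mem_ker]
      subst hN'
      change polyAct 0 (N' + 2) _ (cup i y) = 0
      rcases Nat.lt_or_ge i p with hlt | hge
      · obtain ⟨p, rfl⟩ : ∃ k, p = k + 2 := ⟨p - 2, by omega⟩
        rw [← polyAct_shift_comm (p := p) (cup i) (fun k hk y => ?_) h.mem,
          ih p (by omega) (by omega) (by omega) hy, map_zero]
        rw [← dotAt_cup_far (by omega) (by omega), add_right_comm]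
      · exact h.cup_eq_zero hi hge (by omega) y

theorem IsGood.left_eq_zero {p q N : ℕ} (hpq : q < p) (hN : N = p + q) {Q : MvPolynomial ℕ ℂ}
    (h : IsGood p Q) {x : Mor 0 N} (hx : x ∈ reg N 0) :
    polyAct 0 N (rename (0 + ·) Q) x = 0 := by
  induction q using Nat.strong_induction_on generalizing N with
  | _ q ih =>
    suffices reg N 0 ≤ LinearMap.ker (polyAct 0 N (rename (0 + ·) Q)) from this hx
    refine reg_zero_le p q hN _ (fun i hi hip y hy => ?_) (fun i N' y hN' hi hip hy => ?_)
      (fun h => by omega)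
    · rw [LinearMap.mem_ker] at hy ⊢
      rw [← h.cross_comm (by omega) hi (by omega) (by omega), hy, map_zero]
    · rw [LinearMap.mem_ker]
      subst hN'
      change polyAct 0 (N' + 2) _ (cup i y) = 0
      rcases Nat.lt_or_ge i p with hlt | hge
      · exact h.cup_eq_zero hi (by omega) (by omega) y
      · rw [← polyAct_shift_comm (p := 0) (cup i) (fun k hk y => ?_) h.mem,
          ih (q - 2) (by omega) (by omega) (by omega) hy, map_zero]
        exact cup_dotAt_far (by omega) hi y

/-- Good polynomials in the two halves of the points agree if they agree on nested diagrams. -/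
theorem IsGood.balanced {a N : ℕ} (hN : N = a + a) {Q Q' : MvPolynomial ℕ ℂ} (h : IsGood a Q)
    (h' : IsGood a Q') (hnest : ∀ x, IsNested a N x →
      polyAct 0 N (rename (0 + ·) Q) x = polyAct 0 N (rename (a + ·) Q') x) (x : Mor 0 N) :
    polyAct 0 N (rename (0 + ·) Q) x = polyAct 0 N (rename (a + ·) Q') x := by
  rw [← sub_eq_zero, ← LinearMap.sub_apply, ← map_sub]
  refine polyAct_eq_zero (fun x hx => ?_) x
  rw [map_sub, LinearMap.sub_apply, sub_eq_zero]
  suffices reg N 0 ≤ LinearMap.eqLocus (polyAct 0 N (rename (0 + ·) Q))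
    (polyAct 0 N (rename (a + ·) Q')) from this hx
  refine reg_zero_le a a hN _ (fun i hi hip y hy => ?_) (fun i N' y hN' hi hip hy => ?_)
    (fun _ => hnest)
  · rw [LinearMap.mem_eqLocus] at hy ⊢
    rw [← h.cross_comm (by omega) hi (by omega) (by omega), hy,
      h'.cross_comm (by omega) hi (by omega) (by omega)]
  · rw [LinearMap.mem_eqLocus]
    subst hN'
    change polyAct 0 (N' + 2) _ (cup i y) = polyAct 0 (N' + 2) _ (cup i y)
    -- A cup inside one block is killed by the polynomial of that block. For the other polynomial
    -- the cup can be pulled off, leaving a block smaller by two opposite a full block, where it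
    -- acts by zero.
    rcases Nat.lt_or_ge i a with hlt | hge
    · rw [h.cup_eq_zero hi (by omega) (by omega)]
      obtain ⟨k, hk⟩ : ∃ k, a = k + 2 := ⟨a - 2, by omega⟩
      rw [← polyAct_shift_comm (p := k) (cup i) (fun l hl y => ?_) h'.mem,
        h'.right_eq_zero (by omega) (by omega) hy, map_zero]
      rw [← dotAt_cup_far (by omega) (by omega), hk, add_right_comm]
    · rw [h'.cup_eq_zero hi (by omega) (by omega),
        ← polyAct_shift_comm (p := 0) (cup i) (fun l hl y => ?_) h.mem,
        h.left_eq_zero (q := a - 2) (by omega) (by omega) hy, map_zero]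
      exact cup_dotAt_far (by omega) hi y

end Mor
end AffineVW

namespace AffineVW

/-! ### The deformed Vandermonde polynomial gives central elements -/

open MvPolynomial

/-- Both the Vandermonde product and its product with `D` have alternating factors, so a permutation
multiplies both by its sign; cancel. -/
theorem deformedVandermonde_isSymmetric (a : ℕ) : (deformedVandermonde a).IsSymmetric := by
  intro σ
  let V : MvPolynomial (Fin a) ℂ := ∏ i : Fin a, ∏ j ∈ Finset.Ioi i, (X i - X j)
  have hV : V ≠ 0 := by
    refine Finset.prod_ne_zero_iff.2 fun i _ => Finset.prod_ne_zero_iff.2 fun j hj => ?_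
    exact fun h => (Finset.mem_Ioi.1 hj).ne (X_injective (sub_eq_zero.1 h))
  have h1 := σ.prod_Ioi_comp_eq_sign_mul_prod
    (f := fun i j => (X i - X j : MvPolynomial (Fin a) ℂ)) (fun i j => by ring)
  have h2 := σ.prod_Ioi_comp_eq_sign_mul_prod
    (f := fun i j => ((X i - X j) * ((X i - X j) ^ 2 - 1) : MvPolynomial (Fin a) ℂ))
    (fun i j => by ring)
  simp only [Finset.prod_mul_distrib] at h2
  rw [h1, mul_assoc] at h2
  have hs : ((Equiv.Perm.sign σ : ℤ) : MvPolynomial (Fin a) ℂ) ≠ 0 := by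
    rcases Int.units_eq_one_or (Equiv.Perm.sign σ) with h | h <;> simp [h]
  have h3 := mul_left_cancel₀ hV (mul_left_cancel₀ hs h2)
  rw [deformedVandermonde, map_prod]
  simp only [map_prod, map_sub, map_pow, rename_X, map_one]
  exact h3

theorem dvd_deformedVandermonde {a : ℕ} {i j : Fin a} (h : i < j) :
    ((X i - X j) ^ 2 - 1) ∣ deformedVandermonde a := by
  have h1 := Finset.dvd_prod_of_mem (fun j => ((X i - X j) ^ 2 - 1 : MvPolynomial (Fin a) ℂ))
    (Finset.mem_Ioi.2 h)
  exact h1.trans (Finset.dvd_prod_of_mem (fun i : Fin a => ∏ j ∈ Finset.Ioi i,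
    ((X i - X j) ^ 2 - 1 : MvPolynomial (Fin a) ℂ)) (Finset.mem_univ i))

theorem deformedVandermonde_ne_zero (a : ℕ) : deformedVandermonde a ≠ 0 := by
  refine Finset.prod_ne_zero_iff.2 fun i _ => Finset.prod_ne_zero_iff.2 fun j _ h => ?_
  have := congrArg (eval 0) h
  simp at this

theorem sq_sub_one_ne_zero {a : ℕ} (i j : Fin a) :
    ((X i - X j) ^ 2 - 1 : MvPolynomial (Fin a) ℂ) ≠ 0 := fun h => by
  have := congrArg (eval 0) h
  simp at this

theorem isGood_rename {a : ℕ} {f : MvPolynomial (Fin a) ℂ} (hf : f.IsSymmetric) :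
    Mor.IsGood a (rename Fin.val (deformedVandermonde a * f)) := by
  refine ⟨Mor.rename_val_mem _, fun i hi => ?_⟩
  let i₀ : Fin a := ⟨i, by omega⟩
  let i₁ : Fin a := ⟨i + 1, hi⟩
  have hlt : i₀ < i₁ := Nat.lt_succ_self i
  obtain ⟨D, hD⟩ := dvd_deformedVandermonde hlt
  have hDs : rename (Equiv.swap i₀ i₁) D = D := by
    have := deformedVandermonde_isSymmetric a (Equiv.swap i₀ i₁)
    rw [hD, map_mul, map_sub, map_pow, map_sub, rename_X, rename_X, map_one,
      Equiv.swap_apply_left, Equiv.swap_apply_right,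
      show (X i₁ - X i₀ : MvPolynomial (Fin a) ℂ) ^ 2 = (X i₀ - X i₁) ^ 2 by ring] at this
    exact mul_left_cancel₀ (sq_sub_one_ne_zero i₀ i₁) this
  refine ⟨rename Fin.val (D * f), ?_, ?_⟩
  · rw [hD, mul_assoc, map_mul]
    congr 1
    simp [Mor.gap, i₀, i₁]
  · have hval : (Equiv.swap i (i + 1)) ∘ Fin.val = Fin.val ∘ Equiv.swap i₀ i₁ := by
      funext k
      simp only [Function.comp_apply, Equiv.swap_apply_def, Fin.ext_iff, i₀, i₁]
      split_ifs <;> rfl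
    rw [Mor.swapHom, rename_rename, hval, ← rename_rename, map_mul, hDs, hf]

/-- The translation of all variables by one. -/
noncomputable def translate (a : ℕ) : MvPolynomial (Fin a) ℂ →ₐ[ℂ] MvPolynomial (Fin a) ℂ :=
  aeval fun i => X i + 1

theorem translate_isSymmetric {a : ℕ} {f : MvPolynomial (Fin a) ℂ} (hf : f.IsSymmetric) :
    (translate a f).IsSymmetric := by
  intro σ
  have h : (rename σ).comp (translate a) = (translate a).comp (rename σ) := by
    ext i
    simp [translate]
  have := DFunLike.congr_fun h f
  simpa [hf σ] using this

theorem translate_deformedVandermonde (a : ℕ) :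
    translate a (deformedVandermonde a) = deformedVandermonde a := by
  simp [translate, deformedVandermonde]

theorem polyAct_comp {M M' N : ℕ} (P : MvPolynomial ℕ ℂ) (x : Mor M N) (z : Mor M' M) :
    Mor.polyAct M' N P (Mor.comp x z) = Mor.comp (Mor.polyAct M N P x) z := by
  simp only [← Mor.compL_apply]
  induction P using MvPolynomial.induction_on generalizing x with
  | C c => simp only [Mor.polyAct_C, map_smul, LinearMap.smul_apply]
  | add p q hp hq => simp only [map_add, LinearMap.add_apply, hp, hq]
  | mul_X p i hp =>
    simp only [map_mul, Mor.polyAct_X, Module.End.mul_apply, ← hp]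
    congr 1
    exact Mor.act_comp_right _ x z

theorem dotPoly_mul {a : ℕ} (P : MvPolynomial (Fin a) ℂ) (z : sVW a) :
    dotPoly a P * z = Mor.polyAct a a (rename Fin.val P) z := by
  change Mor.comp (dotPoly a P) z = _
  rw [dotPoly_eq, ← polyAct_comp, Mor.one_comp]

theorem rotAll_mul_dotPoly {a : ℕ} (P : MvPolynomial (Fin a) ℂ) (z : sVW a) :
    Mor.rotAll a a (z * dotPoly a P) = Mor.polyAct 0 (Mor.bent a a)
      (aeval (fun i : Fin a => (X (a + a - 1 - i) + 1 : MvPolynomial ℕ ℂ)) P)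
        (Mor.rotAll a a z) := by
  induction P using MvPolynomial.induction_on with
  | C c =>
    rw [← algebraMap_eq, AlgHom.commutes, AlgHom.commutes, AlgHom.commutes, ← Algebra.commutes,
      ← Algebra.smul_def, Module.algebraMap_end_apply]
    exact map_smul (Mor.rotAll a a) c z
  | add p q hp hq =>
    simp only [map_add, mul_add, LinearMap.add_apply, ← hp, ← hq]
    exact map_add (Mor.rotAll a a) _ _
  | mul_X p i hp =>
    rw [map_mul (dotPoly a), ← mul_assoc, dotPoly_X, rotAll_mul_dot, hp, mul_comm p, map_mul, aeval_X, map_mul,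
      Module.End.mul_apply, map_add, Mor.polyAct_X, map_one]
    rfl

/-- Bent, left multiplication acts on the left block of points and right multiplication on the right
block, both by good polynomials. By `IsGood.balanced` it suffices to compare them on the bent
identity, that is, to commute with 1. -/
theorem dotPoly_mul_comm {a : ℕ} {f : MvPolynomial (Fin a) ℂ} (hf : f.IsSymmetric) (z : sVW a) :
    dotPoly a (deformedVandermonde a * f) * z = z * dotPoly a (deformedVandermonde a * f) := by
  apply Mor.rotAll_injective a a
  have hsym : (deformedVandermonde a * f).IsSymmetric :=
    (deformedVandermonde_isSymmetric a).mul hf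
  have hL : ∀ z : sVW a, Mor.rotAll a a (dotPoly a (deformedVandermonde a * f) * z) =
      Mor.polyAct 0 (Mor.bent a a) (rename (0 + ·) (rename Fin.val (deformedVandermonde a * f)))
        (Mor.rotAll a a z) := by
    intro z
    rw [dotPoly_mul]
    refine (Mor.rotAll_polyAct _ z).trans ?_
    rw [show (fun x : ℕ => 0 + x) = id from funext zero_add, rename_id_apply]
  have hR : ∀ z : sVW a, Mor.rotAll a a (z * dotPoly a (deformedVandermonde a * f)) =
      Mor.polyAct 0 (Mor.bent a a) (rename (a + ·)
        (rename Fin.val (deformedVandermonde a * translate a f))) (Mor.rotAll a a z) := by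
    intro z
    -- Symmetry of the polynomial undoes the reversal of strands, and the shift by 1 in every
    -- variable becomes `translate`, which fixes the deformed Vandermonde factor.
    rw [rotAll_mul_dotPoly, ← hsym Fin.revPerm, aeval_rename,
      ← translate_deformedVandermonde a, ← map_mul, translate_deformedVandermonde]
    congr 1
    congr 1
    have : (aeval ((fun i : Fin a => (X (a + a - 1 - i) + 1 : MvPolynomial ℕ ℂ)) ∘ Fin.revPerm)) =
        ((rename (a + ·)).comp (rename Fin.val)).comp (translate a) := by
      ext1 i
      simp only [aeval_X, Function.comp_apply, translate, AlgHom.comp_apply, map_add, rename_X,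
        map_one, Fin.revPerm_apply, Fin.val_rev]
      congr 2
      omega
    rw [this]
    rfl
  rw [hL, hR]
  refine Mor.IsGood.balanced (Mor.bent_eq a a) (isGood_rename hf)
    (isGood_rename (translate_isSymmetric hf)) (fun x hx => ?_) _
  rw [hx.eq (Mor.isNested_rotAll_one a)]
  exact (hL 1).symm.trans ((congrArg _ ((mul_one _).trans (one_mul _).symm)).trans (hR 1))

end AffineVW

namespace AffineVW

/-! ### Freeness and symmetry -/

open MvPolynomial

/-- The test word of the identity. -/
def nestWord (b : ℕ) : Word (Fin (b + 2)) := fun n =>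
  if n < b + 2 then (Fin.ofNat (b + 2) n, 0) else (Fin.ofNat (b + 2) (2 * (b + 2) - 1 - n), 1)

theorem nestWord_dual {b i : ℕ} (hi : i < b + 2) :
    nestWord b (2 * (b + 2) - 1 - i) = (nestWord b i).dual := by
  rw [nestWord, nestWord, if_pos hi, if_neg (by omega)]
  congr 2
  omega

theorem nestWord_val {b : ℕ} (i : Fin (b + 2)) : (nestWord b i).1 = i := by
  rw [nestWord, if_pos i.2]
  simp


open Mor

theorem sym_nestWord_ne_zero (b : ℕ) :
    sym 0 (fam (rotAll (b + 2) (b + 2) (one (b + 2)))) 1 (nestWord b) ≠ 0 := by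
  obtain ⟨ε, hε, h⟩ := exists_sym_rotAll_one (b + 2) (w := nestWord b) fun i hi => nestWord_dual hi
  rw [h]
  exact (map_ne_zero_iff _ (C_injective _ _)).2 hε

theorem dotPoly_injective (b : ℕ) : Function.Injective (dotPoly (b + 2)) := by
  refine (injective_iff_map_eq_zero _).2 fun P hP => ?_
  have h1 := congrArg (rotAll (b + 2) (b + 2)) ((dotPoly_eq P).symm.trans hP)
  rw [rotAll_polyAct, map_zero] at h1
  refine eq_zero_of_polyAct_add_eq_zero (pos := Fin.val) (fun i => by rw [bent_eq]; omega)
    (rotAll_one_mem_reg (b + 2)) (w := nestWord b) ?_ (sym_nestWord_ne_zero b) (zero_mem _)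
    ((add_zero _).trans h1)
  simp only [nestWord_val]
  exact fun i j h => h

theorem dotPoly_comm_mor {b : ℕ} {P : MvPolynomial (Fin (b + 2)) ℂ}
    (hP : ∀ z, dotPoly (b + 2) P * z = z * dotPoly (b + 2) P) (z : Mor (b + 2) (b + 2)) :
    polyAct (b + 2) (b + 2) (rename Fin.val P) z =
      comp z (polyAct (b + 2) (b + 2) (rename Fin.val P) (one (b + 2))) := by
  rw [← dotPoly_eq]
  exact (dotPoly_mul P z).symm.trans (hP z)

/-- Compare `P` before and after the crossing by `exists_cross_polyAct`. Centrality leaves `h * r *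
u` dots on the crossing plus `h * r` dots on the identity equal to zero, and the first has the
larger degree; freeness of the dots forces the divided difference `r` to vanish. -/
theorem rename_swap_of_comm {b : ℕ} {P : MvPolynomial (Fin (b + 2)) ℂ}
    (hP : ∀ z, dotPoly (b + 2) P * z = z * dotPoly (b + 2) P) (i : Fin (b + 1)) :
    rename (Equiv.swap i.castSucc i.succ) P = P := by
  obtain ⟨r', h1, h2⟩ := exists_cross_polyAct (b + 2) (N := b) (i := i) (by omega)
    (rename Fin.val P)
  have hval : (Equiv.swap (i : ℕ) (i + 1)) ∘ Fin.val =
      Fin.val ∘ Equiv.swap i.castSucc i.succ := by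
    funext k
    simp only [Function.comp_apply, Equiv.swap_apply_def, Fin.ext_iff, Fin.val_castSucc,
      Fin.val_succ]
    split_ifs <;> rfl
  have hX : (X (i : ℕ) - X ((i : ℕ) + 1) : MvPolynomial ℕ ℂ) =
      rename Fin.val (X i.castSucc - X i.succ : MvPolynomial (Fin (b + 2)) ℂ) := by
    simp
  have hgap : gap i =
      rename Fin.val ((X i.castSucc - X i.succ) ^ 2 - 1 : MvPolynomial (Fin (b + 2)) ℂ) := by
    rw [gap, map_sub, map_pow, map_one, hX]
  have hu : (X i.castSucc - X i.succ : MvPolynomial (Fin (b + 2)) ℂ) ≠ 0 := fun h =>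
    absurd (X_injective (sub_eq_zero.1 h)) (Fin.castSucc_lt_succ (i := i)).ne
  rw [swapHom, rename_rename, hval, ← rename_rename, ← map_sub, hX] at h1
  -- The divided difference involves no variables beyond those of `P`.
  obtain ⟨r, rfl⟩ : ∃ r : MvPolynomial (Fin (b + 2)) ℂ, r' = rename Fin.val r := by
    refine ⟨killCompl Fin.val_injective r', ?_⟩
    have h3 := congrArg (killCompl (Fin.val_injective (n := b + 2))) h1
    rw [map_mul, killCompl_rename_app, killCompl_rename_app] at h3
    rw [← h3, map_mul] at h1
    refine mul_left_cancel₀ ?_ h1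
    rwa [Ne, map_eq_zero_iff _ (rename_injective _ Fin.val_injective)]
  rw [← map_mul, (rename_injective _ Fin.val_injective).eq_iff] at h1
  suffices hr : r = 0 by
    rw [hr, mul_zero] at h1
    exact (sub_eq_zero.1 h1.symm).symm
  by_contra hr
  set u : MvPolynomial (Fin (b + 2)) ℂ := X i.castSucc - X i.succ with hu'
  set h : MvPolynomial (Fin (b + 2)) ℂ := u ^ 2 - 1 with hh
  have hh0 : h ≠ 0 := sq_sub_one_ne_zero _ _
  have key : polyAct (b + 2) (b + 2) (rename Fin.val (h * r * u)) (cross i (one (b + 2))) +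
      polyAct (b + 2) (b + 2) (rename Fin.val (h * r)) (one (b + 2)) = 0 := by
    have h3 := h2 (one (b + 2))
    have h4 := dotPoly_comm_mor hP (cross i (one (b + 2)))
    rw [cross, ← act_comp_right, one_comp] at h4
    change _ = cross i _ at h4
    change polyAct _ _ _ (cross i (one (b + 2))) = _ at h4
    rw [← h4, swapHom, rename_rename, hval, ← rename_rename, ← Module.End.mul_apply, ← map_mul,
      hgap, ← map_mul, ← map_mul, ← map_mul] at h3
    rw [show h * r * u = h * P - h * rename (Equiv.swap i.castSucc i.succ) P by
      rw [← mul_sub, ← h1]; ring, map_sub, map_sub, LinearMap.sub_apply, h3]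
    abel
  have h5 := congrArg (rotAll (b + 2) (b + 2)) key
  rw [map_add, rotAll_polyAct, rotAll_polyAct, map_zero] at h5
  have hcross : rotAll (b + 2) (b + 2) (cross i (one (b + 2))) =
      cross i (rotAll (b + 2) (b + 2) (one (b + 2))) :=
    rotAll_act (mk .s) (by omega) rfl _
  have hmem := rotAll_one_mem_reg (b + 2)
  have hdeg : (h * r * u).totalDegree = (h * r).totalDegree + 1 := by
    rw [totalDegree_mul_of_isDomain (mul_ne_zero hh0 hr) hu]
    congr 1
    refine IsHomogeneous.totalDegree ?_ hu
    exact (isHomogeneous_X _ _).sub (isHomogeneous_X _ _)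
  -- The test word of the crossing is that of the identity with two neighbouring letters exchanged.
  refine mul_ne_zero (mul_ne_zero hh0 hr) hu (eq_zero_of_polyAct_add_eq_zero (pos := Fin.val)
    (w := (nestWord b).swapAt i) (fun i => by rw [bent_eq]; omega) ?_ ?_ ?_ ?_ h5)
  · rw [hcross]
    exact (regClosed 0 _).cross i (by rw [bent_eq]; omega) _ hmem
  · intro k l hkl
    have hlab : ∀ k : Fin (b + 2), ((nestWord b).swapAt i k).1 =
        Equiv.swap i.castSucc i.succ k := by
      intro k
      rw [Equiv.swap_apply_def]
      simp only [Word.swapAt, Fin.ext_iff, Fin.val_castSucc, Fin.val_succ]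
      split_ifs
      · exact congrArg Fin.val (nestWord_val i.succ)
      · exact congrArg Fin.val (nestWord_val i.castSucc)
      · exact congrArg Fin.val (nestWord_val k)
    simp only [hlab] at hkl
    exact (Equiv.swap i.castSucc i.succ).injective hkl
  · rw [hcross, fam_cross (by rw [bent_eq]; omega), sym_opS_mul, Word.swapAt_swapAt]
    exact smul_ne_zero (sgn_ne_zero _ _) (sym_nestWord_ne_zero b)
  · rw [hdeg]
    exact polyAct_mem_reg (fun i => by rw [bent_eq]; omega) hmem le_rfl

theorem isSymmetric_of_comm {b : ℕ} {P : MvPolynomial (Fin (b + 2)) ℂ}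
    (hP : ∀ z, dotPoly (b + 2) P * z = z * dotPoly (b + 2) P) : P.IsSymmetric := by
  intro σ
  have hσ : σ ∈ Submonoid.closure
      (Set.range fun i : Fin (b + 1) => Equiv.swap i.castSucc i.succ) := by
    rw [Equiv.Perm.mclosure_swap_castSucc_succ]
    trivial
  induction hσ using Submonoid.closure_induction with
  | mem σ h =>
    obtain ⟨i, rfl⟩ := h
    exact rename_swap_of_comm hP i
  | one => exact rename_id_apply P
  | mul σ τ _ _ h h' =>
    rw [Equiv.Perm.coe_mul, ← rename_rename, h', h]

end AffineVW

namespace AffineVW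

/-! ### The cap-cup morphism -/

open MvPolynomial Mor

theorem Mor.polyAct_aeval_congr {κ : Type} {M N : ℕ} {g g' : κ → MvPolynomial ℕ ℂ} {x : Mor M N}
    (h : ∀ i, polyAct M N (g i) x = polyAct M N (g' i) x) (P : MvPolynomial κ ℂ) :
    polyAct M N (aeval g P) x = polyAct M N (aeval g' P) x := by
  induction P using MvPolynomial.induction_on with
  | C c => rw [← algebraMap_eq, AlgHom.commutes (aeval g), AlgHom.commutes (aeval g')]
  | add p q hp hq => simp only [map_add, LinearMap.add_apply, hp, hq]
  | mul_X p i hp =>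
    rw [map_mul (aeval g), map_mul (aeval g'), aeval_X, aeval_X, map_mul, Module.End.mul_apply, h,
      ← Module.End.mul_apply, ← map_mul, mul_comm, map_mul, Module.End.mul_apply, hp,
      ← Module.End.mul_apply, ← map_mul, mul_comm]

theorem Mor.polyAct_rename_aeval {κ κ' : Type} {M N : ℕ} {pos : κ' → ℕ} {g : κ → MvPolynomial κ' ℂ}
    {g' : κ → MvPolynomial ℕ ℂ} {x : Mor M N}
    (h : ∀ i, polyAct M N (rename pos (g i)) x = polyAct M N (g' i) x) (P : MvPolynomial κ ℂ) :
    polyAct M N (rename pos (aeval g P)) x = polyAct M N (aeval g' P) x := by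
  rw [← polyAct_aeval_congr h, ← comp_aeval_apply]

/-- The cap on the first two strands followed by the cup. -/
noncomputable def capCup (b : ℕ) : sVW (b + 2) := cup 0 (cap 0 (one (b + 2)))

theorem rotAll_capCup (b : ℕ) : rotAll (b + 2) (b + 2) (capCup b) =
    act 0 (mk .bs) 0 (bent (b + 2) b) (bent (b + 2) (b + 2))
      (act 0 (mk .b) 0 (bent (b + 2) (b + 2)) (bent (b + 2) b)
        (rotAll (b + 2) (b + 2) (one (b + 2)))) := by
  refine (rotAll_act (mk .bs) (by omega) (by omega) _).trans ?_
  congr 1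
  exact rotAll_act (mk .b) (by omega) (by omega) _

theorem Mor.act_b_mem_reg {p N N' d : ℕ} (h : N = N' + 2) (hp : p ≤ N') {x : Mor 0 N}
    (hx : x ∈ reg N d) : act p (mk .b) 0 N N' x ∈ reg N' d := by
  subst h
  exact (regClosed d _).cap p N' rfl hp x hx

theorem rotAll_capCup_mem_reg (b : ℕ) :
    rotAll (b + 2) (b + 2) (capCup b) ∈ reg (bent (b + 2) (b + 2)) 0 := by
  rw [rotAll_capCup]
  refine act_bs_mem_reg (by simp only [bent_eq]; omega) (Nat.zero_le _) ?_
  exact act_b_mem_reg (by simp only [bent_eq]; omega) (Nat.zero_le _) (rotAll_one_mem_reg _)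

theorem capCup_mul_dot {b : ℕ} (k : Fin (b + 2)) (hk : 2 ≤ (k : ℕ)) :
    capCup b * dot k = dot k * capCup b := by
  obtain ⟨l, hl⟩ : ∃ l, (k : ℕ) = l + 2 := ⟨k - 2, by omega⟩
  have h1 : capCup b * dot k = cup 0 (cap 0 (dotAt k (one (b + 2)))) := by
    rw [dot_eq]
    change comp (cup 0 (cap 0 (one (b + 2)))) _ = _
    rw [cup, cap, ← act_comp_right, ← act_comp_right, one_comp]
  rw [h1, dot_mul, hl, ← dotAt_cap_far (Nat.zero_le _) (by omega),
    ← dotAt_cup_far (Nat.zero_le _) (by omega)]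
  rfl

theorem capCup_mul_dot_one (b : ℕ) :
    capCup b * dot 1 = capCup b * dot 0 + capCup b := by
  have h1 : ∀ k : Fin (b + 2), capCup b * dot k = cup 0 (cap 0 (dotAt k (one (b + 2)))) := by
    intro k
    rw [dot_eq]
    change comp (cup 0 (cap 0 (one (b + 2)))) _ = _
    rw [cup, cap, ← act_comp_right, ← act_comp_right, one_comp]
  rw [h1, h1]
  change cup 0 (cap 0 (dotAt (0 + 1) (one (b + 2)))) = _
  rw [cap_dotAt_succ (Nat.zero_le _), map_add]
  rfl

section CapCup

variable (b : ℕ)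

theorem dotAt_rotAll_capCup {k : ℕ} (hk : 2 ≤ k) (hk' : k < b + 2) :
    dotAt (b + 2 + (b + 2) - 1 - k) (rotAll (b + 2) (b + 2) (capCup b)) +
      rotAll (b + 2) (b + 2) (capCup b) = dotAt k (rotAll (b + 2) (b + 2) (capCup b)) := by
  have h1 := congrArg (rotAll (b + 2) (b + 2)) (capCup_mul_dot (b := b) ⟨k, hk'⟩ hk)
  rw [rotAll_mul_dot, dot_mul] at h1
  exact h1.trans (rotAll_dotAt hk' _)

theorem dotAt_last_rotAll_capCup :
    dotAt (2 * b + 2) (rotAll (b + 2) (b + 2) (capCup b)) =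
      dotAt (2 * b + 3) (rotAll (b + 2) (b + 2) (capCup b)) +
        rotAll (b + 2) (b + 2) (capCup b) := by
  have h1 := congrArg (rotAll (b + 2) (b + 2)) (capCup_mul_dot_one b)
  have h2 : rotAll (b + 2) (b + 2) (capCup b * dot 0 + capCup b) =
      rotAll (b + 2) (b + 2) (capCup b * dot 0) + rotAll (b + 2) (b + 2) (capCup b) :=
    map_add _ _ _
  rw [h2, rotAll_mul_dot, rotAll_mul_dot] at h1
  have h3 := add_right_cancel h1
  simp only [Fin.val_zero, Fin.val_one] at h3
  rwa [show b + 2 + (b + 2) - 1 - 1 = 2 * b + 2 by omega,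
    show b + 2 + (b + 2) - 1 - 0 = 2 * b + 3 by omega] at h3

theorem dotAt_one_rotAll_capCup :
    dotAt 1 (rotAll (b + 2) (b + 2) (capCup b)) =
      dotAt 0 (rotAll (b + 2) (b + 2) (capCup b)) - rotAll (b + 2) (b + 2) (capCup b) := by
  have h1 := dotAt_succ_cup (i := 0) (Nat.zero_le _) (cap 0 (one (b + 2)))
  have h2 := congrArg (rotAll (b + 2) (b + 2)) h1
  rw [map_sub] at h2
  exact (rotAll_dotAt (by omega) _).symm.trans (h2.trans
    (congrArg (· - rotAll (b + 2) (b + 2) (capCup b)) (rotAll_dotAt (by omega) _)))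

/-- The test word of the cap-cup morphism. -/
def capCupWord : Word (Fin (b + 2)) := fun n =>
  if n = 0 then (0, 0) else if n = 1 then (0, 1) else if n = 2 * b + 2 then (1, 0)
  else if n = 2 * b + 3 then (1, 1) else nestWord b n

theorem Mor.sym_cup_cap {ι : Type} [Fintype ι] [DecidableEq ι] {N N' : ℕ} (h : N = N' + 2)
    (x : Mor 0 N) {w : Word ι} (hw : w 1 = (w 0).dual) :
    sym 0 (fam (act 0 (mk .bs) 0 N' N (act 0 (mk .b) 0 N N' x))) 1 w =
      sgn 1 (w 0).2 • ∑ c : Letter ι,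
        sym 0 (fam x) 1 (Word.cons c (Word.cons c.dual w.tail.tail)) := by
  have h1 : (rep ι 0 (act 0 (mk .bs) 0 N' N (act 0 (mk .b) 0 N N' x)) 1 w : ℂ) =
      sgn 1 (w 0).2 * ∑ c : Letter ι,
        rep ι 0 x 1 (Word.cons c (Word.cons c.dual w.tail.tail)) := by
    rw [rep_act _ _ (by omega) (by omega), rep_act _ _ (by omega) (by omega)]
    exact if_pos hw
  simp only [sym_zero]
  rw [← map_sum, smul_eq_C_mul, ← map_mul]
  exact congrArg C h1

/-- The cap sums over dual pairs of letters at the first two places. The last letter of the word is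
the dual of `(1, 0)`, which leaves a single summand, a test word of the identity. -/
theorem sym_capCupWord_ne_zero :
    sym 0 (fam (rotAll (b + 2) (b + 2) (capCup b))) 1 (capCupWord b) ≠ 0 := by
  rw [rotAll_capCup, sym_cup_cap (by simp only [bent_eq]; omega) _ rfl]
  refine smul_ne_zero (sgn_ne_zero _ _) ?_
  have htail : ∀ n, 2 ≤ n → ∀ c : Letter (Fin (b + 2)),
      Word.cons c (Word.cons c.dual (capCupWord b).tail.tail) n = capCupWord b n := by
    intro n hn c
    obtain ⟨n, rfl⟩ : ∃ k, n = k + 2 := ⟨n - 2, by omega⟩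
    rfl
  have hlast : capCupWord b (2 * b + 3) = (1, 1) := by
    simp [capCupWord]
  have hlast' : capCupWord b (2 * b + 2) = (1, 0) := by
    simp [capCupWord]
  have hmid : ∀ n, 2 ≤ n → n < 2 * b + 2 → capCupWord b n = nestWord b n := by
    intro n h1 h2
    rw [capCupWord, if_neg (by omega), if_neg (by omega), if_neg (by omega), if_neg (by omega)]
  rw [Finset.sum_eq_single ((1, 0) : Letter (Fin (b + 2)))]
  · obtain ⟨ε, hε, h⟩ := exists_sym_rotAll_one (b + 2)
      (w := Word.cons (1, 0) (Word.cons (Letter.dual (1, 0)) (capCupWord b).tail.tail)) (by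
        intro i hi
        rw [htail _ (by omega)]
        rcases i with _ | _ | i
        · rw [show 2 * (b + 2) - 1 - 0 = 2 * b + 3 by omega, hlast]
          rfl
        · rw [show 2 * (b + 2) - 1 - (0 + 1) = 2 * b + 2 by omega, hlast']
          exact (Letter.dual_dual _).symm
        · rw [htail _ (by omega), hmid _ (by omega) (by omega), hmid _ (by omega) (by omega)]
          exact nestWord_dual hi)
    rw [h]
    exact (map_ne_zero_iff _ (C_injective _ _)).2 hε
  · intro c _ hc
    refine sym_rotAll_one_eq_zero (b + 2) (i := 0) (by omega) ?_
    rw [htail _ (by omega), show 2 * (b + 2) - 1 - 0 = 2 * b + 3 by omega, hlast,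
      Word.cons_zero]
    intro h
    exact hc (((Letter.eq_dual_comm _ _).1 h).trans rfl)
  · intro h
    exact absurd (Finset.mem_univ _) h

end CapCup

/-- The place of the `i`-th variable. -/
def capCupPos (b : ℕ) (i : Fin (b + 2)) : ℕ := if i = 1 then 2 * b + 3 else i

theorem two_le_val {b : ℕ} {i : Fin (b + 2)} (h0 : i ≠ 0) (h1 : i ≠ 1) : 2 ≤ (i : ℕ) := by
  rw [Ne, Fin.ext_iff] at h0 h1
  simp only [Fin.val_zero, Fin.val_one] at h0 h1
  omega

theorem rotAll_dotPoly_mul_capCup {b : ℕ} (P : MvPolynomial (Fin (b + 2)) ℂ) :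
    rotAll (b + 2) (b + 2) (dotPoly (b + 2) P * capCup b) =
      polyAct 0 (bent (b + 2) (b + 2)) (rename (capCupPos b) (aeval (fun i : Fin (b + 2) =>
        if i = 0 then X 0 else if i = 1 then X 0 - 1 else X i) P))
        (rotAll (b + 2) (b + 2) (capCup b)) := by
  have h1 := congrArg (rotAll (b + 2) (b + 2)) (dotPoly_mul P (capCup b))
  refine h1.trans ((rotAll_polyAct P (capCup b)).trans ?_)
  have h2 : rename Fin.val = aeval (fun i : Fin (b + 2) => (X i : MvPolynomial ℕ ℂ)) := by
    ext i
    simp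
  rw [h2]
  refine (polyAct_rename_aeval (fun i => ?_) P).symm
  rw [polyAct_X]
  by_cases h0 : i = 0
  · subst h0
    simp [capCupPos, polyAct_X]
  by_cases h1 : i = 1
  · subst h1
    simp only [one_ne_zero, if_false, if_true, map_sub, rename_X, map_one, polyAct_X,
      LinearMap.sub_apply, Module.End.one_apply, Fin.val_one]
    exact (dotAt_one_rotAll_capCup b).symm
  · rw [if_neg h0, if_neg h1, rename_X, polyAct_X, capCupPos, if_neg h1]

/-- On the right of the cap-cup the dots of the first two source strands become the last two target
dots, each plus 1, and these differ by 1. Hence both are expressed by the very last place, which is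
where `capCupPos` puts the variable 1; the symmetry of `P` chooses which of the two comes first. -/
theorem rotAll_capCup_mul_dotPoly {b : ℕ} {P : MvPolynomial (Fin (b + 2)) ℂ}
    (hP : P.IsSymmetric) :
    rotAll (b + 2) (b + 2) (capCup b * dotPoly (b + 2) P) =
      polyAct 0 (bent (b + 2) (b + 2)) (rename (capCupPos b) (aeval (fun i : Fin (b + 2) =>
        if i = 0 then X 1 + 2 else if i = 1 then X 1 + 1 else X i) P))
        (rotAll (b + 2) (b + 2) (capCup b)) := by
  rw [rotAll_mul_dotPoly, ← hP (Equiv.swap 0 1), aeval_rename, hP]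
  refine (polyAct_rename_aeval (fun i => ?_) P).symm
  rw [Function.comp_apply, map_add (polyAct 0 (bent (b + 2) (b + 2))) (X _) 1, polyAct_X, map_one,
    LinearMap.add_apply, Module.End.one_apply]
  by_cases h0 : i = 0
  · subst h0
    rw [if_pos rfl, Equiv.swap_apply_left, map_add, rename_X, map_ofNat, map_add, polyAct_X,
      map_ofNat, LinearMap.add_apply, capCupPos, if_pos rfl, Fin.val_one,
      show b + 2 + (b + 2) - 1 - 1 = 2 * b + 2 by omega, dotAt_last_rotAll_capCup,
      show (2 : Module.End ℂ (Mor 0 (bent (b + 2) (b + 2)))) = 1 + 1 by norm_num,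
      LinearMap.add_apply, Module.End.one_apply, add_assoc]
  by_cases h1 : i = 1
  · subst h1
    rw [if_neg h0, if_pos rfl, Equiv.swap_apply_right, map_add, rename_X, map_one, map_add,
      polyAct_X, map_one, LinearMap.add_apply, Module.End.one_apply, capCupPos, if_pos rfl,
      Fin.val_zero, show b + 2 + (b + 2) - 1 - 0 = 2 * b + 3 by omega]
  · rw [if_neg h0, if_neg h1, rename_X, polyAct_X, capCupPos, if_neg h1,
      Equiv.swap_apply_of_ne_of_ne h0 h1]
    exact (dotAt_rotAll_capCup b (two_le_val h0 h1) i.2).symm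

/-- The variables 0 and 1 stand for dots on two different arcs of the cap-cup diagram and are
independent by freeness, so the commutation is an identity of polynomials. -/
theorem aeval_eq_of_comm {b : ℕ} {P : MvPolynomial (Fin (b + 2)) ℂ}
    (hP : ∀ z, dotPoly (b + 2) P * z = z * dotPoly (b + 2) P) :
    aeval (fun i : Fin (b + 2) => if i = 0 then X 0 else if i = 1 then X 0 - 1 else X i) P =
      aeval (fun i : Fin (b + 2) => if i = 0 then X 1 + 2 else if i = 1 then X 1 + 1
        else (X i : MvPolynomial (Fin (b + 2)) ℂ)) P := by
  have h1 := congrArg (rotAll (b + 2) (b + 2)) (hP (capCup b))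
  rw [rotAll_dotPoly_mul_capCup, rotAll_capCup_mul_dotPoly (isSymmetric_of_comm hP)] at h1
  refine sub_eq_zero.1 (eq_zero_of_polyAct_add_eq_zero (pos := capCupPos b) (w := capCupWord b)
    (fun i => ?_) (rotAll_capCup_mem_reg b) ?_ (sym_capCupWord_ne_zero b) (zero_mem _) ?_)
  · simp only [capCupPos, bent_eq]
    split_ifs <;> omega
  · have hlab : ∀ i, (capCupWord b (capCupPos b i)).1 = i := by
      intro i
      by_cases h0 : i = 0
      · subst h0
        rfl
      by_cases h1 : i = 1
      · subst h1
        simp [capCupPos, capCupWord]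
      · have hi := two_le_val h0 h1
        rw [capCupPos, if_neg h1, capCupWord, if_neg (by omega), if_neg (by omega),
          if_neg (by omega), if_neg (by omega)]
        exact nestWord_val i
    simp only [hlab]
    exact fun i j h => h
  · rw [add_zero, map_sub, map_sub, LinearMap.sub_apply, h1, sub_self]

end AffineVW

namespace AffineVW

/-! ### Central polynomials are constant on the hyperplanes `X_i = X_j + 1` -/

open MvPolynomial

/-- Replace the first two coordinates by `s` and `s - 1`. -/
def withHead {b : ℕ} (s : ℂ) (v : Fin (b + 2) → ℂ) : Fin (b + 2) → ℂ :=
  fun i => if i = 0 then s else if i = 1 then s - 1 else v i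

section Head

variable {b : ℕ} {P : MvPolynomial (Fin (b + 2)) ℂ}

theorem eval_comp_perm (hP : P.IsSymmetric) (σ : Equiv.Perm (Fin (b + 2)))
    (v : Fin (b + 2) → ℂ) : eval (v ∘ σ) P = eval v P := by
  rw [← eval_rename, hP]

theorem eval_withHead_eq (hP : ∀ z, dotPoly (b + 2) P * z = z * dotPoly (b + 2) P) (s t : ℂ)
    (v : Fin (b + 2) → ℂ) : eval (withHead s v) P = eval (withHead t v) P := by
  -- With coordinate 1 equal to `t - 2`, the expressions `X 1 + 2` and `X 1 + 1` take the values `t`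
  -- and `t - 1`.
  let u : Fin (b + 2) → ℂ := fun i => if i = 0 then s else if i = 1 then t - 2 else v i
  have h := congrArg (aeval u) (aeval_eq_of_comm hP)
  rw [comp_aeval_apply, comp_aeval_apply] at h
  have h1 : (fun i : Fin (b + 2) => aeval u (if i = 0 then X 0 else if i = 1 then X 0 - 1
      else (X i : MvPolynomial (Fin (b + 2)) ℂ))) = withHead s v := by
    funext i
    by_cases h0 : i = 0
    · simp [withHead, u, h0]
    by_cases h1 : i = 1
    · simp [withHead, u, h1]
    · simp [withHead, u, h0, h1]
  have h2 : (fun i : Fin (b + 2) => aeval u (if i = 0 then X 1 + 2 else if i = 1 then X 1 + 1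
      else (X i : MvPolynomial (Fin (b + 2)) ℂ))) = withHead t v := by
    funext i
    by_cases h0 : i = 0
    · simp [withHead, u, h0]
    by_cases h1 : i = 1
    · simp only [withHead, u, h1, one_ne_zero, if_true, if_false, map_add, aeval_X, map_one]
      ring
    · simp [withHead, u, h0, h1]
  rw [h1, h2] at h
  exact h

variable (hP : ∀ z, dotPoly (b + 2) P * z = z * dotPoly (b + 2) P)
include hP

/-- The free parameter `s` can be chosen so that the first two coordinates and the `k`-th one fill
`τ, τ + 1, τ + 2`. The triples `(τ + 1, τ, τ + 2)` and `(τ + 2, τ + 1, τ)` are permutations of each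
other. -/
theorem eval_withHead_update_add_two (s τ : ℂ) (v : Fin (b + 2) → ℂ) {k : Fin (b + 2)}
    (h0 : k ≠ 0) (h1 : k ≠ 1) : eval (withHead s (Function.update v k (τ + 2))) P =
      eval (withHead s (Function.update v k τ)) P := by
  rw [eval_withHead_eq hP s (τ + 1), eval_withHead_eq hP s (τ + 2) (Function.update v k τ),
    ← eval_comp_perm (isSymmetric_of_comm hP) (Equiv.swap 0 1 * Equiv.swap 0 k)]
  congr 1
  congr 1
  funext i
  rw [Function.comp_apply, Equiv.Perm.mul_apply]
  by_cases hi0 : i = 0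
  · subst hi0
    rw [Equiv.swap_apply_left, Equiv.swap_apply_of_ne_of_ne h0 h1]
    simp [withHead, h0, h1]
  by_cases hi1 : i = 1
  · subst hi1
    rw [Equiv.swap_apply_of_ne_of_ne hi0 h1.symm, Equiv.swap_apply_right]
    simp only [withHead, if_true, one_ne_zero, if_false]
    ring
  by_cases hik : i = k
  · subst hik
    rw [Equiv.swap_apply_right, Equiv.swap_apply_left]
    simp [withHead, h0, h1]
  · rw [Equiv.swap_apply_of_ne_of_ne hi0 hik, Equiv.swap_apply_of_ne_of_ne hi0 hi1]
    simp [withHead, hi0, hi1, hik]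

/-- A polynomial in one variable with period 2 takes one value infinitely often, hence is constant.
-/
theorem eval_withHead_update (s τ : ℂ) (v : Fin (b + 2) → ℂ) (k : Fin (b + 2)) :
    eval (withHead s (Function.update v k τ)) P =
      eval (withHead s (Function.update v k 0)) P := by
  by_cases h0 : k = 0
  · congr 2
    funext i
    by_cases hi : i = 0
    · simp [withHead, hi]
    · simp [withHead, h0, hi]
  by_cases h1 : k = 1
  · congr 2
    funext i
    by_cases hi : i = 1
    · simp [withHead, hi]
    · simp [withHead, h1, hi]
  let q : Polynomial ℂ := aeval (fun i : Fin (b + 2) => if i = k then Polynomial.X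
    else Polynomial.C (withHead s v i)) P
  have hq : ∀ τ, q.eval τ = eval (withHead s (Function.update v k τ)) P := by
    intro τ
    have : Polynomial.aeval τ q = _ := comp_aeval_apply _ (φ := Polynomial.aeval τ) P
    rw [Polynomial.coe_aeval_eq_eval] at this
    rw [this, ← coe_aeval_eq_eval]
    change _ = aeval _ P
    congr 2
    funext i
    by_cases hi : i = k
    · subst hi
      simp [withHead, h0, h1]
    · simp [withHead, hi]
  have hn : ∀ n : ℕ, q.eval (2 * (n : ℂ)) = q.eval 0 := by
    intro n
    induction n with
    | zero => simp
    | succ n ih =>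
      rw [← ih, hq, hq, ← eval_withHead_update_add_two hP s (2 * (n : ℂ)) v h0 h1]
      congr 4
      push_cast
      ring
  have hconst : q = Polynomial.C (q.eval 0) := by
    refine Polynomial.eq_of_infinite_eval_eq _ _ (Set.Infinite.mono ?_
      (Set.infinite_range_of_injective (f := fun n : ℕ => 2 * (n : ℂ)) fun m n h => by
        simpa using h))
    rintro _ ⟨n, rfl⟩
    simp [hn]
  rw [← hq, ← hq, hconst, Polynomial.eval_C, Polynomial.eval_C]

theorem eval_withHead (s : ℂ) (v : Fin (b + 2) → ℂ) :
    eval (withHead s v) P = eval (withHead 0 0) P := by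
  have key : ∀ S : Finset (Fin (b + 2)),
      eval (withHead s fun i => if i ∈ S then 0 else v i) P = eval (withHead s v) P := by
    intro S
    induction S using Finset.induction_on with
    | empty => simp
    | insert k S _ ih =>
      rw [← ih]
      have h1 := eval_withHead_update hP s (if k ∈ S then 0 else v k)
        (fun i => if i ∈ S then 0 else v i) k
      rw [Function.update_eq_self_iff.2 rfl] at h1
      rw [h1]
      congr 2
      congr 1
      funext i
      by_cases hi : i = k
      · simp [hi]
      · simp [hi]
  rw [← key Finset.univ, eval_withHead_eq hP s 0]
  simp only [Finset.mem_univ, if_true]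
  rfl

theorem eval_eq_of_eq_add_one {i j : Fin (b + 2)} (hij : i ≠ j) (v : Fin (b + 2) → ℂ)
    (hv : v i = v j + 1) : eval v P = eval (withHead 0 0) P := by
  -- A permutation with `0 ↦ i` and `1 ↦ j`.
  let σ : Equiv.Perm (Fin (b + 2)) := Equiv.swap (Equiv.swap 0 i 1) j * Equiv.swap 0 i
  have h0 : σ 0 = i := by
    rw [Equiv.Perm.mul_apply, Equiv.swap_apply_left, Equiv.swap_apply_of_ne_of_ne _ hij]
    intro h
    have : Equiv.swap 0 i 0 = Equiv.swap 0 i 1 := (Equiv.swap_apply_left 0 i).trans h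
    exact zero_ne_one ((Equiv.swap 0 i).injective this)
  have h1 : σ 1 = j := by
    rw [Equiv.Perm.mul_apply, Equiv.swap_apply_left]
  rw [← eval_comp_perm (isSymmetric_of_comm hP) σ, ← eval_withHead hP (v i) (v ∘ σ)]
  congr 2
  funext k
  by_cases hk0 : k = 0
  · simp [withHead, hk0, h0]
  by_cases hk1 : k = 1
  · simp [withHead, hk1, h1, hv]
  · simp [withHead, hk0, hk1]

end Head

/-! ### Divisibility by the deformed Vandermonde polynomial -/

section Division

variable {n : ℕ}

/-- A factor theorem: substituting `X j + 1` for `X i` does not change the class modulo `X i - X j -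
1`, and the result is zero because it vanishes at every point. -/
theorem dvd_of_eval_eq_zero {i j : Fin n} (hij : i ≠ j) {g : MvPolynomial (Fin n) ℂ}
    (hg : ∀ v : Fin n → ℂ, v i = v j + 1 → eval v g = 0) : X i - X j - 1 ∣ g := by
  let u : Fin n → MvPolynomial (Fin n) ℂ := fun k => if k = i then X j + 1 else X k
  have h1 : aeval u g = 0 := by
    refine MvPolynomial.funext fun v => ?_
    have h2 : aeval v (aeval u g) = _ := comp_aeval_apply _ (φ := aeval v) g
    rw [map_zero]
    refine h2.trans (hg _ ?_)
    simp [u, hij.symm]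
  have h2 : (Ideal.Quotient.mkₐ ℂ (Ideal.span {X i - X j - 1})).comp (aeval u) =
      Ideal.Quotient.mkₐ ℂ (Ideal.span {(X i - X j - 1 : MvPolynomial (Fin n) ℂ)}) := by
    ext k
    rw [AlgHom.comp_apply, aeval_X]
    by_cases hk : k = i
    · subst hk
      simp only [u, if_true, Ideal.Quotient.mkₐ_eq_mk]
      rw [eq_comm, Ideal.Quotient.eq, Ideal.mem_span_singleton, sub_sub]
    · simp only [u, if_neg hk]
  have h3 := DFunLike.congr_fun h2 g
  rw [AlgHom.comp_apply, h1, map_zero, eq_comm, Ideal.Quotient.mkₐ_eq_mk,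
    Ideal.Quotient.eq_zero_iff_mem, Ideal.mem_span_singleton] at h3
  exact h3

theorem irreducible_X_sub_X_sub_one {i j : Fin n} (hij : i ≠ j) :
    Irreducible (X i - X j - 1 : MvPolynomial (Fin n) ℂ) := by
  refine irreducible_of_totalDegree_eq_one (le_antisymm ?_ ?_) fun x hx => ?_
  · refine (totalDegree_sub _ _).trans (max_le ((totalDegree_sub _ _).trans (max_le ?_ ?_)) ?_)
    all_goals simp
  · by_contra! h
    have h1 := totalDegree_eq_zero_iff_eq_C.1 (Nat.lt_one_iff.1 h)
    have h2 := congrArg (eval (Pi.single i 1)) h1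
    have h3 := congrArg (eval 0) h1
    simp [hij.symm] at h2 h3
  · refine isUnit_iff_ne_zero.2 fun h => ?_
    have := hx (Finsupp.single i 1)
    rw [h, zero_dvd_iff] at this
    simp [coeff_X, Finsupp.single_left_inj, hij.symm, coeff_one,
      eq_comm (a := (0 : Fin n →₀ ℕ))] at this

theorem isRelPrime_X_sub_X_sub_one {i j k l : Fin n} (hij : i ≠ j)
    (h : ¬ (i = k ∧ j = l)) :
    IsRelPrime (X i - X j - 1 : MvPolynomial (Fin n) ℂ) (X k - X l - 1) := by
  rw [(irreducible_X_sub_X_sub_one hij).isRelPrime_iff_not_dvd]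
  rintro ⟨q, hq⟩
  refine h ⟨?_, ?_⟩
  · by_contra hne
    -- The `i`-th unit vector is a zero of the first polynomial, but for `k ≠ i` the second takes
    -- the value -1 or -2 there. The negative of the `j`-th unit vector does the same for `l ≠ j`.
    have := congrArg (eval (Pi.single i 1)) hq
    simp [Pi.single_apply, Ne.symm hne, hij.symm] at this
    split_ifs at this <;> norm_num at this
  · by_contra hne
    have := congrArg (eval (Pi.single j (-1))) hq
    simp [hij, Pi.single_apply, Ne.symm hne] at this
    split_ifs at this <;> norm_num at this

/-- Each factor splits as `(X i - X j - 1) * -(X j - X i - 1)`. All these linear polynomials are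
irreducible and pairwise coprime, so it suffices that each one divides `g`. -/
theorem deformedVandermonde_dvd {g : MvPolynomial (Fin n) ℂ}
    (hg : ∀ i j : Fin n, i ≠ j → ∀ v : Fin n → ℂ, v i = v j + 1 → eval v g = 0) :
    deformedVandermonde n ∣ g := by
  have hfac : ∀ i j : Fin n, ((X i - X j) ^ 2 - 1 : MvPolynomial (Fin n) ℂ) =
      (X i - X j - 1) * -(X j - X i - 1) := fun i j => by ring
  rw [deformedVandermonde, Finset.prod_sigma']
  refine Finset.prod_dvd_of_isRelPrime ?_ ?_
  · rintro ⟨i, j⟩ hij ⟨k, l⟩ hkl hne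
    have hij : i < j := by simpa using hij
    have hkl : k < l := by simpa using hkl
    have hne : ¬ (i = k ∧ j = l) := by
      rintro ⟨rfl, rfl⟩
      exact hne rfl
    simp only [Function.onFun, hfac]
    refine IsRelPrime.mul_left (IsRelPrime.mul_right ?_ (IsRelPrime.neg_right ?_))
      (IsRelPrime.neg_left (IsRelPrime.mul_right ?_ (IsRelPrime.neg_right ?_)))
    · exact isRelPrime_X_sub_X_sub_one hij.ne hne
    · refine isRelPrime_X_sub_X_sub_one hij.ne fun h => ?_
      obtain ⟨rfl, rfl⟩ := h
      exact lt_asymm hij hkl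
    · refine isRelPrime_X_sub_X_sub_one hij.ne' fun h => ?_
      obtain ⟨rfl, rfl⟩ := h
      exact lt_asymm hij hkl
    · exact isRelPrime_X_sub_X_sub_one hij.ne' fun h => hne h.symm
  · rintro ⟨i, j⟩ hij
    have hij : i < j := by simpa using hij
    simp only [hfac]
    refine IsRelPrime.mul_dvd (IsRelPrime.neg_right ?_) ?_ (neg_dvd.2 ?_)
    · exact isRelPrime_X_sub_X_sub_one hij.ne fun h => hij.ne h.1
    · exact dvd_of_eval_eq_zero hij.ne (hg i j hij.ne)
    · exact dvd_of_eval_eq_zero hij.ne' (hg j i hij.ne')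

end Division

/-- The constant is the common value of `P` on the hyperplanes. The quotient is symmetric because
`P` and the deformed Vandermonde polynomial are, by cancellation in a domain. -/
theorem exists_eq_deformedVandermonde_mul {b : ℕ} {P : MvPolynomial (Fin (b + 2)) ℂ}
    (hP : ∀ z, dotPoly (b + 2) P * z = z * dotPoly (b + 2) P) :
    ∃ (p : MvPolynomial (Fin (b + 2)) ℂ) (c : ℂ), p.IsSymmetric ∧
      P = deformedVandermonde (b + 2) * p + C c := by
  set c := eval (withHead 0 0) P with hc
  obtain ⟨p, hp⟩ : deformedVandermonde (b + 2) ∣ P - C c :=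
    deformedVandermonde_dvd fun i j hij v hv => by
      rw [map_sub, eval_C, eval_eq_of_eq_add_one hP hij v hv, hc, sub_self]
  refine ⟨p, c, fun σ => ?_, by rw [← hp, sub_add_cancel]⟩
  have h1 := congrArg (rename σ) hp
  rw [map_sub, isSymmetric_of_comm hP σ, rename_C, hp, map_mul,
    deformedVandermonde_isSymmetric] at h1
  exact (mul_left_cancel₀ (deformedVandermonde_ne_zero _) h1).symm

end AffineVW

theorem mainTheorem3 (a : ℕ) (ha : 2 ≤ a) :
    Function.Injective (AffineVW.dotPoly a) ∧
    ∀ f : AffineVW.sVW a,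
      f ∈ Subalgebra.center ℂ (AffineVW.sVW a) ↔
        ∃ (p : MvPolynomial (Fin a) ℂ) (c : ℂ), p.IsSymmetric ∧
          f = AffineVW.dotPoly a (AffineVW.deformedVandermonde a * p + MvPolynomial.C c) := by
  obtain ⟨b, rfl⟩ : ∃ b, a = b + 2 := ⟨a - 2, by omega⟩
  refine ⟨AffineVW.dotPoly_injective b, fun f => ?_⟩
  rw [Subalgebra.mem_center_iff]
  constructor
  · intro hf
    obtain ⟨P, rfl⟩ := AffineVW.exists_eq_dotPoly (by omega) f fun i => (hf _).symm
    obtain ⟨p, c, hp, rfl⟩ := AffineVW.exists_eq_deformedVandermonde_mul fun z => (hf z).symm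
    exact ⟨p, c, hp, rfl⟩
  · rintro ⟨p, c, hp, rfl⟩ z
    rw [map_add, mul_add, add_mul, AffineVW.dotPoly_mul_comm hp, ← MvPolynomial.algebraMap_eq,
      AlgHom.commutes, Algebra.commutes]
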